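/- **Setting.** Let $\Omega\subset\mathbb R^2$ be a bounded polygonal domain (open, connected, equal to the interior of its closure, with boundary a finite union of segments), and let $\Gamma^u,\Gamma^\sigma\subset\partial\Omega$ be disjoint, relatively open, of positive length, with $\partial\Omega=\overline{\Gamma^u}\cup\overline{\Gamma^\sigma}$ and $\overline{\Gamma^u}\cap\overline{\Gamma^\sigma}$ finite. Let $\mathcal T_h$ be a finite set of pairwise disjoint open simple polygons $K\subset\Omega$ with $\overline\Omega=\bigcup_K\overline K$ (consecutive edges of $K$ may be collinear). For some $\eta_1,\eta_2>0$, each $K$, of diameter $h_K$, is star-shaped with respect to a ball of radius greater than $\eta_1h_K$, and each edge of $K$ has length at least $\eta_2h_K$. Let $k\ge1$. Write $(\cdot,\cdot)$ for the $L^2(\Omega)$ inner product of vector or tensor fields, $\mathbf{div}$ and $\mathbf{curl}$ for the row-wise weak divergence and weak curl ($\mathrm{curl}(a,b)=\partial_1b-\partial_2a$ for a row $(a,b)$), and $\boldsymbol n$ for the outward unit normal, normal traces being understood weakly through Green's formula. **Discrete spaces.** $\mathbb S(K)$ is the space of tensor fields $\tau\in\mathbb H(\mathbf{div},K)\cap\mathbb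 H(\mathbf{curl},K)$ such that $\tau\boldsymbol n|_F$ is a vector polynomial of degree $\le k$ on each edge $F$ of $K$, $\mathbf{div}\,\tau$ is a polynomial of degree $\le k$ on $K$, and $\mathbf{curl}\,\tau$ is a polynomial of degree $\le k-1$ on $K$. Let $$\mathbb S_h=\{\tau\in\mathbb H(\mathbf{div},\Omega):\ \tau\boldsymbol n=0\text{ on }\Gamma^\sigma,\ \tau|_K\in\mathbb S(K)\ \forall K\in\mathcal T_h\},$$ let $\mathbf V_h$ be the space of vector fields that are polynomials of degree $\le k$ on each $K$, and $\mathbb K_h$ the space of skew-symmetric tensor fields that are polynomials of degree $\le k$ on each $K$. All carry the $L^2(\Omega)$ inner product. **Discrete forms.** For $m\ge 0$ let $\mathbb G_m$ be the space of gradients of vector polynomials of degree $\le m+1$, and $\mathbb G_m^\perp(K)$ its $L^2(K)$-orthogonal complement in the tensor polynomials of degree $\le m$. On each $K$ choose any basis of $\mathbb G_{k-1}$ and any basis of $\mathbb G_k^\perp(K)$. The degrees of freedom $\chi_i$ of $\tau\in\mathbb S(K)$ are $\frac1{|F|}\int_F\tau\boldsymbol n\cdot w$, where $F$ is an edge of $K$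 with midpoint $x_F$ and length $h_F$, and $w$ is a vector with one component $s^\beta$, $0\le\beta\le k$, and the other $0$, with $s=(x-x_F)/h_F$ the normalised arc-length variable on $F$; and $\frac1{|K|}\int_K\tau:g$ for $g$ in the two chosen bases. Let $S_h^K(\sigma,\tau)=|K|\sum_i\chi_i(\sigma)\chi_i(\tau)$, and let $\Pi$ be the $L^2(K)$-orthogonal projection onto tensor polynomials of degree $\le k$. For Lamé parameters $\mu>0$, $\lambda$ with $2\mu+2\lambda>0$, put $$a_h(\sigma,\tau)=\sum_{K}\Big[\frac1{2\mu}\Big(\int_K\Pi\sigma:\Pi\tau-\frac{\lambda}{2\mu+2\lambda}\int_K\mathrm{tr}(\Pi\sigma)\,\mathrm{tr}(\Pi\tau)\Big)+S_h^K(\sigma-\Pi\sigma,\tau-\Pi\tau)\Big].$$ Let $a_{0,h},a_{1,h},a_{0,h}'$ be these forms for the pairs $(\mu_0,\lambda_0),(\mu_1,\lambda_1),(\mu_0',\lambda_0')$. Let $\varrho>0$ be constant, $T>0$ and $\boldsymbol f\in C([0,T],L^2(\Omega)^2)$. **The problem.** Define $A_0,A_1,A_0':\mathbb S_h\to\mathbb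 S_h$ by $(A_*\sigma,\tau)=a_{*,h}(\sigma,\tau)$ for all $\tau\in\mathbb S_h$ (with $A_0'$ belonging to $a_{0,h}'$), $H:\mathbb S_h\to\mathbb K_h$ by $(H\sigma,\eta)=(\sigma,\eta)$ for all $\eta\in\mathbb K_h$, $J:\mathbb S_h\to\mathbf V_h$ by $(J\sigma,w)=(\mathbf{div}\,\sigma,w)$ for all $w\in\mathbf V_h$, $M=\varrho\,\mathrm{Id}$ on $\mathbf V_h$, and $F(t)\in\mathbf V_h$ by $(F(t),w)=(\varrho\boldsymbol f(t),w)$ for all $w\in\mathbf V_h$. On $X_h=\mathbb S_h\times\mathbb S_h\times\mathbf V_h\times\mathbb K_h$ let $$\mathscr A=\begin{bmatrix}A_0&0&0&H^*\\0&A_1&0&H^*\\0&0&M&0\\H&H&0&0\end{bmatrix},\quad\mathscr B=\begin{bmatrix}-A_0'&0&-J^*&0\\0&0&-J^*&0\\J&J&0&0\\0&0&0&0\end{bmatrix},\quad\mathscr C=\begin{bmatrix}0\\0\\F\\0\end{bmatrix}.$$ **Lemma.** The operator $\mathscr A$ is bijective, and for every $\vec x_0\in X_h$ there is exactly one $\vec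 x_h\in C^1([0,T],X_h)$ with $\vec x_h(0)=\vec x_0$ and $$\mathscr A\,\dot{\vec x}_h=\mathscr B\,\vec x_h+\mathscr C\quad\text{on }[0,T].$$ Moreover, $\vec x_h=(\sigma_0,\sigma_1,v,r)\in C^1([0,T],X_h)$ satisfies this system if and only if, for every $t\in[0,T]$, $$\begin{aligned}a_{0,h}(\dot\sigma_0,\tau)+a_{0,h}'(\sigma_0,\tau)+(\mathbf{div}\,\tau,v)+(\tau,\dot r)&=0&&\forall\tau\in\mathbb S_h,\\ a_{1,h}(\dot\sigma_1,\tau)+(\mathbf{div}\,\tau,v)+(\tau,\dot r)&=0&&\forall\tau\in\mathbb S_h,\\(\varrho\dot v,w)-(\mathbf{div}(\sigma_0+\sigma_1),w)-(\varrho\boldsymbol f,w)&=0&&\forall w\in\mathbf V_h,\\(\dot\sigma_0+\dot\sigma_1,\eta)&=0&&\forall\eta\in\mathbb K_h.\end{aligned}$$ -/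

import Mathlib

open MeasureTheory Set
open scoped ContDiff

noncomputable section

namespace ViscoVEM

/-- The Euclidean plane. -/
abbrev E : Type := EuclideanSpace ℝ (Fin 2)

/-- `2 × 2` tensors, stored by rows, with the Frobenius inner product;
`τ i j` is the entry in row `i` and column `j`. -/
abbrev Tens : Type := PiLp 2 (fun _ : Fin 2 => E)

/-- The Hilbert space `L²(U; F)`. -/
abbrev L2 (U : Set E) (F : Type) [NormedAddCommGroup F] : Type :=
  Lp F 2 (volume.restrict U)

/-! ### Weak divergence, weak curl, normal traces -/

/-- Smooth compactly supported scalar functions on the plane. -/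
def IsTest (φ : E → ℝ) : Prop := ContDiff ℝ ∞ φ ∧ HasCompactSupport φ

/-- `∫_U (τᵢ · ∇φ + dᵢ φ) dx`, where `τᵢ` is the `i`-th row of `τ`. -/
def green (U : Set E) (φ : E → ℝ) (τ : E → Tens) (d : E → E) (i : Fin 2) : ℝ :=
  ∫ x in U, (fderiv ℝ φ x (τ x i) + d x i * φ x)

/-- `τ ∈ L²(U)` has the weak (row-wise) divergence `d ∈ L²(U)` in the open set `U`. -/
def HasWeakDiv (U : Set E) (τ : E → Tens) (d : E → E) : Prop :=
  MemLp τ 2 (volume.restrict U) ∧ MemLp d 2 (volume.restrict U) ∧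
    ∀ φ, IsTest φ → tsupport φ ⊆ U → ∀ i, green U φ τ d i = 0

/-- The row-wise rotation `(a, b) ↦ (b, -a)`. -/
def rotRows (t : Tens) : Tens := WithLp.toLp 2 fun i => !₂[t i 1, -(t i 0)]

/-- `τ ∈ L²(U)` has the weak (row-wise) curl `c ∈ L²(U)`. The curl of a plane field `(a, b)` is
the scalar `∂₁ b - ∂₂ a`, which is the divergence of `(b, -a)`. -/
def HasWeakCurl (U : Set E) (τ : E → Tens) (c : E → E) : Prop :=
  HasWeakDiv U (fun x => rotRows (τ x)) c

/-! ### Polynomials -/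

/-- Real polynomials in two variables of total degree at most `k`. -/
abbrev Poly (k : ℕ) : Submodule ℝ (MvPolynomial (Fin 2) ℝ) :=
  MvPolynomial.restrictTotalDegree (Fin 2) ℝ k

/-- The vector field given by a pair of polynomials. -/
def evalVec (p : Fin 2 → MvPolynomial (Fin 2) ℝ) (x : E) : E :=
  WithLp.toLp 2 fun j => MvPolynomial.eval (fun l => x l) (p j)

/-- The tensor field given by a matrix of polynomials. -/
def evalTens (p : Fin 2 → Fin 2 → MvPolynomial (Fin 2) ℝ) (x : E) : Tens :=
  WithLp.toLp 2 fun i => evalVec (p i) x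

/-- `d` coincides (almost everywhere) on `K` with a vector polynomial of degree at most `k`. -/
def IsPolyVec (k : ℕ) (K : Set E) (d : E → E) : Prop :=
  ∃ p : Fin 2 → MvPolynomial (Fin 2) ℝ, (∀ j, p j ∈ Poly k) ∧
    ∀ᵐ x ∂volume.restrict K, d x = evalVec p x

/-- `τ` coincides (almost everywhere) on `K` with a tensor polynomial of degree at most `k`. -/
def IsPolyTens (k : ℕ) (K : Set E) (τ : E → Tens) : Prop :=
  ∃ p : Fin 2 → Fin 2 → MvPolynomial (Fin 2) ℝ, (∀ i j, p i j ∈ Poly k) ∧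
    ∀ᵐ x ∂volume.restrict K, τ x = evalTens p x

/-- Gradients of vector polynomials of degree at most `m + 1`. -/
def gradPoly (m : ℕ) : Submodule ℝ (Fin 2 → Fin 2 → MvPolynomial (Fin 2) ℝ) where
  carrier := {g | ∃ q : Fin 2 → MvPolynomial (Fin 2) ℝ, (∀ i, q i ∈ Poly (m + 1)) ∧
    ∀ i j, g i j = MvPolynomial.pderiv j (q i)}
  zero_mem' := ⟨0, fun _ => Submodule.zero_mem _, fun _ _ => by simp⟩
  add_mem' := by
    rintro a b ⟨q, hq, h⟩ ⟨q', hq', h'⟩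
    exact ⟨q + q', fun i => Submodule.add_mem _ (hq i) (hq' i), fun i j => by simp [h, h']⟩
  smul_mem' := by
    rintro c a ⟨q, hq, h⟩
    exact ⟨c • q, fun i => Submodule.smul_mem _ c (hq i), fun i j => by simp [h]⟩

/-! ### Polygons, meshes, domains -/

/-- A simple polygon: a bounded connected open set whose boundary is a simple closed polygonal
line. Consecutive edges may be collinear (hanging nodes). -/
structure Element where
  n : ℕ
  three_le : 3 ≤ n
  poly : Polygon E n
  injective : Function.Injective poly.vertices
  edges_inter : ∀ e e' : Fin n, e ≠ e' → poly.edgeSet ℝ e ∩ poly.edgeSet ℝ e' ⊆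
    {poly e, poly (finRotate n e)} ∩ {poly e', poly (finRotate n e')}
  carrier : Set E
  isOpen : IsOpen carrier
  isConnected : IsConnected carrier
  isBounded : Bornology.IsBounded carrier
  frontier_eq : frontier carrier = poly.boundary ℝ

/-- The length of an edge. -/
def Element.edgeLength (P : Element) (e : Fin P.n) : ℝ :=
  dist (P.poly e) (P.poly (finRotate P.n e))

/-- The point `x_F + s (b - a)` of the edge `F = [a, b]` with midpoint `x_F`, for
`s ∈ [-1/2, 1/2]`; thus `s` is the normalised variable `(x - x_F) / h_F` on `F`. -/
def Element.edgePoint (P : Element) (e : Fin P.n) (s : ℝ) : E :=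
  P.poly.edgePath ℝ e (s + 1 / 2)

/-- The normal trace of `τ ∈ H(div, K)` is, on each edge `e`, the vector polynomial `g e`
(written in the normalised variable of the edge). -/
def HasNormalTrace (P : Element) (τ : E → Tens)
    (g : Fin P.n → Fin 2 → Polynomial ℝ) : Prop :=
  ∃ d, HasWeakDiv P.carrier τ d ∧ ∀ φ, IsTest φ → ∀ i,
    green P.carrier φ τ d i =
      ∑ e, P.edgeLength e * ∫ s in (-(1 / 2) : ℝ)..(1 / 2), (g e i).eval s * φ (P.edgePoint e s)

/-- The local virtual element space `𝕊(K)`: fields of `H(div, K) ∩ H(curl, K)` whose normal trace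
is a polynomial of degree at most `k` on each edge, whose divergence is a polynomial of degree at
most `k`, and whose curl is a polynomial of degree at most `k - 1`. -/
def MemLocalStress (k : ℕ) (P : Element) (τ : E → Tens) : Prop :=
  (∃ d, HasWeakDiv P.carrier τ d ∧ IsPolyVec k P.carrier d) ∧
  (∃ c, HasWeakCurl P.carrier τ c ∧ IsPolyVec (k - 1) P.carrier c) ∧
  ∃ g : Fin P.n → Fin 2 → Polynomial ℝ, (∀ e i, (g e i).natDegree ≤ k) ∧ HasNormalTrace P τ g

/-- A polygonal domain: bounded, open, connected, equal to the interior of its closure (no slits),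
with boundary a finite union of segments. -/
structure IsPolygonalDomain (Ω : Set E) : Prop where
  isOpen : IsOpen Ω
  isConnected : IsConnected Ω
  isBounded : Bornology.IsBounded Ω
  interior_closure : interior (closure Ω) = Ω
  frontier_eq : ∃ s : Finset (E × E), frontier Ω = ⋃ p ∈ s, segment ℝ p.1 p.2

/-- The boundary of `Ω` is split into two disjoint relatively open parts of positive length, which
meet at finitely many points. -/
structure IsBoundaryPartition (Ω Γu Γσ : Set E) : Prop where
  isOpen_u : ∃ O, IsOpen O ∧ Γu = O ∩ frontier Ω
  isOpen_σ : ∃ O, IsOpen O ∧ Γσ = O ∩ frontier Ω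
  disjoint : Disjoint Γu Γσ
  cover : frontier Ω = closure Γu ∪ closure Γσ
  finite_inter : (closure Γu ∩ closure Γσ).Finite
  pos_u : 0 < Measure.hausdorffMeasure 1 Γu
  pos_σ : 0 < Measure.hausdorffMeasure 1 Γσ

/-- A polygonal mesh of `Ω`: finitely many disjoint open polygons, the closures of which
cover `Ω`. -/
structure Mesh (Ω : Set E) where
  N : ℕ
  elem : Fin N → Element
  subset : ∀ K, (elem K).carrier ⊆ Ω
  disjoint : ∀ K K', K ≠ K' → Disjoint (elem K).carrier (elem K').carrier
  cover : closure Ω = ⋃ K, closure (elem K).carrier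

/-- Each element `K` is star-shaped with respect to a ball of radius greater than `η₁ h_K`, and
each of its edges is of length at least `η₂ h_K`. -/
def Mesh.IsRegular {Ω : Set E} (𝒯 : Mesh Ω) (η₁ η₂ : ℝ) : Prop :=
  ∀ K, (∃ (c : E) (r : ℝ), η₁ * Metric.diam (𝒯.elem K).carrier < r ∧
      ∀ y ∈ Metric.ball c r, StarConvex ℝ y (𝒯.elem K).carrier) ∧
    ∀ e, η₂ * Metric.diam (𝒯.elem K).carrier ≤ (𝒯.elem K).edgeLength e

/-! ### Auxiliary facts on the notions above -/

theorem integrable_green {U : Set E} {φ : E → ℝ} (hφ : IsTest φ) {τ : E → Tens} {d : E → E}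
    (hτ : MemLp τ 2 (volume.restrict U)) (hd : MemLp d 2 (volume.restrict U)) (i : Fin 2) :
    Integrable (fun x => fderiv ℝ φ x (τ x i) + d x i * φ x) (volume.restrict U) := by
  have hτi : MemLp (fun x => τ x i) 2 (volume.restrict U) :=
    (PiLp.proj (𝕜 := ℝ) 2 (fun _ : Fin 2 => E) i).comp_memLp' hτ
  have hdi : MemLp (fun x => d x i) 2 (volume.restrict U) :=
    (PiLp.proj (𝕜 := ℝ) 2 (fun _ : Fin 2 => ℝ) i).comp_memLp' hd
  have hc : Continuous (fderiv ℝ φ) := hφ.1.continuous_fderiv (by simp)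
  have hD : MemLp (fderiv ℝ φ) 2 (volume.restrict U) :=
    hc.memLp_of_hasCompactSupport (hφ.2.fderiv (𝕜 := ℝ))
  have hφL : MemLp φ 2 (volume.restrict U) :=
    hφ.1.continuous.memLp_of_hasCompactSupport hφ.2
  refine Integrable.add ?_ (MemLp.integrable_mul hdi hφL)
  refine Integrable.mono' (MemLp.integrable_mul hD.norm hτi.norm) ?_ ?_
  · exact (ContinuousLinearMap.apply ℝ ℝ (E := E)).flip.aestronglyMeasurable_comp₂
      hD.aestronglyMeasurable hτi.aestronglyMeasurable
  · exact Filter.Eventually.of_forall fun x => (fderiv ℝ φ x).le_opNorm _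

theorem green_congr {U : Set E} {φ : E → ℝ} {τ τ' : E → Tens} {d d' : E → E}
    (hτ : τ =ᵐ[volume.restrict U] τ') (hd : d =ᵐ[volume.restrict U] d') (i : Fin 2) :
    green U φ τ d i = green U φ τ' d' i := by
  refine integral_congr_ae ?_
  filter_upwards [hτ, hd] with x h h'
  rw [h, h']

theorem green_add {U : Set E} {φ : E → ℝ} (hφ : IsTest φ) {τ τ' : E → Tens} {d d' : E → E}
    (hτ : MemLp τ 2 (volume.restrict U)) (hd : MemLp d 2 (volume.restrict U))
    (hτ' : MemLp τ' 2 (volume.restrict U)) (hd' : MemLp d' 2 (volume.restrict U)) (i : Fin 2) :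
    green U φ (τ + τ') (d + d') i = green U φ τ d i + green U φ τ' d' i := by
  unfold green
  rw [← integral_add (integrable_green hφ hτ hd i) (integrable_green hφ hτ' hd' i)]
  refine integral_congr_ae (Filter.Eventually.of_forall fun x => ?_)
  simp only [Pi.add_apply, PiLp.add_apply, map_add]
  ring

theorem green_smul {U : Set E} {φ : E → ℝ} (c : ℝ) (τ : E → Tens) (d : E → E) (i : Fin 2) :
    green U φ (c • τ) (c • d) i = c * green U φ τ d i := by
  unfold green
  rw [← integral_const_mul]
  refine integral_congr_ae (Filter.Eventually.of_forall fun x => ?_)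
  simp only [Pi.smul_apply, PiLp.smul_apply, map_smul, smul_eq_mul]
  ring

theorem green_zero (U : Set E) (φ : E → ℝ) (i : Fin 2) : green U φ 0 0 i = 0 := by
  simp [green]

theorem HasWeakDiv.congr {U : Set E} {τ τ' : E → Tens} {d : E → E} (h : HasWeakDiv U τ d)
    (hτ : τ =ᵐ[volume.restrict U] τ') : HasWeakDiv U τ' d :=
  ⟨h.1.ae_eq hτ, h.2.1, fun φ hφ hs i => by
    rw [← green_congr hτ (Filter.EventuallyEq.refl _ d)]; exact h.2.2 φ hφ hs i⟩

theorem HasWeakDiv.add {U : Set E} {τ τ' : E → Tens} {d d' : E → E} (h : HasWeakDiv U τ d)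
    (h' : HasWeakDiv U τ' d') : HasWeakDiv U (τ + τ') (d + d') :=
  ⟨h.1.add h'.1, h.2.1.add h'.2.1, fun φ hφ hs i => by
    rw [green_add hφ h.1 h.2.1 h'.1 h'.2.1, h.2.2 φ hφ hs i, h'.2.2 φ hφ hs i, add_zero]⟩

theorem HasWeakDiv.smul {U : Set E} {τ : E → Tens} {d : E → E} (h : HasWeakDiv U τ d) (c : ℝ) :
    HasWeakDiv U (c • τ) (c • d) :=
  ⟨h.1.const_smul c, h.2.1.const_smul c, fun φ hφ hs i => by
    rw [green_smul, h.2.2 φ hφ hs i, mul_zero]⟩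

theorem HasWeakDiv.zero (U : Set E) : HasWeakDiv U 0 0 :=
  ⟨MemLp.zero, MemLp.zero, fun _ _ _ _ => green_zero _ _ _⟩

theorem rotRows_add (s t : Tens) : rotRows (s + t) = rotRows s + rotRows t := by
  ext i j
  fin_cases j <;> simp [rotRows]
  ring

theorem rotRows_smul (c : ℝ) (t : Tens) : rotRows (c • t) = c • rotRows t := by
  ext i j
  fin_cases j <;> simp [rotRows]

theorem HasWeakCurl.congr {U : Set E} {τ τ' : E → Tens} {d : E → E} (h : HasWeakCurl U τ d)
    (hτ : τ =ᵐ[volume.restrict U] τ') : HasWeakCurl U τ' d :=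
  HasWeakDiv.congr h (hτ.fun_comp rotRows)

theorem HasWeakCurl.add {U : Set E} {τ τ' : E → Tens} {d d' : E → E} (h : HasWeakCurl U τ d)
    (h' : HasWeakCurl U τ' d') : HasWeakCurl U (τ + τ') (d + d') := by
  have := HasWeakDiv.add h h'
  unfold HasWeakCurl
  convert this using 1
  funext x
  exact rotRows_add _ _

theorem HasWeakCurl.smul {U : Set E} {τ : E → Tens} {d : E → E} (h : HasWeakCurl U τ d) (c : ℝ) :
    HasWeakCurl U (c • τ) (c • d) := by
  have := HasWeakDiv.smul h c
  unfold HasWeakCurl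
  convert this using 1
  funext x
  exact rotRows_smul _ _

theorem HasWeakCurl.zero (U : Set E) : HasWeakCurl U 0 0 := by
  have h := HasWeakDiv.zero U
  unfold HasWeakCurl
  convert h using 1
  funext x
  have := rotRows_smul 0 0
  simpa using this

theorem evalVec_add (p q : Fin 2 → MvPolynomial (Fin 2) ℝ) (x : E) :
    evalVec (p + q) x = evalVec p x + evalVec q x := by
  ext j; simp [evalVec]

theorem evalVec_smul (c : ℝ) (p : Fin 2 → MvPolynomial (Fin 2) ℝ) (x : E) :
    evalVec (c • p) x = c • evalVec p x := by
  ext j; simp [evalVec]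

theorem evalTens_add (p q : Fin 2 → Fin 2 → MvPolynomial (Fin 2) ℝ) (x : E) :
    evalTens (p + q) x = evalTens p x + evalTens q x := by
  ext i j; simp [evalTens, evalVec]

theorem evalTens_smul (c : ℝ) (p : Fin 2 → Fin 2 → MvPolynomial (Fin 2) ℝ) (x : E) :
    evalTens (c • p) x = c • evalTens p x := by
  ext i j; simp [evalTens, evalVec]

theorem IsPolyVec.zero (k : ℕ) (K : Set E) : IsPolyVec k K 0 :=
  ⟨0, fun _ => Submodule.zero_mem _, Filter.Eventually.of_forall fun x => by
    ext j; simp [evalVec]⟩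

theorem IsPolyVec.add {k : ℕ} {K : Set E} {d d' : E → E} (h : IsPolyVec k K d)
    (h' : IsPolyVec k K d') : IsPolyVec k K (d + d') := by
  obtain ⟨p, hp, h⟩ := h
  obtain ⟨q, hq, h'⟩ := h'
  refine ⟨p + q, fun j => Submodule.add_mem _ (hp j) (hq j), ?_⟩
  filter_upwards [h, h'] with x a b
  rw [evalVec_add, Pi.add_apply, a, b]

theorem IsPolyVec.smul {k : ℕ} {K : Set E} {d : E → E} (h : IsPolyVec k K d) (c : ℝ) :
    IsPolyVec k K (c • d) := by
  obtain ⟨p, hp, h⟩ := h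
  refine ⟨c • p, fun j => Submodule.smul_mem _ c (hp j), ?_⟩
  filter_upwards [h] with x a
  rw [evalVec_smul, Pi.smul_apply, a]

theorem IsPolyVec.congr {k : ℕ} {K : Set E} {d d' : E → E} (h : IsPolyVec k K d)
    (hd : d =ᵐ[volume.restrict K] d') : IsPolyVec k K d' := by
  obtain ⟨p, hp, h⟩ := h
  refine ⟨p, hp, ?_⟩
  filter_upwards [h, hd] with x a b
  rw [← b, a]

theorem IsPolyTens.zero (k : ℕ) (K : Set E) : IsPolyTens k K 0 :=
  ⟨0, fun _ _ => Submodule.zero_mem _, Filter.Eventually.of_forall fun x => by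
    ext i j; simp [evalTens, evalVec]⟩

theorem IsPolyTens.add {k : ℕ} {K : Set E} {d d' : E → Tens} (h : IsPolyTens k K d)
    (h' : IsPolyTens k K d') : IsPolyTens k K (d + d') := by
  obtain ⟨p, hp, h⟩ := h
  obtain ⟨q, hq, h'⟩ := h'
  refine ⟨p + q, fun i j => Submodule.add_mem _ (hp i j) (hq i j), ?_⟩
  filter_upwards [h, h'] with x a b
  rw [evalTens_add, Pi.add_apply, a, b]

theorem IsPolyTens.smul {k : ℕ} {K : Set E} {d : E → Tens} (h : IsPolyTens k K d) (c : ℝ) :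
    IsPolyTens k K (c • d) := by
  obtain ⟨p, hp, h⟩ := h
  refine ⟨c • p, fun i j => Submodule.smul_mem _ c (hp i j), ?_⟩
  filter_upwards [h] with x a
  rw [evalTens_smul, Pi.smul_apply, a]

theorem IsPolyTens.congr {k : ℕ} {K : Set E} {d d' : E → Tens} (h : IsPolyTens k K d)
    (hd : d =ᵐ[volume.restrict K] d') : IsPolyTens k K d' := by
  obtain ⟨p, hp, h⟩ := h
  refine ⟨p, hp, ?_⟩
  filter_upwards [h, hd] with x a b
  rw [← b, a]

theorem HasNormalTrace.congr {P : Element} {τ τ' : E → Tens}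
    {g : Fin P.n → Fin 2 → Polynomial ℝ} (h : HasNormalTrace P τ g)
    (hτ : τ =ᵐ[volume.restrict P.carrier] τ') : HasNormalTrace P τ' g := by
  obtain ⟨d, hd, h⟩ := h
  refine ⟨d, hd.congr hτ, fun φ hφ i => ?_⟩
  rw [← green_congr hτ (Filter.EventuallyEq.refl _ d)]
  exact h φ hφ i

theorem continuous_edgePoint (P : Element) (e : Fin P.n) : Continuous (P.edgePoint e) := by
  unfold Element.edgePoint Polygon.edgePath
  exact AffineMap.lineMap_continuous.comp (by fun_prop)

theorem HasNormalTrace.add {P : Element} {τ τ' : E → Tens}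
    {g g' : Fin P.n → Fin 2 → Polynomial ℝ} (h : HasNormalTrace P τ g)
    (h' : HasNormalTrace P τ' g') : HasNormalTrace P (τ + τ') (g + g') := by
  obtain ⟨d, hd, h⟩ := h
  obtain ⟨d', hd', h'⟩ := h'
  refine ⟨d + d', hd.add hd', fun φ hφ i => ?_⟩
  have hI : ∀ (e : Fin P.n) (q : Polynomial ℝ),
      IntervalIntegrable (fun s => q.eval s * φ (P.edgePoint e s)) volume (-(1 / 2)) (1 / 2) :=
    fun e q => (q.continuous.mul
      (hφ.1.continuous.comp (continuous_edgePoint P e))).intervalIntegrable _ _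
  rw [green_add hφ hd.1 hd.2.1 hd'.1 hd'.2.1, h φ hφ i, h' φ hφ i, ← Finset.sum_add_distrib]
  refine Finset.sum_congr rfl fun e _ => ?_
  rw [← mul_add, ← intervalIntegral.integral_add (hI e _) (hI e _)]
  simp only [Pi.add_apply, Polynomial.eval_add, add_mul]

theorem HasNormalTrace.smul {P : Element} {τ : E → Tens}
    {g : Fin P.n → Fin 2 → Polynomial ℝ} (h : HasNormalTrace P τ g) (c : ℝ) :
    HasNormalTrace P (c • τ) (c • g) := by
  obtain ⟨d, hd, h⟩ := h
  refine ⟨c • d, hd.smul c, fun φ hφ i => ?_⟩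
  rw [green_smul, h φ hφ i, Finset.mul_sum]
  refine Finset.sum_congr rfl fun e _ => ?_
  rw [mul_left_comm, ← intervalIntegral.integral_const_mul]
  simp only [Pi.smul_apply, Polynomial.eval_smul, smul_eq_mul, mul_assoc]

theorem HasNormalTrace.zero (P : Element) : HasNormalTrace P 0 0 :=
  ⟨0, HasWeakDiv.zero _, fun φ _ i => by rw [green_zero]; simp⟩

theorem MemLocalStress.congr {k : ℕ} {P : Element} {τ τ' : E → Tens} (h : MemLocalStress k P τ)
    (hτ : τ =ᵐ[volume.restrict P.carrier] τ') : MemLocalStress k P τ' := by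
  obtain ⟨⟨d, hd, hd'⟩, ⟨c, hc, hc'⟩, g, hg, hg'⟩ := h
  exact ⟨⟨d, hd.congr hτ, hd'⟩, ⟨c, hc.congr hτ, hc'⟩, g, hg, hg'.congr hτ⟩

theorem MemLocalStress.add {k : ℕ} {P : Element} {τ τ' : E → Tens} (h : MemLocalStress k P τ)
    (h' : MemLocalStress k P τ') : MemLocalStress k P (τ + τ') := by
  obtain ⟨⟨d, hd, hd'⟩, ⟨c, hc, hc'⟩, g, hg, hg'⟩ := h
  obtain ⟨⟨D, hD, hD'⟩, ⟨C, hC, hC'⟩, G, hG, hG'⟩ := h'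
  exact ⟨⟨_, hd.add hD, hd'.add hD'⟩, ⟨_, hc.add hC, hc'.add hC'⟩, _,
    fun e i => (Polynomial.natDegree_add_le _ _).trans (max_le (hg e i) (hG e i)), hg'.add hG'⟩

theorem MemLocalStress.smul {k : ℕ} {P : Element} {τ : E → Tens} (h : MemLocalStress k P τ)
    (r : ℝ) : MemLocalStress k P (r • τ) := by
  obtain ⟨⟨d, hd, hd'⟩, ⟨c, hc, hc'⟩, g, hg, hg'⟩ := h
  exact ⟨⟨_, hd.smul r, hd'.smul r⟩, ⟨_, hc.smul r, hc'.smul r⟩, _,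
    fun e i => (Polynomial.natDegree_smul_le _ _).trans (hg e i), hg'.smul r⟩

theorem MemLocalStress.zero (k : ℕ) (P : Element) : MemLocalStress k P 0 :=
  ⟨⟨0, HasWeakDiv.zero _, IsPolyVec.zero _ _⟩, ⟨0, HasWeakCurl.zero _, IsPolyVec.zero _ _⟩, 0,
    fun _ _ => by simp, HasNormalTrace.zero P⟩

theorem continuous_evalTens (p : Fin 2 → Fin 2 → MvPolynomial (Fin 2) ℝ) :
    Continuous (evalTens p) := by
  unfold evalTens evalVec
  refine (PiLp.continuous_toLp 2 _).comp (continuous_pi fun i =>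
    (PiLp.continuous_toLp 2 _).comp (continuous_pi fun j => ?_))
  exact (MvPolynomial.continuous_eval (p i j)).comp (by fun_prop)

theorem memLp_evalTens (P : Element) (p : Fin 2 → Fin 2 → MvPolynomial (Fin 2) ℝ) :
    MemLp (evalTens p) 2 (volume.restrict P.carrier) := by
  have : IsFiniteMeasure (volume.restrict P.carrier) :=
    ⟨by rw [Measure.restrict_apply_univ]; exact P.isBounded.measure_lt_top⟩
  obtain ⟨C, hC⟩ := P.isBounded.isCompact_closure.exists_bound_of_continuousOn
    (continuous_evalTens p).continuousOn
  refine MemLp.of_bound (continuous_evalTens p).aestronglyMeasurable C ?_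
  filter_upwards [ae_restrict_mem P.isOpen.measurableSet] with x hx
  exact hC x (subset_closure hx)

/-! ### Degrees of freedom -/

/-- The orthogonal complement, for the `L²(K)` inner product, of the gradients of vector
polynomials of degree at most `m + 1` in the tensor polynomials of degree at most `m`. -/
def gradPerp (m : ℕ) (P : Element) :
    Submodule ℝ (Fin 2 → Fin 2 → MvPolynomial (Fin 2) ℝ) where
  carrier := {g | (∀ i j, g i j ∈ Poly m) ∧
    ∀ h ∈ gradPoly m, ∫ x in P.carrier, inner ℝ (evalTens g x) (evalTens h x) = 0}
  zero_mem' := ⟨fun _ _ => Submodule.zero_mem _, fun h _ => by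
    have : ∀ x, evalTens 0 x = 0 := fun x => by ext i j; simp [evalTens, evalVec]
    simp [this]⟩
  add_mem' := by
    rintro a b ⟨ha, ha'⟩ ⟨hb, hb'⟩
    refine ⟨fun i j => Submodule.add_mem _ (ha i j) (hb i j), fun h hh => ?_⟩
    simp only [evalTens_add, inner_add_left]
    have hI : ∀ q, IntegrableOn (fun x => inner ℝ (evalTens q x) (evalTens h x)) P.carrier :=
      fun q => (((continuous_evalTens q).inner (continuous_evalTens h)).continuousOn.integrableOn_compact
        P.isBounded.isCompact_closure).mono_set subset_closure
    rw [integral_add (hI a) (hI b), ha' h hh, hb' h hh, add_zero]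
  smul_mem' := by
    rintro c a ⟨ha, ha'⟩
    refine ⟨fun i j => Submodule.smul_mem _ c (ha i j), fun h hh => ?_⟩
    simp only [evalTens_smul, real_inner_smul_left]
    rw [integral_const_mul, ha' h hh, mul_zero]

/-- A choice, on each element `K`, of a basis of `𝔾_{k-1}(K)` and of a basis of `𝔾_k^⊥(K)`,
which fixes the interior degrees of freedom. -/
structure DofBasis {Ω : Set E} (𝒯 : Mesh Ω) (k : ℕ) where
  m₁ : Fin 𝒯.N → ℕ
  m₂ : Fin 𝒯.N → ℕ
  grad : ∀ K, Module.Basis (Fin (m₁ K)) ℝ (gradPoly (k - 1))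
  perp : ∀ K, Module.Basis (Fin (m₂ K)) ℝ (gradPerp k (𝒯.elem K))

open Classical in
/-- The normal trace (as a polynomial on each edge) of a field that has one. -/
def normalTrace (P : Element) (τ : E → Tens) : Fin P.n → Fin 2 → Polynomial ℝ :=
  if h : ∃ g, HasNormalTrace P τ g then h.choose else 0

variable {Ω : Set E}

/-- The indices of the local degrees of freedom on the element `K`. -/
abbrev DofIndex {𝒯 : Mesh Ω} {k : ℕ} (b : DofBasis 𝒯 k) (K : Fin 𝒯.N) : Type :=
  (Fin (𝒯.elem K).n × Fin 2 × Fin (k + 1)) ⊕ (Fin (b.m₁ K) ⊕ Fin (b.m₂ K))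

/-- The local degrees of freedom: the moments `|F|⁻¹ ∫_F τ n · w` against the vector monomials of
degree at most `k` in the normalised variable of each edge `F`, and the moments `|K|⁻¹ ∫_K τ : g`
for `g` in the chosen bases. -/
def dof {𝒯 : Mesh Ω} {k : ℕ} (b : DofBasis 𝒯 k) (K : Fin 𝒯.N) (τ : E → Tens) :
    DofIndex b K → ℝ
  | .inl (e, i, β) =>
      ∫ s in (-(1 / 2) : ℝ)..(1 / 2), (normalTrace (𝒯.elem K) τ e i).eval s * s ^ (β : ℕ)
  | .inr (.inl l) => (volume.real (𝒯.elem K).carrier)⁻¹ *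
      ∫ x in (𝒯.elem K).carrier, inner ℝ (τ x) (evalTens (b.grad K l).1 x)
  | .inr (.inr l) => (volume.real (𝒯.elem K).carrier)⁻¹ *
      ∫ x in (𝒯.elem K).carrier, inner ℝ (τ x) (evalTens (b.perp K l).1 x)

/-- The stabilisation `S_h^K(σ, τ) = |K| ∑ᵢ χᵢ(σ) χᵢ(τ)`. -/
def stab {𝒯 : Mesh Ω} {k : ℕ} (b : DofBasis 𝒯 k) (K : Fin 𝒯.N) (σ τ : E → Tens) : ℝ :=
  volume.real (𝒯.elem K).carrier * ∑ l, dof b K σ l * dof b K τ l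

/-! ### Projection and discrete stress forms -/

/-- Tensor polynomials of degree at most `k` as elements of `L²(K)`. -/
def polyToL2 (k : ℕ) (P : Element) : (Fin 2 → Fin 2 → Poly k) →ₗ[ℝ] L2 P.carrier Tens where
  toFun p := (memLp_evalTens P fun i j => (p i j).1).toLp
  map_add' p q := by
    rw [← MemLp.toLp_add]
    exact MemLp.toLp_congr _ _ (Filter.Eventually.of_forall fun x => evalTens_add _ _ x)
  map_smul' c p := by
    rw [RingHom.id_apply, ← MemLp.toLp_const_smul]
    exact MemLp.toLp_congr _ _ (Filter.Eventually.of_forall fun x => evalTens_smul c _ x)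

/-- The subspace of tensor polynomials of degree at most `k` in `L²(K)`. -/
def polyL2 (k : ℕ) (P : Element) : Submodule ℝ (L2 P.carrier Tens) :=
  LinearMap.range (polyToL2 k P)

instance (k : ℕ) : Module.Finite ℝ (Poly k) := by infer_instance

instance (k : ℕ) (P : Element) : FiniteDimensional ℝ (polyL2 k P) := by
  unfold polyL2
  infer_instance

/-- The restriction of a global square integrable tensor field to the element `K`. -/
def restr (𝒯 : Mesh Ω) (K : Fin 𝒯.N) (τ : L2 Ω Tens) : L2 (𝒯.elem K).carrier Tens :=
  ((Lp.memLp τ).mono_measure (Measure.restrict_mono (𝒯.subset K) le_rfl)).toLp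

/-- The `L²(K)`-orthogonal projection onto tensor polynomials of degree at most `k`. -/
def proj (k : ℕ) (P : Element) (τ : L2 P.carrier Tens) : L2 P.carrier Tens :=
  (polyL2 k P).starProjection τ

/-- The trace of a tensor. -/
def tr (t : Tens) : ℝ := t 0 0 + t 1 1

/-- A pair of Lamé parameters for which the compliance tensor
`σ ↦ (1 / 2μ) (σ - λ / (2μ + 2λ) tr(σ) I)` is positive definite. -/
structure Lame where
  mu : ℝ
  lam : ℝ
  mu_pos : 0 < mu
  bulk_pos : 0 < 2 * mu + 2 * lam

/-- The local discrete form
`a_h^K(σ, τ) = (1 / 2μ) (∫_K Πσ : Πτ - λ / (2μ + 2λ) ∫_K tr(Πσ) tr(Πτ)) + S_h^K(σ - Πσ, τ - Πτ)`. -/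
def localForm {𝒯 : Mesh Ω} {k : ℕ} (b : DofBasis 𝒯 k) (L : Lame) (K : Fin 𝒯.N)
    (σ τ : L2 (𝒯.elem K).carrier Tens) : ℝ :=
  1 / (2 * L.mu) *
    ((∫ x in (𝒯.elem K).carrier,
        inner ℝ (proj k (𝒯.elem K) σ x) (proj k (𝒯.elem K) τ x)) -
      L.lam / (2 * L.mu + 2 * L.lam) *
        ∫ x in (𝒯.elem K).carrier, tr (proj k (𝒯.elem K) σ x) * tr (proj k (𝒯.elem K) τ x)) +
  stab b K (σ - proj k (𝒯.elem K) σ : L2 (𝒯.elem K).carrier Tens)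
    (τ - proj k (𝒯.elem K) τ : L2 (𝒯.elem K).carrier Tens)

/-- The global discrete form `a_h(σ, τ) = ∑_K a_h^K(σ, τ)`. -/
def stressForm {𝒯 : Mesh Ω} {k : ℕ} (b : DofBasis 𝒯 k) (L : Lame) (σ τ : L2 Ω Tens) : ℝ :=
  ∑ K, localForm b L K (restr 𝒯 K σ) (restr 𝒯 K τ)

/-! ### Discrete spaces -/

/-- `τ ∈ H(div, Ω)` with `τ n = 0` on `Γσ`. -/
def MemHDivStar (Ω Γσ : Set E) (τ : E → Tens) : Prop :=
  ∃ d, HasWeakDiv Ω τ d ∧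
    ∀ φ, IsTest φ → tsupport φ ∩ frontier Ω ⊆ Γσ → ∀ i, green Ω φ τ d i = 0

/-- The stress space `𝕊_h`. -/
def stressSpace (𝒯 : Mesh Ω) (Γσ : Set E) (k : ℕ) : Submodule ℝ (L2 Ω Tens) where
  carrier := {τ | MemHDivStar Ω Γσ τ ∧ ∀ K, MemLocalStress k (𝒯.elem K) τ}
  zero_mem' := by
    have h0 : ((0 : L2 Ω Tens) : E → Tens) =ᵐ[volume.restrict Ω] 0 := Lp.coeFn_zero _ _ _
    refine ⟨⟨0, (HasWeakDiv.zero Ω).congr h0.symm, fun φ _ _ i => ?_⟩, fun K => ?_⟩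
    · rw [green_congr h0 (Filter.EventuallyEq.refl _ 0), green_zero]
    · exact (MemLocalStress.zero k _).congr (ae_restrict_of_ae_restrict_of_subset (𝒯.subset K) h0.symm)
  add_mem' := by
    rintro σ τ ⟨⟨d, hd, hd'⟩, hσ⟩ ⟨⟨D, hD, hD'⟩, hτ⟩
    have h0 : (σ + τ : L2 Ω Tens) =ᵐ[volume.restrict Ω] (σ : E → Tens) + τ := Lp.coeFn_add _ _
    refine ⟨⟨d + D, (hd.add hD).congr h0.symm, fun φ hφ hs i => ?_⟩, fun K => ?_⟩
    · rw [green_congr h0 (Filter.EventuallyEq.refl _ _),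
        green_add hφ hd.1 hd.2.1 hD.1 hD.2.1, hd' φ hφ hs i, hD' φ hφ hs i, add_zero]
    · exact ((hσ K).add (hτ K)).congr
        (ae_restrict_of_ae_restrict_of_subset (𝒯.subset K) h0.symm)
  smul_mem' := by
    rintro c σ ⟨⟨d, hd, hd'⟩, hσ⟩
    have h0 : (c • σ : L2 Ω Tens) =ᵐ[volume.restrict Ω] c • (σ : E → Tens) := Lp.coeFn_smul _ _
    refine ⟨⟨c • d, (hd.smul c).congr h0.symm, fun φ hφ hs i => ?_⟩, fun K => ?_⟩
    · rw [green_congr h0 (Filter.EventuallyEq.refl _ _), green_smul, hd' φ hφ hs i, mul_zero]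
    · exact ((hσ K).smul c).congr
        (ae_restrict_of_ae_restrict_of_subset (𝒯.subset K) h0.symm)

/-- The velocity space `V_h`. -/
def velSpace (𝒯 : Mesh Ω) (k : ℕ) : Submodule ℝ (L2 Ω E) where
  carrier := {v | ∀ K, IsPolyVec k (𝒯.elem K).carrier v}
  zero_mem' K := (IsPolyVec.zero k _).congr
    (ae_restrict_of_ae_restrict_of_subset (𝒯.subset K) (Lp.coeFn_zero _ _ _).symm)
  add_mem' {v w} hv hw K := ((hv K).add (hw K)).congr
    (ae_restrict_of_ae_restrict_of_subset (𝒯.subset K) (Lp.coeFn_add v w).symm)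
  smul_mem' c v hv K := ((hv K).smul c).congr
    (ae_restrict_of_ae_restrict_of_subset (𝒯.subset K) (Lp.coeFn_smul c v).symm)

/-- The rotation space `𝕂_h`. -/
def rotSpace (𝒯 : Mesh Ω) (k : ℕ) : Submodule ℝ (L2 Ω Tens) where
  carrier := {η | (∀ᵐ x ∂volume.restrict Ω, ∀ i j, η x i j = -(η x j i)) ∧
    ∀ K, IsPolyTens k (𝒯.elem K).carrier η}
  zero_mem' := by
    refine ⟨?_, fun K => (IsPolyTens.zero k _).congr
      (ae_restrict_of_ae_restrict_of_subset (𝒯.subset K) (Lp.coeFn_zero _ _ _).symm)⟩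
    filter_upwards [Lp.coeFn_zero Tens 2 (volume.restrict Ω)] with x hx i j
    change ((0 : L2 Ω Tens) : E → Tens) x i j = -(((0 : L2 Ω Tens) : E → Tens) x j i)
    rw [hx]
    simp
  add_mem' := by
    rintro η ζ ⟨h, hη⟩ ⟨h', hζ⟩
    refine ⟨?_, fun K => ((hη K).add (hζ K)).congr
      (ae_restrict_of_ae_restrict_of_subset (𝒯.subset K) (Lp.coeFn_add η ζ).symm)⟩
    filter_upwards [Lp.coeFn_add η ζ, h, h'] with x hx a b i j
    rw [hx]
    simp only [Pi.add_apply, PiLp.add_apply]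
    rw [a i j, b i j]
    ring
  smul_mem' := by
    rintro c η ⟨h, hη⟩
    refine ⟨?_, fun K => ((hη K).smul c).congr
      (ae_restrict_of_ae_restrict_of_subset (𝒯.subset K) (Lp.coeFn_smul c η).symm)⟩
    filter_upwards [Lp.coeFn_smul c η, h] with x hx a i j
    rw [hx]
    simp only [Pi.smul_apply, PiLp.smul_apply, smul_eq_mul]
    rw [a i j]
    ring

/-- The state space `𝕊_h × 𝕊_h × V_h × 𝕂_h`. -/
abbrev State (𝒯 : Mesh Ω) (Γσ : Set E) (k : ℕ) : Type :=
  stressSpace 𝒯 Γσ k × stressSpace 𝒯 Γσ k × velSpace 𝒯 k × rotSpace 𝒯 k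

open Classical in
/-- The weak divergence of a field in `H(div, Ω)`, as an element of `L²(Ω)`. -/
def weakDiv (τ : L2 Ω Tens) : L2 Ω E :=
  if h : ∃ d : L2 Ω E, HasWeakDiv Ω τ d then h.choose else 0

/-! ### The semi-discrete problem in variational form -/

/-- `x = (σ₀, σ₁, v, r) ∈ C¹([0, T])` solves the semi-discrete variational problem with load `f`
and initial datum `x₀`. -/
def SolvesVariational {𝒯 : Mesh Ω} {k : ℕ} (b : DofBasis 𝒯 k) (Γσ : Set E) (ρ : ℝ)
    (L₀ L₁ L₀' : Lame) (T : ℝ) (f : ℝ → L2 Ω E) (x₀ : State 𝒯 Γσ k)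
    (x : ℝ → State 𝒯 Γσ k) : Prop :=
  x 0 = x₀ ∧ ∃ x' : ℝ → State 𝒯 Γσ k, ContinuousOn x' (Icc 0 T) ∧
    ∀ t ∈ Icc 0 T, HasDerivWithinAt x (x' t) (Icc 0 T) t ∧
      (∀ τ : stressSpace 𝒯 Γσ k,
        stressForm b L₀ (x' t).1 τ + stressForm b L₀' (x t).1 τ +
          inner ℝ (weakDiv (τ : L2 Ω Tens)) ((x t).2.2.1 : L2 Ω E) +
          inner ℝ (τ : L2 Ω Tens) ((x' t).2.2.2 : L2 Ω Tens) = 0) ∧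
      (∀ τ : stressSpace 𝒯 Γσ k,
        stressForm b L₁ (x' t).2.1 τ +
          inner ℝ (weakDiv (τ : L2 Ω Tens)) ((x t).2.2.1 : L2 Ω E) +
          inner ℝ (τ : L2 Ω Tens) ((x' t).2.2.2 : L2 Ω Tens) = 0) ∧
      (∀ w : velSpace 𝒯 k,
        inner ℝ (ρ • ((x' t).2.2.1 : L2 Ω E)) (w : L2 Ω E) -
          inner ℝ (weakDiv ((x t).1 + (x t).2.1 : L2 Ω Tens)) (w : L2 Ω E) -
          inner ℝ (ρ • f t) (w : L2 Ω E) = 0) ∧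
      ∀ η : rotSpace 𝒯 k,
        inner ℝ ((x' t).1 + (x' t).2.1 : L2 Ω Tens) (η : L2 Ω Tens) = 0

/-! ### The semi-discrete problem in operator form -/

open Classical in
/-- The Riesz representative in `W` (for the inner product of the ambient space) of a functional
on `W`. -/
def riesz {H : Type*} [NormedAddCommGroup H] [InnerProductSpace ℝ H] (W : Submodule ℝ H)
    (l : W → ℝ) : W :=
  if h : ∃ w : W, ∀ z : W, inner ℝ w z = l z then h.choose else 0

/-- The operator `A_*` on `𝕊_h` given by `(A_* σ, τ) = a_{*,h}(σ, τ)`. -/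
def opA {𝒯 : Mesh Ω} {k : ℕ} (b : DofBasis 𝒯 k) (Γσ : Set E) (L : Lame)
    (σ : stressSpace 𝒯 Γσ k) : stressSpace 𝒯 Γσ k :=
  riesz _ fun τ => stressForm b L σ τ

/-- The operator `H : 𝕊_h → 𝕂_h`. -/
def opH (𝒯 : Mesh Ω) (Γσ : Set E) (k : ℕ) (σ : stressSpace 𝒯 Γσ k) : rotSpace 𝒯 k :=
  riesz _ fun η => inner ℝ (σ : L2 Ω Tens) (η : L2 Ω Tens)

/-- The operator `J : 𝕊_h → V_h`. -/
def opJ (𝒯 : Mesh Ω) (Γσ : Set E) (k : ℕ) (σ : stressSpace 𝒯 Γσ k) : velSpace 𝒯 k :=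
  riesz _ fun w => inner ℝ (weakDiv (σ : L2 Ω Tens)) (w : L2 Ω E)

/-- The adjoint `H^*` of `H`. -/
def opHadj (𝒯 : Mesh Ω) (Γσ : Set E) (k : ℕ) (η : rotSpace 𝒯 k) : stressSpace 𝒯 Γσ k :=
  riesz _ fun τ => inner ℝ η (opH 𝒯 Γσ k τ)

/-- The adjoint `J^*` of `J`. -/
def opJadj (𝒯 : Mesh Ω) (Γσ : Set E) (k : ℕ) (w : velSpace 𝒯 k) : stressSpace 𝒯 Γσ k :=
  riesz _ fun τ => inner ℝ w (opJ 𝒯 Γσ k τ)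

/-- The block operator `𝒜`. -/
def blockA {𝒯 : Mesh Ω} {k : ℕ} (b : DofBasis 𝒯 k) (Γσ : Set E) (ρ : ℝ) (L₀ L₁ : Lame)
    (x : State 𝒯 Γσ k) : State 𝒯 Γσ k :=
  (opA b Γσ L₀ x.1 + opHadj 𝒯 Γσ k x.2.2.2,
    opA b Γσ L₁ x.2.1 + opHadj 𝒯 Γσ k x.2.2.2,
    ρ • x.2.2.1,
    opH 𝒯 Γσ k x.1 + opH 𝒯 Γσ k x.2.1)

/-- The block operator `ℬ`. -/
def blockB {𝒯 : Mesh Ω} {k : ℕ} (b : DofBasis 𝒯 k) (Γσ : Set E) (L₀' : Lame)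
    (x : State 𝒯 Γσ k) : State 𝒯 Γσ k :=
  (-opA b Γσ L₀' x.1 - opJadj 𝒯 Γσ k x.2.2.1,
    -opJadj 𝒯 Γσ k x.2.2.1,
    opJ 𝒯 Γσ k x.1 + opJ 𝒯 Γσ k x.2.1,
    0)

/-- The load `𝒞` for the body force `g = f(t)`. -/
def blockC (𝒯 : Mesh Ω) (Γσ : Set E) (k : ℕ) (ρ : ℝ) (g : L2 Ω E) : State 𝒯 Γσ k :=
  (0, 0, riesz _ (fun w : velSpace 𝒯 k => inner ℝ (ρ • g) (w : L2 Ω E)), 0)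

/-- `x ∈ C¹([0, T])` solves `𝒜 ẋ = ℬ x + 𝒞` on `[0, T]` with initial datum `x₀`. -/
def SolvesODE {𝒯 : Mesh Ω} {k : ℕ} (b : DofBasis 𝒯 k) (Γσ : Set E) (ρ : ℝ)
    (L₀ L₁ L₀' : Lame) (T : ℝ) (f : ℝ → L2 Ω E) (x₀ : State 𝒯 Γσ k)
    (x : ℝ → State 𝒯 Γσ k) : Prop :=
  x 0 = x₀ ∧ ∃ x' : ℝ → State 𝒯 Γσ k, ContinuousOn x' (Icc 0 T) ∧
    ∀ t ∈ Icc 0 T, HasDerivWithinAt x (x' t) (Icc 0 T) t ∧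
      blockA b Γσ ρ L₀ L₁ (x' t) = blockB b Γσ L₀' (x t) + blockC 𝒯 Γσ k ρ (f t)

end ViscoVEM

end

noncomputable section

namespace ViscoVEM

/-! ### Plane rotations and stream functions. -/

section

/-! All unknowns live in finite-dimensional spaces. Once `𝒜` is invertible, the system is `ẋ = 𝒜⁻¹ℬ
x + 𝒜⁻¹𝒞`, a linear equation with a constant operator and continuous forcing: variation of constants
gives a solution and Lipschitz continuity gives uniqueness. The equivalence with the variational
equations amounts to testing each block row against its own space (`blockA_eq_iff`). The substance
is therefore that `𝕊_h` is finite dimensional (`finiteDimensional_stressSpace`) and that `𝒜` is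
injective (`bijective_blockA`).

Let `(σ₀, σ₁, v, r)` be in the kernel of `𝒜`. Then `v = 0` because `ϱ > 0`. Testing the first row
with `σ₀` and the second with `σ₁`, and using the fourth row to cancel `(σ₀ + σ₁, r)`, gives `a₀(σ₀,
σ₀) + a₁(σ₁, σ₁) = 0`. Two facts conclude: the discrete forms are definite
(`eq_zero_of_stressForm_self`), so the stresses vanish; and a rotation orthogonal to all of `𝕊_h` is
zero (`eq_zero_of_forall_inner_stressSpace`), so `r = 0`.

Definiteness reduces to unisolvence on one element. If `a_h(σ, σ) = 0`, then `Πσ = 0` on each `K`,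
because the compliance is positive definite, and then all degrees of freedom of `σ = σ - Πσ` vanish;
the edge moments kill the normal trace. Such a field is zero (`Element.StarBall.ae_eq_zero`). Its
divergence `d` is a polynomial, and Green's formula against `d` itself gives `∫ d² = 0`. Subtracting
a polynomial with the same curl leaves a curl-free field, and a divergence-free field with zero
normal trace is orthogonal to that (`integral_inner_eq_zero_of_star`). Orthogonality to polynomials
then gives `∫ |σ|² = 0`. The orthogonality lemma avoids potentials of rough fields: on a set
star-shaped about a ball, the field is smoothed by averages that push its support into the interior,
and smooth compactly supported divergence-free fields are rotated gradients
(`exists_stream_function`). Linearity of the forms also needs `Πσ` to lie in `𝕊(K)`, that is, Gauss'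
theorem for polynomials on `K`; it is obtained by cutting `K` into triangles from the centre of the
ball (`Element.StarBall.exists_gauss`).

For the rotations, bubble fields on a single element are extended by zero. Projecting a polynomial
row onto the closure of rotated gradients of compactly supported functions gives a bubble with the
same curl, which forces the rows of a skew field orthogonal to `𝕊_h` to be curl-free, hence the
field to be constant on each element. A curl-free bubble with zero normal trace and affine
divergence, found from a Poincaré inequality, detects the remaining constant. -/

/-- Rotation of the plane by a right angle; `rotRows` acts by `rotE` on each row. -/
def rotE : E →L[ℝ] E :=
  LinearMap.toContinuousLinearMap
    { toFun := fun v => !₂[v 1, -(v 0)]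
      map_add' := fun u v => by ext j; fin_cases j <;> simp; ring
      map_smul' := fun a v => by ext j; fin_cases j <;> simp }

theorem rotE_apply (v : E) : rotE v = !₂[v 1, -(v 0)] := rfl

theorem rotRows_apply (t : Tens) (i : Fin 2) : rotRows t i = rotE (t i) := rfl

theorem inner_eq (u v : E) : inner ℝ u v = u 0 * v 0 + u 1 * v 1 := by
  simp [PiLp.inner_apply, Fin.sum_univ_two, mul_comm]

theorem inner_rotE_left (u v : E) : inner ℝ (rotE u) v = u 1 * v 0 - u 0 * v 1 := by
  rw [inner_eq, rotE_apply]; simp; ring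

theorem inner_rotE_rotE (u v : E) : inner ℝ (rotE u) (rotE v) = inner ℝ u v := by
  rw [inner_eq, inner_eq, rotE_apply, rotE_apply]; simp; ring

/-- The standard basis vectors of the plane. -/
def bas (j : Fin 2) : E := EuclideanSpace.single j 1

theorem eq_sum_bas (v : E) : v = v 0 • bas 0 + v 1 • bas 1 := by
  ext j; fin_cases j <;> simp [bas]

theorem map_eq_sum_bas {F : Type*} [NormedAddCommGroup F] [NormedSpace ℝ F] (l : E →L[ℝ] F)
    (v : E) : l v = v 0 • l (bas 0) + v 1 • l (bas 1) := by
  conv_lhs => rw [eq_sum_bas v]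
  simp

theorem one_lt_rank_E : 1 < Module.rank ℝ E := by
  rw [← Module.finrank_eq_rank, finrank_euclideanSpace_fin]; norm_num

/-- In dimension two the unit sphere is connected, and scaling maps `(R, ∞) × sphere` onto the
complement. -/
theorem isPreconnected_compl_closedBall_E (R : ℝ) (hR : 0 ≤ R) :
    IsPreconnected (Metric.closedBall (0 : E) R)ᶜ := by
  have h1 : IsPreconnected (Ioi R ×ˢ Metric.sphere (0 : E) 1) :=
    isPreconnected_Ioi.prod (isPreconnected_sphere one_lt_rank_E 0 1)
  have h2 : (Metric.closedBall (0 : E) R)ᶜ =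
      (fun p : ℝ × E => p.1 • p.2) '' (Ioi R ×ˢ Metric.sphere (0 : E) 1) := by
    ext x
    simp only [mem_compl_iff, Metric.mem_closedBall, dist_zero_right, not_le, mem_image, mem_prod,
      mem_Ioi, mem_sphere_iff_norm, sub_zero, Prod.exists]
    constructor
    · intro hx
      have hx0 : ‖x‖ ≠ 0 := by linarith [norm_nonneg x]
      refine ⟨‖x‖, ‖x‖⁻¹ • x, ⟨hx, ?_⟩, ?_⟩
      · rw [norm_smul, norm_inv, norm_norm, inv_mul_cancel₀ hx0]
      · rw [smul_smul, mul_inv_cancel₀ hx0, one_smul]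
    · rintro ⟨t, u, ⟨ht, hu⟩, rfl⟩
      rw [norm_smul, hu, mul_one, Real.norm_eq_abs]
      exact ht.trans_le (le_abs_self t)
  rw [h2]
  exact h1.image _ (by fun_prop)

/-- A function with zero derivative outside a bounded set star-shaped about `c` is constant there. -/
theorem exists_const_off_star {K : Set E} {c : E} (hb : Bornology.IsBounded K)
    (hc : StarConvex ℝ c K) {ψ : E → ℝ} {S : Set E} (hS : IsClosed S) (hSK : S ⊆ K)
    (hψ : Differentiable ℝ ψ) (h0 : ∀ x ∉ S, fderiv ℝ ψ x = 0) :
    ∃ a, ∀ x ∉ K, ψ x = a := by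
  obtain ⟨R, hR⟩ := hb.subset_closedBall (0 : E)
  set R' := max R 0
  have hKR : K ⊆ Metric.closedBall (0 : E) R' :=
    hR.trans (Metric.closedBall_subset_closedBall (le_max_left _ _))
  obtain ⟨a, ha⟩ := IsOpen.exists_is_const_of_fderiv_eq_zero (𝕜 := ℝ) (f := ψ)
    (Metric.isClosed_closedBall.isOpen_compl)
    (isPreconnected_compl_closedBall_E R' (le_max_right _ _)) hψ.differentiableOn
    (fun x hx => h0 x fun hxS => hx (hKR (hSK hxS)))
  refine ⟨a, fun x hx => ?_⟩
  -- Star-shapedness read backwards: if a point further out on the ray were in `K`, so would be `x`.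
  -- Hence `ψ` is constant along the ray from `x` to the far field, where its value is `a`.
  have hray : ∀ t : ℝ, 1 ≤ t → c + t • (x - c) ∉ K := by
    intro t ht hK
    have h := hc hK (a := 1 - t⁻¹) (b := t⁻¹)
      (by rw [sub_nonneg]; exact inv_le_one_of_one_le₀ ht) (by positivity) (by ring)
    have ht0 : t ≠ 0 := by positivity
    apply hx
    convert h using 1
    rw [smul_add, smul_smul, inv_mul_cancel₀ ht0]
    module
  -- The ray needs `x ≠ c`. A nonempty star-shaped set contains its centre, so `x = c` is possible
  -- only for the empty set, about which `StarConvex` says nothing.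
  have hxc : x ≠ c ∨ K = ∅ := by
    by_contra! h
    obtain ⟨y, hy⟩ := h.2
    exact hx (h.1 ▸ hc.mem ⟨y, hy⟩)
  rcases hxc with hxc | hK
  · have hn : 0 < ‖x - c‖ := norm_pos_iff.2 (sub_ne_zero.2 hxc)
    have hconst : ∀ t ∈ Ici (1 : ℝ), ψ (c + t • (x - c)) = ψ (c + (1 : ℝ) • (x - c)) := by
      intro t ht
      have hder : ∀ u ∈ Ici (1 : ℝ), HasDerivWithinAt (fun u : ℝ => ψ (c + u • (x - c))) 0 (Ici 1) u := by
        intro u hu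
        have h1 : HasDerivAt (fun u : ℝ => c + u • (x - c)) (x - c) u := by
          simpa using ((hasDerivAt_id u).smul_const (x - c)).const_add c
        have h2 := (hψ (c + u • (x - c))).hasFDerivAt.comp_hasDerivAt u h1
        rw [h0 _ fun hS => hray u hu (hSK hS)] at h2
        exact h2.hasDerivWithinAt
      have := (convex_Ici (1 : ℝ)).norm_image_sub_le_of_norm_hasDerivWithin_le (C := 0) hder
        (by simp) (show (1 : ℝ) ∈ Ici 1 from self_mem_Ici) ht
      rw [zero_mul] at this
      exact sub_eq_zero.1 (norm_le_zero_iff.1 this)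
    set t : ℝ := max 1 ((R' + ‖c‖ + 1) / ‖x - c‖)
    have hfar : c + t • (x - c) ∈ (Metric.closedBall (0 : E) R')ᶜ := by
      simp only [mem_compl_iff, Metric.mem_closedBall, dist_zero_right, not_le]
      have h1 : R' + ‖c‖ + 1 ≤ t * ‖x - c‖ := by
        rw [← div_le_iff₀ hn]; exact le_max_right _ _
      have h2 : ‖t • (x - c)‖ ≤ ‖c + t • (x - c)‖ + ‖c‖ := by
        calc ‖t • (x - c)‖ = ‖(c + t • (x - c)) - c‖ := by congr 1; abel
          _ ≤ _ := norm_sub_le _ _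
      rw [norm_smul, Real.norm_of_nonneg (by positivity)] at h2
      linarith
    have := hconst t (mem_Ici.2 (le_max_left _ _))
    rw [ha _ hfar] at this
    simpa using this.symm
  · obtain rfl : S = ∅ := subset_eq_empty hSK hK
    have h0' : ∀ x, fderiv ℝ ψ x = 0 := fun x => h0 x (by simp)
    obtain ⟨y, hy⟩ : ∃ y, y ∈ (Metric.closedBall (0 : E) R')ᶜ := by
      refine ⟨(R' + 1) • bas 0, ?_⟩
      have : 0 ≤ R' := le_max_right _ _
      simp [bas, norm_smul, abs_of_nonneg (by positivity : 0 ≤ R' + 1)]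
    rw [is_const_of_fderiv_eq_zero hψ h0' x y, ha y hy]

/-- A smooth divergence-free field with support in a bounded star-shaped open set `K` is the rotated
gradient of a test function with support in `K`. -/
theorem exists_stream_function {K : Set E} {c : E} (hb : Bornology.IsBounded K)
    (hc : StarConvex ℝ c K) {σ : E → E} (hσ : ContDiff ℝ ∞ σ) (hs : tsupport σ ⊆ K)
    (hdiv : ∀ x, fderiv ℝ σ x (bas 0) 0 + fderiv ℝ σ x (bas 1) 1 = 0) :
    ∃ ψ, IsTest ψ ∧ tsupport ψ ⊆ K ∧ ∀ x w, fderiv ℝ ψ x (rotE w) = inner ℝ w (σ x) := by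
  -- The candidate for `dψ`. The antisymmetric part of its derivative is a multiple of `div σ`, so
  -- it is closed, and the Poincaré lemma on the whole plane supplies `ψ`.
  set θ : E → E →L[ℝ] ℝ := fun x => innerSL ℝ (rotE (σ x)) with hθ
  have hθs : ContDiff ℝ ∞ θ := (innerSL ℝ).contDiff.comp (rotE.contDiff.comp hσ)
  have hder : ∀ a u v, fderiv ℝ θ a u v = inner ℝ (rotE (fderiv ℝ σ a u)) v := by
    intro a u v
    have h1 : HasFDerivAt θ (((innerSL ℝ).comp rotE).comp (fderiv ℝ σ a)) a :=
      ((innerSL ℝ).comp rotE).hasFDerivAt.comp a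
        ((hσ.differentiable (by simp)) a).hasFDerivAt
    rw [h1.fderiv]
    rfl
  obtain ⟨ψ, hψ⟩ := (convex_univ (𝕜 := ℝ) (E := E)).exists_forall_hasFDerivAt_of_fderiv_symmetric
    isOpen_univ (hθs.differentiable (by simp)).differentiableOn (by
      intro a _ u v
      rw [hder, hder, inner_rotE_left, inner_rotE_left, map_eq_sum_bas (fderiv ℝ σ a) u,
        map_eq_sum_bas (fderiv ℝ σ a) v]
      simp only [PiLp.add_apply, PiLp.smul_apply, smul_eq_mul]
      have := hdiv a
      linear_combination (u 1 * v 0 - u 0 * v 1) * this)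
  have hfd : ∀ x, fderiv ℝ ψ x = θ x := fun x => (hψ x trivial).fderiv
  have hψd : Differentiable ℝ ψ := fun x => (hψ x trivial).differentiableAt
  have hψs : ContDiff ℝ ∞ ψ := contDiff_infty_iff_fderiv.2 ⟨hψd, by
    rw [show fderiv ℝ ψ = θ from funext hfd]; exact hθs⟩
  have h0 : ∀ x ∉ tsupport σ, fderiv ℝ ψ x = 0 := by
    intro x hx
    rw [hfd, hθ]
    simp [image_eq_zero_of_notMem_tsupport hx]
  obtain ⟨a, ha⟩ := exists_const_off_star hb hc (isClosed_tsupport σ) hs hψd h0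
  -- A point outside `K` has a ball around it that avoids the closed set `tsupport σ`; there `ψ` is
  -- constant, and its value at the point is `a`.
  have hsupp : tsupport (fun x => ψ x - a) ⊆ K := by
    intro x hx
    by_contra hxK
    have hxs : x ∈ (tsupport σ)ᶜ := fun h => hxK (hs h)
    obtain ⟨ε, hε, hball⟩ := Metric.isOpen_iff.1 (isClosed_tsupport σ).isOpen_compl x hxs
    have : (fun x => ψ x - a) =ᶠ[nhds x] 0 := by
      filter_upwards [Metric.ball_mem_nhds x hε] with y hy
      have := (convex_ball x ε).is_const_of_fderivWithin_eq_zero (𝕜 := ℝ) (f := ψ)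
        hψd.differentiableOn (fun z hz => by
          rw [fderivWithin_of_isOpen Metric.isOpen_ball hz]; exact h0 z (hball hz))
        hy (Metric.mem_ball_self hε)
      simp only [Pi.zero_apply, this, ha x hxK, sub_self]
    exact absurd hx (notMem_tsupport_iff_eventuallyEq.2 this)
  refine ⟨fun x => ψ x - a, ⟨hψs.sub contDiff_const, ?_⟩, hsupp, fun x w => ?_⟩
  · exact hb.isCompact_closure.of_isClosed_subset (isClosed_tsupport _) (hsupp.trans subset_closure)
  · rw [fderiv_sub_const, hfd, hθ, innerSL_apply_apply, inner_rotE_rotE, real_inner_comm]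

end

/-! ### Regularisation on star-shaped sets: solenoidal fields are orthogonal to curl-free ones. -/

section

theorem finrank_E : Module.finrank ℝ E = 2 := by simp

theorem integral_comp_const_sub_smul {F : Type*} [NormedAddCommGroup F] [NormedSpace ℝ F]
    (κ : E → F) (x : E) {s : ℝ} (hs : 0 < s) :
    ∫ z, κ (x - s • z) = (s ^ 2)⁻¹ • ∫ y, κ y := by
  have h := Measure.integral_comp_smul_of_nonneg (volume : Measure E) (fun y => κ (x - y)) s
    (hR := hs.le)
  rw [h, finrank_E, integral_sub_left_eq_self κ volume x]

theorem IsTest.integrable {κ : E → ℝ} (hκ : IsTest κ) : Integrable κ :=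
  hκ.1.continuous.integrable_of_hasCompactSupport hκ.2

theorem IsTest.exists_bound {κ : E → ℝ} (hκ : IsTest κ) : ∃ C, ∀ x, ‖κ x‖ ≤ C :=
  hκ.1.continuous.bounded_above_of_compact_support hκ.2

theorem integrable_inner_of_memLp {X F : Type*} [MeasurableSpace X] {μ : Measure X}
    [NormedAddCommGroup F] [InnerProductSpace ℝ F] {f g : X → F} (hf : MemLp f 2 μ)
    (hg : MemLp g 2 μ) : Integrable (fun x => inner ℝ (f x) (g x)) μ :=
  (hf.norm.integrable_mul hg.norm).mono' (hf.1.inner hg.1)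
    (Filter.Eventually.of_forall fun x => norm_inner_le_norm (f x) (g x))

/-- Averages of a dilated integrable field against a test function are smooth. -/
theorem smooth_kernel_average {κ : E → ℝ} (hκ : IsTest κ) {v : E → E} (hv : Integrable v) {s : ℝ}
    (hs : 0 < s) :
    ContDiff ℝ ∞ (fun x => ∫ z, κ (x - s • z) • v z) ∧
      ∀ x u, fderiv ℝ (fun x => ∫ z, κ (x - s • z) • v z) x u =
        ∫ z, fderiv ℝ κ (x - s • z) u • v z := by
  -- The substitution `y = s z` turns the average into an honest convolution `κ ⋆ f`, up to the
  -- Jacobian `s⁻²`.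
  set f : E → E := fun y => v (s⁻¹ • y)
  have hf : Integrable f := hv.comp_smul (inv_ne_zero hs.ne')
  have hchange : ∀ (G : E → E → E) (x : E),
      ∫ z, G (x - s • z) (v z) = (s ^ 2)⁻¹ • ∫ y, G (x - y) (f y) := by
    intro G x
    have h := Measure.integral_comp_smul_of_nonneg (volume : Measure E)
      (fun y => G (x - y) (f y)) s (hR := hs.le)
    rw [finrank_E] at h
    rw [← h]
    refine integral_congr_ae (Filter.Eventually.of_forall fun z => ?_)
    simp only [f, smul_smul, inv_mul_cancel₀ hs.ne', one_smul]
  have hσ : (fun x => ∫ z, κ (x - s • z) • v z) =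
      fun x => (s ^ 2)⁻¹ • convolution κ f (ContinuousLinearMap.lsmul ℝ ℝ) volume x := by
    funext x
    rw [hchange (fun a b => κ a • b) x, convolution_eq_swap]
    rfl
  rw [hσ]
  have hL := hf.locallyIntegrable
  refine ⟨(hκ.2.contDiff_convolution_left (n := ⊤) _ hκ.1 hL).const_smul _, fun x u => ?_⟩
  have h1 := hκ.2.hasFDerivAt_convolution_left (ContinuousLinearMap.lsmul ℝ ℝ)
    (hκ.1.of_le (by simp)) hL x
  change fderiv ℝ ((s ^ 2)⁻¹ • convolution κ f (ContinuousLinearMap.lsmul ℝ ℝ) volume) x u = _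
  rw [(h1.const_smul ((s ^ 2)⁻¹)).fderiv, hchange (fun a b => fderiv ℝ κ a u • b) x]
  have h2 := (hκ.2.fderiv (𝕜 := ℝ)).convolutionExists_left
    (ContinuousLinearMap.precompL E (ContinuousLinearMap.lsmul ℝ ℝ : ℝ →L[ℝ] E →L[ℝ] E))
    (hκ.1.continuous_fderiv (by simp)) hL x
  rw [smul_apply, convolution_eq_swap,
    ContinuousLinearMap.integral_apply h2.integrable_swap]
  rfl

section kernel

variable {κ : E → ℝ} {s : ℝ}

/-- By Tonelli, integrating the kernel in `x` costs `‖κ‖₁`, and integrating it in `z` costs `s⁻²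
‖κ‖₁` (`integrable_kernel_fst`). These are the two marginals of a Schur test. -/
theorem integrable_kernel_snd (hκ : IsTest κ) {F : E → ℝ} (hF : Integrable F) (s : ℝ) :
    Integrable (fun p : E × E => κ (p.1 - s • p.2) * F p.2) (volume.prod volume) := by
  have hc : Continuous fun p : E × E => κ (p.1 - s • p.2) :=
    hκ.1.continuous.comp (by fun_prop)
  have hm : AEStronglyMeasurable (fun p : E × E => κ (p.1 - s • p.2) * F p.2)
      (volume.prod volume) := hc.aestronglyMeasurable.mul hF.1.comp_snd
  refine (integrable_prod_iff' hm).2 ⟨?_, ?_⟩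
  · refine Filter.Eventually.of_forall fun z => ?_
    exact (hκ.integrable.comp_sub_right (s • z)).mul_const (F z)
  · have : (fun z => ∫ x, ‖κ (x - s • z) * F z‖) = fun z => (∫ x, ‖κ x‖) * ‖F z‖ := by
      funext z
      simp only [norm_mul]
      rw [integral_mul_const, integral_sub_right_eq_self (fun x => ‖κ x‖)]
    rw [this]
    exact hF.norm.const_mul _

theorem integrable_kernel_fst (hκ : IsTest κ) {F : E → ℝ} (hF : Integrable F) (hs : 0 < s) :
    Integrable (fun p : E × E => κ (p.1 - s • p.2) * F p.1) (volume.prod volume) := by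
  have hc : Continuous fun p : E × E => κ (p.1 - s • p.2) :=
    hκ.1.continuous.comp (by fun_prop)
  have hm : AEStronglyMeasurable (fun p : E × E => κ (p.1 - s • p.2) * F p.1)
      (volume.prod volume) := hc.aestronglyMeasurable.mul hF.1.comp_fst
  refine (integrable_prod_iff hm).2 ⟨?_, ?_⟩
  · refine Filter.Eventually.of_forall fun x => ?_
    exact ((hκ.integrable.comp_sub_left x).comp_smul hs.ne').mul_const (F x)
  · have : (fun x => ∫ z, ‖κ (x - s • z) * F x‖) = fun x => (s ^ 2)⁻¹ * (∫ x, ‖κ x‖) * ‖F x‖ := by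
      funext x
      simp only [norm_mul]
      rw [integral_mul_const, integral_comp_const_sub_smul (fun x => ‖κ x‖) x hs, smul_eq_mul]
    rw [this]
    exact hF.norm.const_mul _

theorem integrable_kernel_smul (hκ : IsTest κ) {f : E → E} (hf : Integrable f) (x : E) (s : ℝ) :
    Integrable fun z => κ (x - s • z) • f z := by
  obtain ⟨C, hC⟩ := hκ.exists_bound
  refine hf.bdd_smul C ?_ (Filter.Eventually.of_forall fun z => hC _)
  exact (hκ.1.continuous.comp (by fun_prop)).aestronglyMeasurable

theorem integrable_inner_kernel (hκ : IsTest κ) (hκ0 : ∀ x, 0 ≤ κ x) (hs : 0 < s) {w f : E → E}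
    (hw : MemLp w 2) (hf : MemLp f 2) :
    Integrable (fun p : E × E => κ (p.1 - s • p.2) * inner ℝ (w p.1) (f p.2))
      (volume.prod volume) := by
  have hc : Continuous fun p : E × E => κ (p.1 - s • p.2) :=
    hκ.1.continuous.comp (by fun_prop)
  have h1 := integrable_kernel_fst hκ hw.norm.integrable_sq hs
  have h2 := integrable_kernel_snd hκ hf.norm.integrable_sq s
  refine (h1.add h2).mono' (hc.aestronglyMeasurable.mul
    (hw.1.comp_fst.inner hf.1.comp_snd)) (Filter.Eventually.of_forall fun p => ?_)
  have h := abs_real_inner_le_norm (w p.1) (f p.2)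
  rw [norm_mul, Real.norm_of_nonneg (hκ0 _), Real.norm_eq_abs, Pi.add_apply, ← mul_add]
  refine mul_le_mul_of_nonneg_left (h.trans ?_) (hκ0 _)
  nlinarith [sq_nonneg (‖w p.1‖ - ‖f p.2‖), sq_nonneg ‖w p.1‖, sq_nonneg ‖f p.2‖]

theorem integral_inner_kernel (hκ : IsTest κ) (hκ0 : ∀ x, 0 ≤ κ x) (hs : 0 < s) {w f : E → E}
    (hw : MemLp w 2) (hf : MemLp f 2) (hf1 : Integrable f) :
    ∫ x, inner ℝ (w x) (∫ z, κ (x - s • z) • f z) =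
      ∫ p : E × E, κ (p.1 - s • p.2) * inner ℝ (w p.1) (f p.2) ∂(volume.prod volume) := by
  rw [integral_prod _ (integrable_inner_kernel hκ hκ0 hs hw hf)]
  refine integral_congr_ae (Filter.Eventually.of_forall fun x => ?_)
  simp only
  rw [← integral_inner (integrable_kernel_smul hκ hf1 x s)]
  simp only [real_inner_smul_right]

theorem integrable_inner_average (hκ : IsTest κ) (hκ0 : ∀ x, 0 ≤ κ x) (hs : 0 < s) {w f : E → E}
    (hw : MemLp w 2) (hf : MemLp f 2) (hf1 : Integrable f) :
    Integrable fun x => inner ℝ (w x) (∫ z, κ (x - s • z) • f z) := by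
  refine (integrable_inner_kernel hκ hκ0 hs hw hf).integral_prod_left.congr
    (Filter.Eventually.of_forall fun x => ?_)
  simp only
  rw [← integral_inner (integrable_kernel_smul hκ hf1 x s)]
  simp only [real_inner_smul_right]

/-- A Schur type bound. -/
theorem abs_integral_inner_kernel_le (hκ : IsTest κ) (hκ0 : ∀ x, 0 ≤ κ x) (hs : 0 < s)
    {w f : E → E} (hw : MemLp w 2) (hf : MemLp f 2) (hf1 : Integrable f) {a : ℝ} (ha : 0 < a) :
    |∫ x, inner ℝ (w x) (∫ z, κ (x - s • z) • f z)| ≤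
      (∫ y, κ y) * ((s ^ 2)⁻¹ * a * (∫ x, ‖w x‖ ^ 2) + a⁻¹ * ∫ z, ‖f z‖ ^ 2) := by
  rw [integral_inner_kernel hκ hκ0 hs hw hf hf1]
  have h1 := integrable_kernel_fst hκ hw.norm.integrable_sq hs
  have h2 := integrable_kernel_snd hκ hf.norm.integrable_sq s
  have e1 : ∫ p : E × E, κ (p.1 - s • p.2) * ‖w p.1‖ ^ 2 ∂(volume.prod volume) =
      (∫ y, κ y) * (s ^ 2)⁻¹ * ∫ x, ‖w x‖ ^ 2 := by
    rw [integral_prod _ h1, ← integral_const_mul]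
    refine integral_congr_ae (Filter.Eventually.of_forall fun x => ?_)
    simp only
    rw [integral_mul_const, integral_comp_const_sub_smul κ x hs, smul_eq_mul]
    ring
  have e2 : ∫ p : E × E, κ (p.1 - s • p.2) * ‖f p.2‖ ^ 2 ∂(volume.prod volume) =
      (∫ y, κ y) * ∫ x, ‖f x‖ ^ 2 := by
    rw [integral_prod_symm _ h2, ← integral_const_mul]
    refine integral_congr_ae (Filter.Eventually.of_forall fun x => ?_)
    simp only
    rw [integral_mul_const, integral_sub_right_eq_self κ]
  have h3 : ∀ p : E × E, ‖κ (p.1 - s • p.2) * inner ℝ (w p.1) (f p.2)‖ ≤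
      a * (κ (p.1 - s • p.2) * ‖w p.1‖ ^ 2) + a⁻¹ * (κ (p.1 - s • p.2) * ‖f p.2‖ ^ 2) := by
    intro p
    have h := abs_real_inner_le_norm (w p.1) (f p.2)
    rw [norm_mul, Real.norm_of_nonneg (hκ0 _), Real.norm_eq_abs]
    -- Young's inequality with a free weight: `a` will be the approximation error, so that a factor
    -- `f` of norm at most `a` makes both terms of order `a`.
    have h4 : ‖w p.1‖ * ‖f p.2‖ ≤ a * ‖w p.1‖ ^ 2 + a⁻¹ * ‖f p.2‖ ^ 2 := by
      have h5 : a * ‖w p.1‖ ^ 2 + a⁻¹ * ‖f p.2‖ ^ 2 - 2 * (‖w p.1‖ * ‖f p.2‖) =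
          a⁻¹ * (a * ‖w p.1‖ - ‖f p.2‖) ^ 2 := by
        field_simp
        ring
      have h6 : 0 ≤ a⁻¹ * (a * ‖w p.1‖ - ‖f p.2‖) ^ 2 := by positivity
      have h7 : 0 ≤ ‖w p.1‖ * ‖f p.2‖ := by positivity
      linarith
    calc _ ≤ κ (p.1 - s • p.2) * (a * ‖w p.1‖ ^ 2 + a⁻¹ * ‖f p.2‖ ^ 2) :=
          mul_le_mul_of_nonneg_left (h.trans h4) (hκ0 _)
      _ = _ := by ring
  rw [← Real.norm_eq_abs]
  refine (norm_integral_le_integral_norm _).trans ((integral_mono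
    (integrable_inner_kernel hκ hκ0 hs hw hf).norm
    ((h1.const_mul a).add (h2.const_mul a⁻¹)) h3).trans ?_)
  simp only [Pi.add_apply]
  rw [integral_add (h1.const_mul a) (h2.const_mul a⁻¹), integral_const_mul, integral_const_mul,
    e1, e2]
  exact le_of_eq (by ring)

/-- The number `s⁻² ∫ κ` is the total mass of `z ↦ κ (x - s z)`, so the error is an average of `g z
- g x` over the points that the kernel sees. -/
theorem norm_average_sub_le (hκ : IsTest κ) (hκ0 : ∀ x, 0 ≤ κ x) (hs : 0 < s) {g : E → E}
    (hg : Integrable g) {x : E} {δ : ℝ} (hδ : ∀ z, κ (x - s • z) ≠ 0 → ‖g z - g x‖ ≤ δ) :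
    ‖(∫ z, κ (x - s • z) • g z) - ((s ^ 2)⁻¹ * ∫ y, κ y) • g x‖ ≤
      δ * ((s ^ 2)⁻¹ * ∫ y, κ y) := by
  have hi : Integrable fun z => κ (x - s • z) :=
    (hκ.integrable.comp_sub_left x).comp_smul hs.ne'
  have h1 : ((s ^ 2)⁻¹ * ∫ y, κ y) = ∫ z, κ (x - s • z) := by
    rw [integral_comp_const_sub_smul κ x hs, smul_eq_mul]
  rw [h1, ← integral_smul_const, ← integral_sub (integrable_kernel_smul hκ hg x s)
    (hi.smul_const _), ← integral_const_mul]
  refine norm_integral_le_of_norm_le (hi.const_mul δ) (Filter.Eventually.of_forall fun z => ?_)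
  rw [← smul_sub, norm_smul, Real.norm_of_nonneg (hκ0 _), mul_comm]
  by_cases h : κ (x - s • z) = 0
  · simp [h]
  · exact mul_le_mul_of_nonneg_right (hδ z h) (hκ0 _)

end kernel

/-- The kernel used to regularise a field on a set star-shaped about the ball `B(c, r)`. -/
theorem exists_star_kernel (c : E) {r : ℝ} (hr : 0 < r) {s : ℝ} (hs1 : s < 1) :
    ∃ κ : E → ℝ, IsTest κ ∧ (∀ x, 0 ≤ κ x) ∧ 0 < ∫ y, κ y ∧
      ∀ y, κ y ≠ 0 → ∃ u ∈ Metric.ball c (r / 2), y = (1 - s) • u := by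
  -- With `κ` supported in `(1 - s) B(c, r/2)`, the average at `x` only sees `z` with `x = s z + (1
  -- - s) u`, `u` in the half ball. Stopping at `r / 2` leaves room to move `u` inside `B(c, r)`.
  let β : ContDiffBump c := ⟨r / 4, r / 2, by positivity, by linarith⟩
  have h1 : 0 < 1 - s := by linarith
  set L : E ≃L[ℝ] E := ContinuousLinearEquiv.smulLeft (Units.mk0 (1 - s)⁻¹ (inv_ne_zero h1.ne'))
  have hL : ∀ y, L y = (1 - s)⁻¹ • y := fun y => rfl
  have ht : IsTest (fun y => β (L y)) :=
    ⟨β.contDiff.comp L.contDiff, β.hasCompactSupport.comp_homeomorph L.toHomeomorph⟩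
  refine ⟨fun y => β (L y), ht, fun x => β.nonneg, ?_, fun y hy => ?_⟩
  · refine (ht.1.continuous.integral_pos_of_hasCompactSupport_nonneg_nonzero ht.2
      (fun x => β.nonneg) (x := (1 - s) • c) ?_)
    rw [hL, smul_smul, inv_mul_cancel₀ h1.ne', one_smul]
    exact (β.pos_of_mem_ball (Metric.mem_ball_self β.rOut_pos)).ne'
  · refine ⟨L y, ?_, ?_⟩
    · have : L y ∈ Function.support β := hy
      rwa [β.support_eq] at this
    · rw [hL, smul_smul, mul_inv_cancel₀ h1.ne', one_smul]

/-- On a bounded open set star-shaped about a ball, a square integrable field with zero divergence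
and zero normal trace is the weak limit of compactly supported rotated gradients, hence orthogonal
to every curl-free field. -/
theorem integral_inner_eq_zero_of_star {K : Set E} {c : E} {r : ℝ} (hr : 0 < r)
    (hb : Bornology.IsBounded K) (hK : MeasurableSet K)
    (hc : ∀ y ∈ Metric.ball c r, StarConvex ℝ y K) {v w : E → E}
    (hv : MemLp v 2 (volume.restrict K)) (hw : MemLp w 2 (volume.restrict K))
    (hdiv : ∀ φ, IsTest φ → ∫ x in K, fderiv ℝ φ x (v x) = 0)
    (hcurl : ∀ φ, IsTest φ → tsupport φ ⊆ K → ∫ x in K, fderiv ℝ φ x (rotE (w x)) = 0) :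
    ∫ x in K, inner ℝ (w x) (v x) = 0 := by
  have hfin : IsFiniteMeasure (volume.restrict K) :=
    ⟨by rw [Measure.restrict_apply_univ]; exact hb.measure_lt_top⟩
  set V : E → E := K.indicator v
  set W : E → E := K.indicator w
  have hV : MemLp V 2 := (memLp_indicator_iff_restrict hK).2 hv
  have hW : MemLp W 2 := (memLp_indicator_iff_restrict hK).2 hw
  have hV1 : Integrable V := (integrable_indicator_iff hK).2 (hv.integrable (by norm_num))
  have hW1 : Integrable W := (integrable_indicator_iff hK).2 (hw.integrable (by norm_num))
  -- The average of `V` is smooth, divergence-free and supported inside `K`, so it is the rotated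
  -- gradient of an admissible test function, and `hcurl` says that `w` is orthogonal to it.
  have hker : ∀ s : ℝ, 0 < s → s < 1 → ∀ κ : E → ℝ, IsTest κ →
      (∀ y, κ y ≠ 0 → ∃ u ∈ Metric.ball c (r / 2), y = (1 - s) • u) →
      ∫ x, inner ℝ (W x) (∫ z, κ (x - s • z) • V z) = 0 := by
    intro s hs hs1 κ hκ hsupp
    obtain ⟨hsm, hfd⟩ := smooth_kernel_average hκ hV1 hs
    set σ : E → E := fun x => ∫ z, κ (x - s • z) • V z with hσ
    have h1s : 0 < 1 - s := by linarith
    -- A limit point `x` of the support is close to some `x' = s z + (1 - s) u` with `z ∈ K`.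
    -- Absorbing `x - x'` into `u` keeps `u` in the ball `B(c, r)`, so `x` is again a convex
    -- combination covered by `hc`.
    have hts : tsupport σ ⊆ K := by
      intro x hx
      have hε : 0 < (1 - s) * (r / 2) := by positivity
      obtain ⟨x', hx', hd⟩ := Metric.mem_closure_iff.1 hx _ hε
      have : ∃ z, κ (x' - s • z) • V z ≠ 0 := by
        by_contra! h
        exact hx' (by simp only [hσ, h, integral_zero])
      obtain ⟨z, hz⟩ := this
      have hzK : z ∈ K := by
        by_contra hzK
        exact hz (by simp [V, hzK])
      obtain ⟨u, hu, hu'⟩ := hsupp _ (left_ne_zero_of_smul hz)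
      have hy : u + (1 - s)⁻¹ • (x - x') ∈ Metric.ball c r := by
        rw [mem_ball_iff_norm] at hu ⊢
        have h3 : ‖(1 - s)⁻¹ • (x - x')‖ < r / 2 := by
          rw [norm_smul, Real.norm_of_nonneg (by positivity), inv_mul_lt_iff₀ h1s]
          rwa [dist_eq_norm] at hd
        calc ‖u + (1 - s)⁻¹ • (x - x') - c‖ = ‖(u - c) + (1 - s)⁻¹ • (x - x')‖ := by
              congr 1; abel
          _ ≤ _ := norm_add_le _ _
          _ < r := by linarith
      have := hc _ hy hzK h1s.le hs.le (by ring)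
      convert this using 1
      rw [smul_add, smul_smul, mul_inv_cancel₀ h1s.ne', one_smul, ← hu']
      abel
    -- The `x`-gradient of `κ (x - s z)` is `-s⁻¹` times its `z`-gradient, so `div σ` at `x` is
    -- `hdiv` for one test function of `z`. That function need not vanish on the boundary of `K`;
    -- this is where the zero normal trace enters.
    have hdv : ∀ x, fderiv ℝ σ x (bas 0) 0 + fderiv ℝ σ x (bas 1) 1 = 0 := by
      intro x
      have hcf : Continuous (fderiv ℝ κ) := hκ.1.continuous_fderiv (by simp)
      obtain ⟨C, hC⟩ := hcf.bounded_above_of_compact_support (hκ.2.fderiv (𝕜 := ℝ))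
      have hintg : ∀ j, Integrable fun z => fderiv ℝ κ (x - s • z) (bas j) • V z := by
        intro j
        refine hV1.bdd_smul (φ := fun z => fderiv ℝ κ (x - s • z) (bas j))
          (C * ‖bas j‖) ?_ (Filter.Eventually.of_forall fun z => ?_)
        · exact ((hcf.comp (by fun_prop)).clm_apply continuous_const).aestronglyMeasurable
        · exact ((fderiv ℝ κ _).le_opNorm _).trans
            (mul_le_mul_of_nonneg_right (hC _) (norm_nonneg _))
      have hcomp : ∀ j, fderiv ℝ σ x (bas j) j = ∫ z, fderiv ℝ κ (x - s • z) (bas j) * V z j := by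
        intro j
        rw [hfd]
        exact (((PiLp.proj (𝕜 := ℝ) 2 (fun _ : Fin 2 => ℝ) j).integral_comp_comm (hintg j)).symm)
      have hintj : ∀ j, Integrable fun z => fderiv ℝ κ (x - s • z) (bas j) * V z j := fun j =>
        (PiLp.proj (𝕜 := ℝ) 2 (fun _ : Fin 2 => ℝ) j).integrable_comp (hintg j)
      rw [hcomp, hcomp, ← integral_add (hintj 0) (hintj 1)]
      have ht : IsTest fun z => κ (x - s • z) := by
        set L : E ≃L[ℝ] E := ContinuousLinearEquiv.smulLeft (Units.mk0 (-s) (by linarith))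
        have he : (fun z => κ (x - s • z)) = κ ∘ (L.toHomeomorph.trans (Homeomorph.addLeft x)) := by
          funext z
          change κ (x - s • z) = κ (x + (-s) • z)
          rw [neg_smul, sub_eq_add_neg]
        refine ⟨hκ.1.comp (by fun_prop), ?_⟩
        rw [he]
        exact hκ.2.comp_homeomorph _
      have hfz : ∀ z u, fderiv ℝ (fun z => κ (x - s • z)) z u = -s * fderiv ℝ κ (x - s • z) u := by
        intro z u
        have h1 : HasFDerivAt (fun z : E => x - s • z) (-(s • ContinuousLinearMap.id ℝ E)) z :=
          ((hasFDerivAt_id z).const_smul s).const_sub x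
        have h2 := (hκ.1.differentiable (by simp) (x - s • z)).hasFDerivAt.comp z h1
        change fderiv ℝ (κ ∘ fun z => x - s • z) z u = _
        rw [h2.fderiv]
        simp
      have h0 := hdiv _ ht
      have : ∫ z, (fderiv ℝ κ (x - s • z) (bas 0) * V z 0 +
          fderiv ℝ κ (x - s • z) (bas 1) * V z 1) =
          ∫ z in K, -s⁻¹ * fderiv ℝ (fun z => κ (x - s • z)) z (v z) := by
        rw [← integral_indicator hK]
        refine integral_congr_ae (Filter.Eventually.of_forall fun z => ?_)
        simp only
        by_cases hz : z ∈ K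
        · simp only [V, indicator_of_mem hz, hfz]
          rw [map_eq_sum_bas (fderiv ℝ κ (x - s • z)) (v z)]
          simp only [smul_eq_mul]
          field_simp
        · simp [V, indicator_of_notMem hz]
      rw [this, integral_const_mul, h0, mul_zero]
    obtain ⟨ψ, hψ, hψK, hψe⟩ := exists_stream_function hb
      (hc c (Metric.mem_ball_self hr)) hsm hts hdv
    rw [← hcurl ψ hψ hψK, ← integral_indicator hK]
    refine integral_congr_ae (Filter.Eventually.of_forall fun x => ?_)
    simp only
    by_cases hx : x ∈ K
    · simp only [W, indicator_of_mem hx, hψe, hσ]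
    · simp [W, indicator_of_notMem hx]
  have hVW : ∫ x in K, inner ℝ (w x) (v x) = ∫ x, inner ℝ (W x) (V x) := by
    rw [← integral_indicator hK]
    refine integral_congr_ae (Filter.Eventually.of_forall fun x => ?_)
    by_cases hx : x ∈ K
    · simp [W, V, hx]
    · simp [W, V, hx]
  rw [hVW]
  obtain ⟨R, hR⟩ := hb.subset_closedBall (0 : E)
  set A := ∫ x, ‖W x‖ ^ 2
  set B := ∫ x, ‖W x‖
  have hA : 0 ≤ A := integral_nonneg fun x => by positivity
  have hB : 0 ≤ B := integral_nonneg fun x => by positivity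
  -- The factor adds up three errors: `εA + ε` for replacing `V` by `g` in the regularised pairing,
  -- `εB` for un-averaging `g`, and `εA + ε` for returning from `g` to `V`.
  suffices h : ∀ ε : ℝ, 0 < ε → |∫ x, inner ℝ (W x) (V x)| ≤ ε * (2 * A + B + 2) by
    by_contra hne
    have hpos : 0 < |∫ x, inner ℝ (W x) (V x)| := abs_pos.2 hne
    have := h (|∫ x, inner ℝ (W x) (V x)| / (2 * (2 * A + B + 2))) (by positivity)
    have h2 : |∫ x, inner ℝ (W x) (V x)| / (2 * (2 * A + B + 2)) * (2 * A + B + 2) =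
      |∫ x, inner ℝ (W x) (V x)| / 2 := by field_simp
    linarith
  intro ε hε
  obtain ⟨g, hgc, hgs, hgε⟩ := hV.exist_eLpNorm_sub_le (by norm_num) (by norm_num) hε
  have hg : MemLp g 2 := hgs.continuous.memLp_of_hasCompactSupport hgc
  have hg1 : Integrable g := hgs.continuous.integrable_of_hasCompactSupport hgc
  have hF : ∫ z, ‖(V - g) z‖ ^ 2 ≤ ε ^ 2 := by
    have h1 := (hV.sub hg).eLpNorm_eq_integral_rpow_norm (by norm_num) (by norm_num)
    rw [h1] at hgε
    have h2 := (ENNReal.ofReal_le_ofReal_iff hε.le).1 hgε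
    simp only [ENNReal.toReal_ofNat, Real.rpow_ofNat] at h2
    have h3 : 0 ≤ ∫ z, ‖(V - g) z‖ ^ 2 := integral_nonneg fun x => by positivity
    rw [Real.rpow_inv_le_iff_of_pos h3 hε.le (by norm_num)] at h2
    simpa using h2
  obtain ⟨δ, hδ, hgδ⟩ := Metric.uniformContinuous_iff.1
    (hgs.lipschitzWith_of_hasCompactSupport hgc (by simp)).choose_spec.uniformContinuous ε hε
  -- `D` bounds `‖x - u‖` for `x ∈ K` and `u` in the half ball. Since `s (z - x) = q (x - u)` and `s
  -- = 1 - q ≥ 1/2`, the kernel only sees points with `‖z - x‖ ≤ 2 q D < δ`.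
  set D := |R| + ‖c‖ + r with hD
  have hDpos : 0 < D := by positivity
  set q := min (1 / 2) (δ / (4 * D)) with hq
  have hq0 : 0 < q := by positivity
  have hq1 : q ≤ 1 / 2 := min_le_left _ _
  have hq2 : q * (2 * D) < δ := by
    have : q * (4 * D) ≤ δ := by
      rw [← le_div_iff₀ (by positivity)]; exact min_le_right _ _
    nlinarith
  obtain ⟨κ, hκ, hκ0, hκpos, hκs⟩ := exists_star_kernel c hr (s := 1 - q) (by linarith)
  set s := 1 - q with hs_def
  have hs : 0 < s := by linarith
  have hs1 : s < 1 := by linarith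
  set m := (s ^ 2)⁻¹ * ∫ y, κ y with hm
  have hmpos : 0 < m := by positivity
  have hI0 := hker s hs hs1 κ hκ hκs
  have hVg : Integrable (V - g) := hV1.sub hg1
  -- replacing `V` by `g` in the regularised pairing
  have hI1 : |∫ x, inner ℝ (W x) (∫ z, κ (x - s • z) • g z)| ≤ m * (ε * A + ε) := by
    have h1 := abs_integral_inner_kernel_le hκ hκ0 hs hW (hV.sub hg) hVg hε
    have h2 : ∫ x, inner ℝ (W x) (∫ z, κ (x - s • z) • (V - g) z) =
        -∫ x, inner ℝ (W x) (∫ z, κ (x - s • z) • g z) := by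
      rw [← zero_sub, ← hI0, ← integral_sub (integrable_inner_average hκ hκ0 hs hW hV hV1)
        (integrable_inner_average hκ hκ0 hs hW hg hg1)]
      refine integral_congr_ae (Filter.Eventually.of_forall fun x => ?_)
      simp only [Pi.sub_apply, smul_sub]
      rw [integral_sub (integrable_kernel_smul hκ hV1 x s) (integrable_kernel_smul hκ hg1 x s),
        inner_sub_right]
    rw [h2, abs_neg] at h1
    refine h1.trans ?_
    -- The factor `s⁻² ≥ 1` is inserted so that the whole bound is a multiple of the mass `m`, which
    -- can then be divided out.
    have h3 : ε⁻¹ * ∫ z, ‖(V - g) z‖ ^ 2 ≤ (s ^ 2)⁻¹ * ε := by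
      calc ε⁻¹ * ∫ z, ‖(V - g) z‖ ^ 2 ≤ ε⁻¹ * ε ^ 2 := by gcongr
        _ = 1 * ε := by field_simp
        _ ≤ (s ^ 2)⁻¹ * ε := by
          gcongr
          exact (one_le_inv₀ (by positivity)).2 (pow_le_one₀ hs.le hs1.le)
    calc _ ≤ (∫ y, κ y) * ((s ^ 2)⁻¹ * ε * A + (s ^ 2)⁻¹ * ε) := by gcongr
      _ = _ := by rw [hm]; ring
  have hWg : Integrable fun x => inner ℝ (W x) (g x) := integrable_inner_of_memLp hW hg
  have hI2 : |(∫ x, inner ℝ (W x) (∫ z, κ (x - s • z) • g z)) - m * ∫ x, inner ℝ (W x) (g x)| ≤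
      m * (ε * B) := by
    rw [← integral_const_mul, ← integral_sub (integrable_inner_average hκ hκ0 hs hW hg hg1)
      (hWg.const_mul m), ← Real.norm_eq_abs]
    have : m * (ε * B) = ∫ x, (ε * m) * ‖W x‖ := by rw [integral_const_mul]; ring
    rw [this]
    refine norm_integral_le_of_norm_le (hW1.norm.const_mul _) (Filter.Eventually.of_forall fun x => ?_)
    by_cases hx : x ∈ K
    · rw [← real_inner_smul_right, ← inner_sub_right]
      refine (norm_inner_le_norm _ _).trans ?_
      rw [mul_comm]
      refine mul_le_mul_of_nonneg_right (norm_average_sub_le hκ hκ0 hs hg1 fun z hz => ?_)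
        (norm_nonneg _)
      obtain ⟨u, hu, hu'⟩ := hκs _ hz
      rw [← dist_eq_norm]
      refine (hgδ ?_).le
      have h5 : s • (z - x) = q • (x - u) := by
        have h6 : s • z = x - (1 - s) • u := by rw [← hu']; abel
        rw [smul_sub, h6, hs_def]
        module
      have h7 : s * ‖z - x‖ = q * ‖x - u‖ := by
        have := congrArg norm h5
        rwa [norm_smul, norm_smul, Real.norm_of_nonneg hs.le, Real.norm_of_nonneg hq0.le] at this
      have h8 : ‖x - u‖ ≤ D := by
        have hx' : ‖x‖ ≤ |R| := by
          have := hR hx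
          rw [mem_closedBall_zero_iff] at this
          exact this.trans (le_abs_self R)
        have hu2 : ‖u - c‖ < r / 2 := by rwa [mem_ball_iff_norm] at hu
        have hu3 : ‖u‖ ≤ ‖u - c‖ + ‖c‖ := by
          simpa using norm_add_le (u - c) c
        linarith [norm_sub_le x u]
      rw [dist_eq_norm]
      nlinarith [norm_nonneg (z - x), norm_nonneg (x - u)]
    · simp [W, indicator_of_notMem hx]
  have hI3 : |∫ x, inner ℝ (W x) (g x)| ≤ ε * A + ε + ε * B := by
    have h1 : |m * ∫ x, inner ℝ (W x) (g x)| ≤ m * (ε * A + ε) + m * (ε * B) := by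
      have := abs_sub_abs_le_abs_sub (m * ∫ x, inner ℝ (W x) (g x))
        (∫ x, inner ℝ (W x) (∫ z, κ (x - s • z) • g z))
      rw [abs_sub_comm] at this
      linarith
    rw [abs_mul, abs_of_pos hmpos, ← mul_add] at h1
    exact le_of_mul_le_mul_left h1 hmpos
  have hI4 : |∫ x, inner ℝ (W x) ((V - g) x)| ≤ ε * A + ε := by
    rw [← Real.norm_eq_abs]
    have hWs := hW.norm.integrable_sq
    have hVs := (hV.sub hg).norm.integrable_sq
    refine (norm_integral_le_of_norm_le (g := fun x => ε * ‖W x‖ ^ 2 + ε⁻¹ * ‖(V - g) x‖ ^ 2)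
      ((hWs.const_mul ε).add (hVs.const_mul ε⁻¹)) (Filter.Eventually.of_forall fun x => ?_)).trans ?_
    · refine (norm_inner_le_norm _ _).trans ?_
      have h5 : ε * ‖W x‖ ^ 2 + ε⁻¹ * ‖(V - g) x‖ ^ 2 - 2 * (‖W x‖ * ‖(V - g) x‖) =
          ε⁻¹ * (ε * ‖W x‖ - ‖(V - g) x‖) ^ 2 := by
        field_simp
        ring
      have h6 : 0 ≤ ε⁻¹ * (ε * ‖W x‖ - ‖(V - g) x‖) ^ 2 := by positivity
      have h7 : 0 ≤ ‖W x‖ * ‖(V - g) x‖ := by positivity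
      linarith
    · rw [integral_add (hWs.const_mul ε) (hVs.const_mul ε⁻¹), integral_const_mul,
        integral_const_mul]
      have : ε⁻¹ * ∫ z, ‖(V - g) z‖ ^ 2 ≤ ε := by
        calc ε⁻¹ * ∫ z, ‖(V - g) z‖ ^ 2 ≤ ε⁻¹ * ε ^ 2 := by gcongr
          _ = ε := by field_simp
      linarith
  have hsplit : ∫ x, inner ℝ (W x) (V x) =
      (∫ x, inner ℝ (W x) ((V - g) x)) + ∫ x, inner ℝ (W x) (g x) := by
    rw [← integral_add (integrable_inner_of_memLp hW (hV.sub hg)) hWg]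
    simp only [Pi.sub_apply, ← inner_add_right, sub_add_cancel]
  rw [hsplit]
  refine (abs_add_le _ _).trans ?_
  linarith

end

/-! ### Gauss' theorem on triangles and on star-shaped polygons. -/

section

/-- The determinant of two plane vectors. -/
def det2 (u v : E) : ℝ := u 0 * v 1 - u 1 * v 0

/-- Polar type coordinates on the triangle with vertices `c`, `c + a`, `c + b`. -/
def triMap (c a b : E) (p : ℝ × ℝ) : E := c + p.1 • (a + p.2 • (b - a))

/-- The open triangle with vertices `c`, `c + a`, `c + b`. -/
def openTri (c a b : E) : Set E := triMap c a b '' (Ioo 0 1 ×ˢ Ioo 0 1)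

/-- The coordinates of the plane, as a measurable equivalence. -/
def coordEquiv : E ≃ᵐ ℝ × ℝ :=
  (MeasurableEquiv.toLp 2 (Fin 2 → ℝ)).symm.trans MeasurableEquiv.finTwoArrow

theorem coordEquiv_apply (x : E) : coordEquiv x = (x 0, x 1) := rfl

theorem measurePreserving_coordEquiv : MeasurePreserving coordEquiv :=
  (volume_preserving_finTwoArrow ℝ).comp
    (EuclideanSpace.volume_preserving_symm_measurableEquiv_toLp (Fin 2))

theorem continuous_triMap (c a b : E) : Continuous (triMap c a b) := by
  unfold triMap; fun_prop

theorem det2_smul_left (s : ℝ) (u v : E) : det2 (s • u) v = s * det2 u v := by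
  simp [det2]; ring

theorem det2_combination (a b : E) (t : ℝ) : det2 (a + t • (b - a)) (b - a) = det2 a b := by
  simp [det2]; ring

theorem triMap_injOn {c a b : E} (hD : det2 a b ≠ 0) :
    InjOn (triMap c a b) (Ioo 0 1 ×ˢ Ioo 0 1) := by
  rintro ⟨s, t⟩ ⟨hs, -⟩ ⟨s', t'⟩ ⟨hs', -⟩ h
  simp only [triMap, add_right_inj] at h hs hs'
  have h1 : s = s' := by
    have := congrArg (fun v => det2 v (b - a)) h
    simp only [det2_smul_left, det2_combination] at this
    exact mul_right_cancel₀ hD this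
  subst h1
  have h2 := smul_right_injective E hs.1.ne' h
  rw [add_right_inj] at h2
  have h3 : t = t' := by
    have := congrArg (fun v => det2 v a) h2
    simp only [det2_smul_left] at this
    refine mul_right_cancel₀ (b := det2 (b - a) a) ?_ this
    have : det2 (b - a) a = -det2 a b := by simp [det2]; ring
    rw [this]
    exact neg_ne_zero.2 hD
  rw [h3]

theorem measurableSet_openTri {c a b : E} (hD : det2 a b ≠ 0) : MeasurableSet (openTri c a b) :=
  (measurableSet_Ioo.prod measurableSet_Ioo).image_of_continuousOn_injOn
    (continuous_triMap c a b).continuousOn (triMap_injOn hD)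

/-- Change of variables with `triMap`, whose Jacobian at `(s, t)` is `s · det(a, b)`. -/
theorem integral_openTri {c a b : E} (hD : det2 a b ≠ 0) (F : E → ℝ) :
    ∫ x in openTri c a b, F x =
      ∫ p in Ioo (0 : ℝ) 1 ×ˢ Ioo (0 : ℝ) 1, |det2 a b| * p.1 * F (triMap c a b p) := by
  set S : Set E := coordEquiv ⁻¹' (Ioo (0 : ℝ) 1 ×ˢ Ioo (0 : ℝ) 1) with hS
  have hSm : MeasurableSet S := coordEquiv.measurable (measurableSet_Ioo.prod measurableSet_Ioo)
  have himg : openTri c a b = (fun x => triMap c a b (coordEquiv x)) '' S := by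
    rw [openTri, hS, ← image_image (triMap c a b) coordEquiv,
      image_preimage_eq _ coordEquiv.surjective]
  set f' : E → E →L[ℝ] E := fun x =>
    (PiLp.proj (𝕜 := ℝ) 2 (fun _ : Fin 2 => ℝ) 0).smulRight (a + x 1 • (b - a)) +
      x 0 • (PiLp.proj (𝕜 := ℝ) 2 (fun _ : Fin 2 => ℝ) 1).smulRight (b - a) with hf'
  have hder : ∀ x ∈ S, HasFDerivWithinAt (fun x => triMap c a b (coordEquiv x)) (f' x) S x := by
    intro x _
    have h0 : HasFDerivAt (fun x : E => x 0) (PiLp.proj (𝕜 := ℝ) 2 (fun _ : Fin 2 => ℝ) 0) x :=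
      (PiLp.proj (𝕜 := ℝ) 2 (fun _ : Fin 2 => ℝ) 0).hasFDerivAt
    have h1 : HasFDerivAt (fun x : E => x 1) (PiLp.proj (𝕜 := ℝ) 2 (fun _ : Fin 2 => ℝ) 1) x :=
      (PiLp.proj (𝕜 := ℝ) 2 (fun _ : Fin 2 => ℝ) 1).hasFDerivAt
    have h2 := (h0.smul ((h1.smul_const (b - a)).const_add a)).const_add c
    refine (h2.congr_fderiv ?_).hasFDerivWithinAt
    rw [hf', add_comm]
  have hdet : ∀ x, (f' x).det = x 0 * det2 a b := by
    intro x
    change LinearMap.det (f' x : E →ₗ[ℝ] E) = _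
    rw [← LinearMap.det_toMatrix (EuclideanSpace.basisFun (Fin 2) ℝ).toBasis, Matrix.det_fin_two]
    simp [LinearMap.toMatrix_apply, hf', det2]
    ring
  have hinj : InjOn (fun x => triMap c a b (coordEquiv x)) S := fun x hx y hy h =>
    coordEquiv.injective (triMap_injOn hD hx hy h)
  rw [himg, integral_image_eq_integral_abs_det_fderiv_smul volume hSm hder hinj,
    ← measurePreserving_coordEquiv.setIntegral_preimage_emb coordEquiv.measurableEmbedding]
  refine setIntegral_congr_fun hSm fun x hx => ?_
  have hx0 : 0 < x 0 := hx.1.1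
  simp only [hdet, abs_mul, abs_of_pos hx0, smul_eq_mul, coordEquiv_apply]
  ring

/-- The divergence theorem on a triangle. -/
theorem integral_fderiv_openTri {c a b : E} (hD : det2 a b ≠ 0) {Φ : E → ℝ} (hΦ : ContDiff ℝ 1 Φ)
    (u : E) :
    ∫ x in openTri c a b, fderiv ℝ Φ x u = |det2 a b| / det2 a b *
      (det2 u (b - a) * (∫ t in (0 : ℝ)..1, Φ (c + (a + t • (b - a)))) +
        det2 b u * (∫ s in (0 : ℝ)..1, Φ (c + s • b)) -
        det2 a u * ∫ s in (0 : ℝ)..1, Φ (c + s • a)) := by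
  set D := det2 a b with hDdef
  set X := triMap c a b with hX
  have hXd : ∀ p : ℝ × ℝ, HasFDerivAt X
      ((ContinuousLinearMap.fst ℝ ℝ ℝ).smulRight (a + p.2 • (b - a)) +
        p.1 • (ContinuousLinearMap.snd ℝ ℝ ℝ).smulRight (b - a)) p := by
    intro p
    have h0 : HasFDerivAt (fun p : ℝ × ℝ => p.1) (ContinuousLinearMap.fst ℝ ℝ ℝ) p := hasFDerivAt_fst
    have h1 : HasFDerivAt (fun p : ℝ × ℝ => p.2) (ContinuousLinearMap.snd ℝ ℝ ℝ) p := hasFDerivAt_snd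
    have h2 := (h0.smul ((h1.smul_const (b - a)).const_add a)).const_add c
    refine h2.congr_fderiv ?_
    rw [add_comm]
  set X' : ℝ × ℝ → ℝ × ℝ →L[ℝ] E := fun p =>
      ((ContinuousLinearMap.fst ℝ ℝ ℝ).smulRight (a + p.2 • (b - a)) +
        p.1 • (ContinuousLinearMap.snd ℝ ℝ ℝ).smulRight (b - a)) with hX'
  have hΨ : ∀ p, HasFDerivAt (fun p => Φ (X p)) ((fderiv ℝ Φ (X p)).comp (X' p)) p := fun p =>
    ((hΦ.differentiable (by simp)) (X p)).hasFDerivAt.comp p (hXd p)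
  set α := det2 u (b - a) with hα
  -- `(f, g)` is the Piola transform of the field `Φ u`: its divergence on the unit square is the
  -- pulled-back integrand. The terms without a derivative of `Φ` cancel because `∂ₜ det(a + t(b -
  -- a), u) = -α`.
  set f : ℝ × ℝ → ℝ := fun p => α * p.1 * Φ (X p) with hf
  set g : ℝ × ℝ → ℝ := fun p => det2 (a + p.2 • (b - a)) u * Φ (X p) with hg
  have hβ : ∀ t : ℝ, det2 (a + t • (b - a)) u = det2 a u + t * -α := by
    intro t; simp [hα, det2]; ring
  set f' : ℝ × ℝ → ℝ × ℝ →L[ℝ] ℝ := fun p =>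
    (α * p.1) • ((fderiv ℝ Φ (X p)).comp (X' p)) + Φ (X p) • (α • ContinuousLinearMap.fst ℝ ℝ ℝ)
    with hf'
  set g' : ℝ × ℝ → ℝ × ℝ →L[ℝ] ℝ := fun p =>
    (det2 (a + p.2 • (b - a)) u) • ((fderiv ℝ Φ (X p)).comp (X' p)) +
      Φ (X p) • (-α • ContinuousLinearMap.snd ℝ ℝ ℝ) with hg'
  have hfd : ∀ p, HasFDerivAt f (f' p) p := fun p =>
    ((hasFDerivAt_fst (p := p)).const_mul α).mul (hΨ p)
  have hgd : ∀ p, HasFDerivAt g (g' p) p := by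
    intro p
    have h1 : HasFDerivAt (fun p : ℝ × ℝ => det2 (a + p.2 • (b - a)) u)
        (-α • ContinuousLinearMap.snd ℝ ℝ ℝ) p := by
      simp only [hβ]
      exact ((hasFDerivAt_snd (p := p)).mul_const (-α)).const_add _
    exact h1.mul (hΨ p)
  have hsum : ∀ p : ℝ × ℝ, f' p (1, 0) + g' p (0, 1) = D * p.1 * fderiv ℝ Φ (X p) u := by
    intro p
    -- Cramer's rule in the basis `a + t(b - a)`, `b - a`, whose determinant is `D` for every `t`.
    have hu : D • u = α • (a + p.2 • (b - a)) + det2 (a + p.2 • (b - a)) u • (b - a) := by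
      ext j
      fin_cases j <;> simp [hα, hDdef, det2] <;> ring
    have h1 : D * fderiv ℝ Φ (X p) u = α * fderiv ℝ Φ (X p) (a + p.2 • (b - a)) +
        det2 (a + p.2 • (b - a)) u * fderiv ℝ Φ (X p) (b - a) := by
      rw [← smul_eq_mul, ← map_smul, hu, map_add, map_smul, map_smul, smul_eq_mul, smul_eq_mul]
    have h2 : D * p.1 * fderiv ℝ Φ (X p) u = p.1 * (D * fderiv ℝ Φ (X p) u) := by ring
    rw [h2, h1]
    simp only [hf', hg', hX', add_apply, smul_apply,
      ContinuousLinearMap.comp_apply, ContinuousLinearMap.smulRight_apply,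
      ContinuousLinearMap.coe_fst', ContinuousLinearMap.coe_snd', smul_eq_mul, one_smul, zero_smul,
      smul_zero, add_zero, zero_add, map_smul]
    ring
  have hXc : Continuous X := continuous_triMap c a b
  have hcont : Continuous fun p : ℝ × ℝ => D * p.1 * fderiv ℝ Φ (X p) u := by
    have := hΦ.continuous_fderiv (by simp)
    have h2 := (this.comp hXc).clm_apply (continuous_const (y := u))
    exact (continuous_const.mul continuous_fst).mul h2
  have hdivthm := integral_divergence_prod_Icc_of_hasFDerivAt_of_le f g f' g' (0, 0) (1, 1)
    (by simp [Prod.le_def]) (fun p _ => (hfd p).continuousAt.continuousWithinAt)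
    (fun p _ => (hgd p).continuousAt.continuousWithinAt) (fun p _ => hfd p) (fun p _ => hgd p)
    (by simp only [hsum]; exact hcont.continuousOn.integrableOn_compact isCompact_Icc)
  simp only [hsum] at hdivthm
  rw [integral_openTri hD]
  have hset : ∫ p in Ioo (0 : ℝ) 1 ×ˢ Ioo (0 : ℝ) 1, |D| * p.1 * fderiv ℝ Φ (X p) u =
      |D| / D * ∫ p in Icc ((0 : ℝ), (0 : ℝ)) (1, 1), D * p.1 * fderiv ℝ Φ (X p) u := by
    rw [← integral_const_mul, ← Icc_prod_Icc]
    have hae : (Ioo (0 : ℝ) 1 ×ˢ Ioo (0 : ℝ) 1 : Set (ℝ × ℝ)) =ᵐ[volume]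
        (Icc (0 : ℝ) 1 ×ˢ Icc (0 : ℝ) 1 : Set (ℝ × ℝ)) :=
      Measure.set_prod_ae_eq Ioo_ae_eq_Icc Ioo_ae_eq_Icc
    rw [setIntegral_congr_set hae]
    refine integral_congr_ae (Filter.Eventually.of_forall fun p => ?_)
    simp only
    field_simp
  rw [hset, hdivthm]
  congr 1
  simp only [hf, hg, hX, triMap, one_smul, zero_smul, add_zero, mul_zero, zero_mul, mul_one,
    intervalIntegral.integral_zero, sub_zero, intervalIntegral.integral_const_mul,
    add_sub_cancel]
  ring

/-! ### Star-shaped polygons -/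

theorem volume_span_singleton (v : E) : volume ((ℝ ∙ v : Submodule ℝ E) : Set E) = 0 := by
  refine Measure.addHaar_submodule volume _ fun htop => ?_
  have := finrank_span_le_card (R := ℝ) {v}
  rw [htop, finrank_top, finrank_E] at this
  simp at this

theorem finRotate_ne_self {n : ℕ} (hn : 2 ≤ n) (e : Fin n) : finRotate n e ≠ e := by
  obtain ⟨m, rfl⟩ : ∃ m, n = m + 2 := ⟨n - 2, by omega⟩
  rw [finRotate_apply]
  simp

theorem Element.nonempty (P : Element) : P.carrier.Nonempty := P.isConnected.nonempty

theorem Element.vertex_ne (P : Element) (e : Fin P.n) : P.poly e ≠ P.poly (finRotate P.n e) :=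
  fun h => finRotate_ne_self (by have := P.three_le; omega) e (P.injective h).symm

theorem Element.edgeLength_pos (P : Element) (e : Fin P.n) : 0 < P.edgeLength e :=
  dist_pos.2 (P.vertex_ne e)

theorem Element.mem_frontier_of_mem_edgeSet (P : Element) {e : Fin P.n} {x : E}
    (hx : x ∈ P.poly.edgeSet ℝ e) : x ∈ frontier P.carrier := by
  rw [P.frontier_eq]; exact mem_iUnion.2 ⟨e, hx⟩

theorem Element.notMem_frontier (P : Element) {x : E} (hx : x ∈ P.carrier) :
    x ∉ frontier P.carrier := fun h => by
  have := P.isOpen.inter_frontier_eq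
  exact (this ▸ (⟨hx, h⟩ : x ∈ P.carrier ∩ frontier P.carrier) : x ∈ (∅ : Set E))

/-- The element is star-shaped with respect to the ball of centre `c` and radius `r`. -/
structure Element.StarBall (P : Element) (c : E) (r : ℝ) : Prop where
  pos : 0 < r
  star : ∀ y ∈ Metric.ball c r, StarConvex ℝ y P.carrier

theorem Mesh.IsRegular.exists_starBall {Ω : Set E} {𝒯 : Mesh Ω} {η₁ η₂ : ℝ} (h : 𝒯.IsRegular η₁ η₂)
    (hη : 0 < η₁) (K : Fin 𝒯.N) : ∃ c r, (𝒯.elem K).StarBall c r := by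
  obtain ⟨⟨c, r, hr, hs⟩, -⟩ := h K
  exact ⟨c, r, lt_of_le_of_lt (mul_nonneg hη.le Metric.diam_nonneg) hr, hs⟩

namespace Element.StarBall

variable {P : Element} {c : E} {r : ℝ}

theorem center_mem (h : P.StarBall c r) : c ∈ P.carrier :=
  (h.star c (Metric.mem_ball_self h.pos)).mem P.nonempty

theorem ball_subset (h : P.StarBall c r) : Metric.ball c r ⊆ P.carrier := fun y hy => (h.star y hy).mem P.nonempty

/-- Replace `x` by a nearby point of the carrier and correct the error by moving the centre inside
the ball. This is the place where a ball, rather than a single star centre, is needed. -/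
theorem mem_of_mem_closure (h : P.StarBall c r) {x : E} (hx : x ∈ closure P.carrier) {t : ℝ} (ht0 : 0 ≤ t)
    (ht1 : t < 1) : c + t • (x - c) ∈ P.carrier := by
  have h1 : 0 < 1 - t := by linarith
  obtain ⟨x', hx', hd⟩ := Metric.mem_closure_iff.1 hx ((1 - t) * r) (mul_pos h1 h.pos)
  have hy : c + (t / (1 - t)) • (x - x') ∈ Metric.ball c r := by
    rw [mem_ball_iff_norm, add_sub_cancel_left, norm_smul, Real.norm_of_nonneg (by positivity),
      div_mul_eq_mul_div, div_lt_iff₀ h1]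
    rw [dist_eq_norm] at hd
    nlinarith [norm_nonneg (x - x')]
  have := h.star _ hy hx' h1.le ht0 (by ring)
  convert this using 1
  rw [smul_add, smul_smul, mul_div_cancel₀ _ h1.ne']
  module

/-- Each ray from the centre meets the boundary at most once. -/
theorem frontier_ray_unique (h : P.StarBall c r) {y z : E} (hy : c + y ∈ frontier P.carrier)
    (hz : c + z ∈ frontier P.carrier) {s s' : ℝ} (hs : 0 < s) (hs' : 0 < s')
    (he : s • y = s' • z) : y = z := by
  have key : ∀ {y z : E} {s s' : ℝ}, c + y ∈ frontier P.carrier → c + z ∈ frontier P.carrier →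
      0 < s → 0 < s' → s • y = s' • z → ¬ s < s' := by
    intro y z s s' hy hz hs hs' he hlt
    have hz' : z = (s / s') • y := by
      rw [div_eq_inv_mul, mul_smul, he, smul_smul, inv_mul_cancel₀ hs'.ne', one_smul]
    have := h.mem_of_mem_closure (frontier_subset_closure hy) (t := s / s') (by positivity)
      ((div_lt_one hs').2 hlt)
    rw [add_sub_cancel_left, ← hz'] at this
    exact P.notMem_frontier this hz
  rcases lt_trichotomy s s' with hlt | heq | hgt
  · exact absurd hlt (key hy hz hs hs' he)
  · subst heq; exact smul_right_injective E hs.ne' he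
  · exact absurd hgt (key hz hy hs' hs he.symm)

end Element.StarBall

/-- The vertices relative to the centre. -/
def relVertex (P : Element) (c : E) (e : Fin P.n) : E := P.poly e - c

theorem edgePath_eq (P : Element) (c : E) (e : Fin P.n) (t : ℝ) :
    P.poly.edgePath ℝ e t = c + (relVertex P c e + t • (relVertex P c (finRotate P.n e) -
      relVertex P c e)) := by
  simp only [Polygon.edgePath, AffineMap.lineMap_apply, relVertex, vsub_eq_sub, vadd_eq_add]
  module

theorem mem_edgeSet_of_mem_Icc (P : Element) (c : E) (e : Fin P.n) {t : ℝ} (ht : t ∈ Icc (0 : ℝ) 1) :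
    c + (relVertex P c e + t • (relVertex P c (finRotate P.n e) - relVertex P c e)) ∈
      P.poly.edgeSet ℝ e := by
  rw [← edgePath_eq, Polygon.edgeSet_eq_image_edgePath]
  exact mem_image_of_mem _ ht

namespace Element.StarBall

variable {P : Element} {c : E} {r : ℝ}

theorem edge_mem_frontier (P : Element) (c : E) (e : Fin P.n) {t : ℝ} (ht : t ∈ Icc (0 : ℝ) 1) :
    c + (relVertex P c e + t • (relVertex P c (finRotate P.n e) - relVertex P c e)) ∈
      frontier P.carrier :=
  P.mem_frontier_of_mem_edgeSet (mem_edgeSet_of_mem_Icc P c e ht)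

theorem vertex_mem_frontier (P : Element) (c : E) (e : Fin P.n) : c + relVertex P c e ∈ frontier P.carrier := by
  simpa using edge_mem_frontier P c e (t := 0) (by simp)

/-- If the two vertices were collinear with the centre, either they would lie on opposite sides, and
the edge would pass through the interior point `c`, or on one ray, which meets the boundary only
once. -/
theorem det2_ne_zero (h : P.StarBall c r) (e : Fin P.n) :
    det2 (relVertex P c e) (relVertex P c (finRotate P.n e)) ≠ 0 := by
  set a := relVertex P c e with ha
  set b := relVertex P c (finRotate P.n e) with hb
  intro hD
  have hab : a ≠ b := fun hab => P.vertex_ne e (by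
    rw [ha, hb, relVertex, relVertex, sub_left_inj] at hab; exact hab)
  have hc0 : c ∉ frontier P.carrier := P.notMem_frontier h.center_mem
  have ha0 : a ≠ 0 := fun h0 => hc0 (by simpa [← ha, h0] using vertex_mem_frontier P c e)
  have hb0 : b ≠ 0 := fun h0 => hc0 (by
    have := vertex_mem_frontier P c (finRotate P.n e)
    rwa [← hb, h0, add_zero] at this)
  have hnn : 0 < inner ℝ a a := real_inner_self_pos.2 ha0
  have hlin : inner ℝ a a • b = inner ℝ a b • a := by
    ext j
    simp only [det2] at hD
    fin_cases j <;> simp only [inner_eq, PiLp.smul_apply, smul_eq_mul] <;> simp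
    · linear_combination (-a.ofLp 1) * hD
    · linear_combination (a.ofLp 0) * hD
  rcases lt_trichotomy (inner ℝ a b) 0 with hlt | heq | hgt
  · have ht : inner ℝ a a / (inner ℝ a a - inner ℝ a b) ∈ Icc (0 : ℝ) 1 :=
      ⟨div_nonneg hnn.le (by linarith), (div_le_one (by linarith)).2 (by linarith)⟩
    have := edge_mem_frontier P c e ht
    rw [← ha, ← hb] at this
    have hz : a + (inner ℝ a a / (inner ℝ a a - inner ℝ a b)) • (b - a) = 0 := by
      have hq : inner ℝ a a - inner ℝ a b ≠ 0 := by linarith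
      have : (inner ℝ a a - inner ℝ a b) • (a + (inner ℝ a a / (inner ℝ a a - inner ℝ a b)) • (b - a))
          = 0 := by
        rw [smul_add, smul_smul, mul_div_cancel₀ _ hq, smul_sub, hlin]
        module
      exact (smul_eq_zero.1 this).resolve_left hq
    rw [hz, add_zero] at this
    exact hc0 this
  · rw [heq, zero_smul] at hlin
    exact hb0 ((smul_eq_zero.1 hlin).resolve_left hnn.ne')
  · exact hab (h.frontier_ray_unique (vertex_mem_frontier P c e)
      (vertex_mem_frontier P c (finRotate P.n e)) hgt hnn hlin.symm)

/-- The open cones spanned by different edges are disjoint. -/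
theorem cone_disjoint (h : P.StarBall c r) {e e' : Fin P.n} (hne : e ≠ e') {s s' t t' : ℝ} (hs : 0 < s) (hs' : 0 < s')
    (ht : t ∈ Ioo (0 : ℝ) 1) (ht' : t' ∈ Ioo (0 : ℝ) 1) :
    s • (relVertex P c e + t • (relVertex P c (finRotate P.n e) - relVertex P c e)) ≠
      s' • (relVertex P c e' + t' • (relVertex P c (finRotate P.n e') - relVertex P c e')) := by
  intro he
  -- Both edge points lie on one ray from `c`, so they coincide. Distinct edges share at most end
  -- points, which the open parameter interval excludes.
  have heq := h.frontier_ray_unique (edge_mem_frontier P c e (Ioo_subset_Icc_self ht))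
    (edge_mem_frontier P c e' (Ioo_subset_Icc_self ht')) hs hs' he
  have h1 := mem_edgeSet_of_mem_Icc P c e (Ioo_subset_Icc_self ht)
  have h2 := mem_edgeSet_of_mem_Icc P c e' (Ioo_subset_Icc_self ht')
  rw [← heq] at h2
  have h3 := (P.edges_inter e e' hne ⟨h1, h2⟩).1
  have hab : relVertex P c (finRotate P.n e) - relVertex P c e ≠ 0 := by
    simp only [relVertex, sub_sub_sub_cancel_right]
    exact sub_ne_zero.2 (P.vertex_ne e).symm
  rcases h3 with h3 | h3
  · have : t • (relVertex P c (finRotate P.n e) - relVertex P c e) = 0 := by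
      have h4 : P.poly e = c + relVertex P c e := by simp [relVertex]
      rw [h4, add_right_inj] at h3
      simpa using h3
    exact ht.1.ne' ((smul_eq_zero.1 this).resolve_right hab)
  · have : (1 - t) • (relVertex P c (finRotate P.n e) - relVertex P c e) = 0 := by
      have h4 : P.poly (finRotate P.n e) = c + relVertex P c (finRotate P.n e) := by
        simp [relVertex]
      rw [mem_singleton_iff, h4, add_right_inj] at h3
      rw [sub_smul, one_smul, sub_eq_zero, sub_eq_iff_eq_add', h3]
    have := (smul_eq_zero.1 this).resolve_right hab
    linarith [ht.2]

theorem openTri_disjoint (h : P.StarBall c r) :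
    Pairwise (Function.onFun Disjoint fun e =>
      openTri c (relVertex P c e) (relVertex P c (finRotate P.n e))) := by
  intro e e' hne
  refine disjoint_left.2 ?_
  rintro x ⟨⟨s, t⟩, ⟨hs, ht⟩, rfl⟩ ⟨⟨s', t'⟩, ⟨hs', ht'⟩, he⟩
  exact h.cone_disjoint hne hs.1 hs'.1 ht ht' (add_left_cancel he).symm

theorem openTri_subset (h : P.StarBall c r) (e : Fin P.n) :
    openTri c (relVertex P c e) (relVertex P c (finRotate P.n e)) ⊆ P.carrier := by
  rintro x ⟨⟨s, t⟩, ⟨hs, ht⟩, rfl⟩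
  have := h.mem_of_mem_closure (frontier_subset_closure
    (edge_mem_frontier P c e (Ioo_subset_Icc_self ht))) (t := s) hs.1.le hs.2
  rwa [add_sub_cancel_left] at this

/-- Consecutive triangles have the same orientation. -/
theorem orientation_eq (h : P.StarBall c r) (e : Fin P.n) :
    |det2 (relVertex P c e) (relVertex P c (finRotate P.n e))| /
        det2 (relVertex P c e) (relVertex P c (finRotate P.n e)) =
      |det2 (relVertex P c (finRotate P.n e)) (relVertex P c (finRotate P.n (finRotate P.n e)))| /
        det2 (relVertex P c (finRotate P.n e))
          (relVertex P c (finRotate P.n (finRotate P.n e))) := by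
  have hne := finRotate_ne_self (by have := P.three_le; omega) e
  have hD := h.det2_ne_zero e
  have hD' := h.det2_ne_zero (finRotate P.n e)
  have hcone := fun s s' t t' => h.cone_disjoint (e := e) (e' := finRotate P.n e) hne.symm
    (s := s) (s' := s') (t := t) (t' := t')
  set a := relVertex P c e
  set b := relVertex P c (finRotate P.n e)
  set d := relVertex P c (finRotate P.n (finRotate P.n e))
  set D := det2 a b with hDdef
  set D' := det2 b d with hDdef'
  -- Opposite signs would put `a` and `d` on the same side of the ray through `b`, and the cones
  -- over the two edges would overlap close to that ray. The value of `ε` below is chosen to make `β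
  -- ≥ 1/2`.
  suffices hpos : ¬ D / D' < 0 by
    rcases lt_or_gt_of_ne hD with h1 | h1 <;> rcases lt_or_gt_of_ne hD' with h2 | h2
    · rw [abs_of_neg h1, abs_of_neg h2, neg_div, neg_div, div_self hD, div_self hD']
    · exact absurd (div_neg_of_neg_of_pos h1 h2) hpos
    · exact absurd (div_neg_of_pos_of_neg h1 h2) hpos
    · rw [abs_of_pos h1, abs_of_pos h2, div_self hD, div_self hD']
  intro hneg
  set q := det2 a d / D' with hq
  -- a vector in the intersection of the two cones
  set ε : ℝ := (1 + |q|)⁻¹ / 2 with hε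
  have hε0 : 0 < ε := by positivity
  have hβ : 0 < 1 + ε * q := by
    have h1 : ε * |q| ≤ 1 / 2 := by
      rw [hε, div_mul_eq_mul_div, div_le_div_iff_of_pos_right (by norm_num), inv_mul_le_iff₀
        (by positivity)]
      linarith [abs_nonneg q]
    have h2 : -(ε * |q|) ≤ ε * q := by
      rw [← mul_neg]; exact mul_le_mul_of_nonneg_left (neg_abs_le q) hε0.le
    linarith
  set β := 1 + ε * q with hβdef
  set δ := -(ε * (D / D')) with hδ
  have hδ0 : 0 < δ := by rw [hδ]; nlinarith
  have hx : b + ε • a = β • b + δ • d := by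
    have key : D' • a = det2 a d • b - D • d := by
      ext j
      fin_cases j <;> simp [hDdef, hDdef', det2] <;> ring
    have : a = q • b - (D / D') • d := by
      rw [hq, div_eq_inv_mul, div_eq_inv_mul, mul_smul, mul_smul, ← smul_sub, ← key, smul_smul,
        inv_mul_cancel₀ hD', one_smul]
    rw [hβdef, hδ]
    conv_lhs => rw [this]
    module
  refine hcone (1 + ε) (β + δ) (1 / (1 + ε)) (δ / (β + δ)) (by positivity) (by positivity)
    ⟨by positivity, by rw [div_lt_one (by positivity)]; linarith⟩
    ⟨by positivity, by rw [div_lt_one (by positivity)]; linarith⟩ ?_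
  rw [smul_add, smul_smul, mul_div_cancel₀ _ (by positivity), smul_add, smul_smul,
    mul_div_cancel₀ _ (by positivity)]
  have h1 : (1 + ε) • a + (1 : ℝ) • (b - a) = b + ε • a := by module
  have h2 : (β + δ) • b + δ • (d - b) = β • b + δ • d := by module
  rw [h1, h2, hx]

/-- The lines through `c` and the vertices are null sets. Off them, the ray from `c` through a point
of the carrier leaves it through a relatively interior point of some edge, and the point lies in the
triangle over that edge. -/
theorem carrier_ae_eq (h : P.StarBall c r) :
    P.carrier =ᵐ[volume] ⋃ e, openTri c (relVertex P c e) (relVertex P c (finRotate P.n e)) := by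
  refine Filter.EventuallyLE.antisymm ?_ (Filter.Eventually.of_forall fun x hx => ?_)
  · set N : Set E := ⋃ e, ((ℝ ∙ relVertex P c e : Submodule ℝ E) : Set E) with hN
    have hN0 : volume ((fun x => x - c) ⁻¹' N) = 0 := by
      simp only [sub_eq_add_neg]
      rw [measure_preimage_add_right, hN]
      exact measure_iUnion_null fun e => volume_span_singleton _
    filter_upwards [compl_mem_ae_iff.2 hN0] with x hx hxK
    have hxN : ∀ e, x - c ∉ (ℝ ∙ relVertex P c e : Submodule ℝ E) := fun e he =>
      hx (mem_iUnion.2 ⟨e, he⟩)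
    -- A half-line that avoids the boundary and starts inside would stay inside by connectedness,
    -- against boundedness.
    obtain ⟨t, ht1, htf⟩ : ∃ t : ℝ, 1 ≤ t ∧ c + t • (x - c) ∈ frontier P.carrier := by
      by_contra! hno
      obtain ⟨R, hR⟩ := P.isBounded.subset_closedBall c
      have hxc : 0 < ‖x - c‖ := norm_pos_iff.2 fun h0 =>
        hxN ⟨0, (show 0 < 3 by norm_num).trans_le P.three_le⟩ (by rw [h0]; exact Submodule.zero_mem _)
      have hpre : IsPreconnected ((fun t : ℝ => c + t • (x - c)) '' Ici 1) :=
        isPreconnected_Ici.image _ (by fun_prop)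
      have hne : ((fun t : ℝ => c + t • (x - c)) '' Ici 1 ∩ P.carrier).Nonempty :=
        ⟨x, ⟨1, self_mem_Ici, by simp⟩, hxK⟩
      have hsub := hpre.subset_left_of_subset_union (v := (closure P.carrier)ᶜ) P.isOpen
        isClosed_closure.isOpen_compl
        (disjoint_left.2 fun y hy hy' => hy' (subset_closure hy)) (by
          rintro _ ⟨t, ht, rfl⟩
          by_contra hcon
          rw [mem_union, not_or, mem_compl_iff, not_not] at hcon
          refine hno t ht ?_
          rw [frontier, P.isOpen.interior_eq]
          exact ⟨hcon.2, hcon.1⟩) hne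
      have hfar := hR (hsub (mem_image_of_mem (fun t : ℝ => c + t • (x - c))
        (show max 1 ((|R| + 1) / ‖x - c‖) ∈ Ici (1 : ℝ) from mem_Ici.2 (le_max_left _ _))))
      rw [mem_closedBall_iff_norm, add_sub_cancel_left, norm_smul,
        Real.norm_of_nonneg (by positivity)] at hfar
      have h1 : |R| + 1 ≤ max 1 ((|R| + 1) / ‖x - c‖) * ‖x - c‖ := by
        rw [← div_le_iff₀ hxc]; exact le_max_right _ _
      linarith [le_abs_self R]
    have ht1' : 1 < t := by
      rcases ht1.lt_or_eq with hlt | heq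
      · exact hlt
      · rw [← heq, one_smul, add_sub_cancel] at htf
        exact absurd htf (P.notMem_frontier hxK)
    have ht0 : t ≠ 0 := by positivity
    rw [P.frontier_eq] at htf
    obtain ⟨e, he⟩ := mem_iUnion.1 htf
    rw [Polygon.edgeSet_eq_image_edgePath] at he
    obtain ⟨τ, hτ, heq⟩ := he
    rw [edgePath_eq P c, add_right_inj] at heq
    have hxe : x - c = t⁻¹ • (relVertex P c e + τ • (relVertex P c (finRotate P.n e) -
        relVertex P c e)) := by
      rw [heq, smul_smul, inv_mul_cancel₀ ht0, one_smul]
    refine mem_iUnion.2 ⟨e, (t⁻¹, τ), ⟨⟨by positivity, inv_lt_one_of_one_lt₀ ht1'⟩, ?_, ?_⟩, ?_⟩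
    · refine lt_of_le_of_ne hτ.1 fun (h0 : 0 = τ) => hxN e ?_
      rw [hxe, ← h0, zero_smul, add_zero]
      exact Submodule.smul_mem _ _ (Submodule.mem_span_singleton_self _)
    · refine lt_of_le_of_ne hτ.2 fun (h0 : τ = 1) => hxN (finRotate P.n e) ?_
      rw [hxe, h0, one_smul, add_sub_cancel]
      exact Submodule.smul_mem _ _ (Submodule.mem_span_singleton_self _)
    · simp only [triMap, ← hxe, add_sub_cancel]
  · obtain ⟨e, he⟩ := mem_iUnion.1 hx
    exact h.openTri_subset e he

/-- Gauss' theorem on a star-shaped polygon. -/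
theorem exists_gauss (h : P.StarBall c r) : ∃ ν : Fin P.n → E, ∀ Φ : E → ℝ, ContDiff ℝ 1 Φ → ∀ u,
    ∫ x in P.carrier, fderiv ℝ Φ x u =
      ∑ e, inner ℝ (ν e) u * ∫ s in (-(1 / 2) : ℝ)..(1 / 2), Φ (P.edgePoint e s) := by
  set a := relVertex P c with ha
  -- The orientation sign of each triangle. The vector `ν e` is the rotated edge with this sign; it
  -- is not normalised and carries the edge length.
  set sg : Fin P.n → ℝ := fun e => |det2 (a e) (a (finRotate P.n e))| /
    det2 (a e) (a (finRotate P.n e)) with hsg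
  refine ⟨fun e => sg e • rotE (a (finRotate P.n e) - a e), fun Φ hΦ u => ?_⟩
  have hintg : IntegrableOn (fun x => fderiv ℝ Φ x u) P.carrier := by
    have hcont : Continuous fun x => fderiv ℝ Φ x u :=
      (hΦ.continuous_fderiv (by simp)).clm_apply continuous_const
    exact (hcont.continuousOn.integrableOn_compact P.isBounded.isCompact_closure).mono_set
      subset_closure
  rw [setIntegral_congr_set h.carrier_ae_eq, integral_iUnion_fintype
    (fun e => measurableSet_openTri (h.det2_ne_zero e)) h.openTri_disjoint
    (fun e => hintg.mono_set (h.openTri_subset e))]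
  simp only [integral_fderiv_openTri (h.det2_ne_zero _) hΦ u]
  -- The flux through the segment from `c` to a vertex. Neighbouring triangles have the same sign,
  -- so these terms telescope around the polygon and only the outer edges survive.
  set I : Fin P.n → ℝ := fun e => det2 (a e) u * ∫ s in (0 : ℝ)..1, Φ (c + s • a e) with hI
  have hterm : ∀ e, |det2 (relVertex P c e) (relVertex P c (finRotate P.n e))| /
      det2 (relVertex P c e) (relVertex P c (finRotate P.n e)) *
      (det2 u (relVertex P c (finRotate P.n e) - relVertex P c e) *
        (∫ t in (0 : ℝ)..1, Φ (c + (relVertex P c e + t •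
          (relVertex P c (finRotate P.n e) - relVertex P c e)))) +
        det2 (relVertex P c (finRotate P.n e)) u *
          (∫ s in (0 : ℝ)..1, Φ (c + s • relVertex P c (finRotate P.n e))) -
        det2 (relVertex P c e) u * ∫ s in (0 : ℝ)..1, Φ (c + s • relVertex P c e)) =
      inner ℝ (sg e • rotE (a (finRotate P.n e) - a e)) u *
        (∫ s in (-(1 / 2) : ℝ)..(1 / 2), Φ (P.edgePoint e s)) +
      (sg (finRotate P.n e) * I (finRotate P.n e) - sg e * I e) := by
    intro e
    have h1 : ∫ s in (-(1 / 2) : ℝ)..(1 / 2), Φ (P.edgePoint e s) =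
        ∫ t in (0 : ℝ)..1, Φ (c + (a e + t • (a (finRotate P.n e) - a e))) := by
      simp only [Element.edgePoint, edgePath_eq P c]
      rw [intervalIntegral.integral_comp_add_right
        (fun t => Φ (c + (relVertex P c e + t • (relVertex P c (finRotate P.n e) -
          relVertex P c e)))) (1 / 2)]
      norm_num
      rfl
    have h2 : sg (finRotate P.n e) = sg e := (h.orientation_eq e).symm
    have h3 : inner ℝ (sg e • rotE (a (finRotate P.n e) - a e)) u =
        sg e * det2 u (a (finRotate P.n e) - a e) := by
      rw [real_inner_smul_left, inner_rotE_left]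
      simp only [det2]
      ring
    rw [h1, h2, h3, hI]
    simp only [hsg, ha]
    ring
  rw [Finset.sum_congr rfl fun e _ => hterm e, Finset.sum_add_distrib, Finset.sum_sub_distrib,
    Equiv.sum_comp (finRotate P.n) fun e => sg e * I e, sub_self, add_zero]

end Element.StarBall

end

/-! ### Polynomial calculus, weak divergence and uniqueness of normal traces. -/

section

/-! ### Polynomials -/

theorem monomial_mem_Poly {s : Fin 2 →₀ ℕ} {m : ℕ} (h : s 0 + s 1 ≤ m) (a : ℝ) :
    MvPolynomial.monomial s a ∈ Poly m := by
  rw [MvPolynomial.mem_restrictTotalDegree]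
  refine (MvPolynomial.totalDegree_monomial_le s a).trans ?_
  rw [Finsupp.sum_fintype _ _ (by simp), Fin.sum_univ_two]
  exact h

theorem degree_le_of_mem_Poly {p : MvPolynomial (Fin 2) ℝ} {m : ℕ} (hp : p ∈ Poly m)
    {s : Fin 2 →₀ ℕ} (hs : s ∈ p.support) : s 0 + s 1 ≤ m := by
  rw [MvPolynomial.mem_restrictTotalDegree] at hp
  have := (MvPolynomial.le_totalDegree hs).trans hp
  rwa [Finsupp.sum_fintype _ _ (by simp), Fin.sum_univ_two] at this

theorem Poly_mono {m n : ℕ} (h : m ≤ n) {p : MvPolynomial (Fin 2) ℝ} (hp : p ∈ Poly m) :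
    p ∈ Poly n := by
  rw [MvPolynomial.mem_restrictTotalDegree] at hp ⊢
  exact hp.trans h

theorem pderiv_mem_Poly {p : MvPolynomial (Fin 2) ℝ} {m : ℕ} (hp : p ∈ Poly m) (j : Fin 2) :
    MvPolynomial.pderiv j p ∈ Poly (m - 1) := by
  rw [← MvPolynomial.support_sum_monomial_coeff p, map_sum]
  refine Submodule.sum_mem _ fun s hs => ?_
  have hd := degree_le_of_mem_Poly hp hs
  rw [MvPolynomial.pderiv_monomial]
  by_cases h0 : s j = 0
  · simp [h0]
  · refine monomial_mem_Poly ?_ _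
    fin_cases j <;> simp at h0 ⊢ <;> omega

/-- Antiderivative monomial by monomial. It is used to produce a polynomial field with a prescribed
curl. -/
theorem exists_pderiv_eq {p : MvPolynomial (Fin 2) ℝ} {m : ℕ} (hp : p ∈ Poly m) (j : Fin 2) :
    ∃ q ∈ Poly (m + 1), MvPolynomial.pderiv j q = p := by
  refine ⟨∑ s ∈ p.support, MvPolynomial.monomial (s + Finsupp.single j 1)
    (p.coeff s / ((s j : ℝ) + 1)), Submodule.sum_mem _ fun s hs => ?_, ?_⟩
  · have hd := degree_le_of_mem_Poly hp hs
    refine monomial_mem_Poly ?_ _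
    fin_cases j <;> simp <;> omega
  · conv_rhs => rw [← MvPolynomial.support_sum_monomial_coeff p]
    rw [map_sum]
    refine Finset.sum_congr rfl fun s _ => ?_
    rw [MvPolynomial.pderiv_monomial, add_tsub_cancel_right]
    congr 1
    have : (s j : ℝ) + 1 ≠ 0 := by positivity
    simp
    field_simp

/-- The polynomial function on the plane given by a polynomial. -/
def evalPoly (p : MvPolynomial (Fin 2) ℝ) (x : E) : ℝ := MvPolynomial.eval (fun l => x l) p

theorem evalVec_apply (p : Fin 2 → MvPolynomial (Fin 2) ℝ) (x : E) (j : Fin 2) :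
    evalVec p x j = evalPoly (p j) x := rfl

theorem evalTens_apply (p : Fin 2 → Fin 2 → MvPolynomial (Fin 2) ℝ) (x : E) (i : Fin 2) :
    evalTens p x i = evalVec (p i) x := rfl

theorem hasFDerivAt_evalPoly (p : MvPolynomial (Fin 2) ℝ) (x : E) :
    HasFDerivAt (evalPoly p) (∑ j, evalPoly (MvPolynomial.pderiv j p) x •
      (PiLp.proj (𝕜 := ℝ) 2 (fun _ : Fin 2 => ℝ) j)) x := by
  induction p using MvPolynomial.induction_on with
  | C a =>
    have : evalPoly (MvPolynomial.C a) = fun _ => a := by funext y; simp [evalPoly]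
    rw [this]
    refine (hasFDerivAt_const a x).congr_fderiv ?_
    simp [evalPoly]
  | add p q hp hq =>
    have : evalPoly (p + q) = evalPoly p + evalPoly q := by funext y; simp [evalPoly]
    rw [this]
    refine (hp.add hq).congr_fderiv ?_
    simp only [map_add, evalPoly, add_smul, Finset.sum_add_distrib]
  | mul_X p n hp =>
    have : evalPoly (p * MvPolynomial.X n) = fun y => evalPoly p y * y n := by
      funext y; simp [evalPoly]
    rw [this]
    have hn : HasFDerivAt (fun y : E => y n) (PiLp.proj (𝕜 := ℝ) 2 (fun _ : Fin 2 => ℝ) n) x :=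
      (PiLp.proj (𝕜 := ℝ) 2 (fun _ : Fin 2 => ℝ) n).hasFDerivAt
    refine (hp.mul hn).congr_fderiv ?_
    ext v
    simp only [evalPoly, Derivation.leibniz, MvPolynomial.pderiv_X, smul_eq_mul, map_add, map_mul,
      MvPolynomial.eval_X, Fin.sum_univ_two, add_apply, smul_apply, PiLp.proj_apply]
    fin_cases n <;> simp <;> ring

theorem fderiv_evalPoly (p : MvPolynomial (Fin 2) ℝ) (x u : E) :
    fderiv ℝ (evalPoly p) x u = ∑ j, evalPoly (MvPolynomial.pderiv j p) x * u j := by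
  rw [(hasFDerivAt_evalPoly p x).fderiv]
  simp

theorem contDiff_evalPoly (p : MvPolynomial (Fin 2) ℝ) : ContDiff ℝ ∞ (evalPoly p) := by
  induction p using MvPolynomial.induction_on with
  | C a =>
    have : evalPoly (MvPolynomial.C a) = fun _ => a := by funext y; simp [evalPoly]
    rw [this]; exact contDiff_const
  | add p q hp hq =>
    have : evalPoly (p + q) = evalPoly p + evalPoly q := by funext y; simp [evalPoly]
    rw [this]; exact hp.add hq
  | mul_X p n hp =>
    have : evalPoly (p * MvPolynomial.X n) = fun y => evalPoly p y * y n := by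
      funext y; simp [evalPoly]
    rw [this]
    exact hp.mul (PiLp.proj (𝕜 := ℝ) 2 (fun _ : Fin 2 => ℝ) n).contDiff

/-! ### Test functions and weak divergence -/

theorem IsTest.mul {φ q : E → ℝ} (hφ : IsTest φ) (hq : ContDiff ℝ ∞ q) :
    IsTest fun x => φ x * q x :=
  ⟨hφ.1.mul hq, hφ.2.mul_right⟩

theorem IsTest.hasFDerivAt {φ : E → ℝ} (hφ : IsTest φ) (x : E) :
    HasFDerivAt φ (fderiv ℝ φ x) x :=
  (hφ.1.differentiable (by simp) x).hasFDerivAt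

/-- A smooth function coincides near a bounded set with a test function. -/
theorem exists_test_eqOn {U : Set E} (hU : Bornology.IsBounded U) {q : E → ℝ}
    (hq : ContDiff ℝ ∞ q) :
    ∃ φ, IsTest φ ∧ ∀ x ∈ U, φ x = q x ∧ fderiv ℝ φ x = fderiv ℝ q x := by
  obtain ⟨R, hR⟩ := hU.subset_ball (0 : E)
  set ρ := max R 1
  have hρ : 0 < ρ := lt_of_lt_of_le one_pos (le_max_right _ _)
  let β : ContDiffBump (0 : E) := ⟨ρ, ρ + 1, hρ, by linarith⟩
  have hβ : IsTest β := ⟨β.contDiff, β.hasCompactSupport⟩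
  refine ⟨fun x => β x * q x, hβ.mul hq, fun x hx => ?_⟩
  have hxρ : x ∈ Metric.ball (0 : E) ρ := Metric.ball_subset_ball (le_max_left _ _) (hR hx)
  have hev : (fun x => β x * q x) =ᶠ[nhds x] q := by
    filter_upwards [Metric.isOpen_ball.mem_nhds hxρ] with y hy
    rw [β.one_of_mem_closedBall (Metric.ball_subset_closedBall hy), one_mul]
  exact ⟨hev.eq_of_nhds, hev.fderiv_eq⟩

theorem ae_eq_zero_of_forall_test {U : Set E} (hU : IsOpen U) {f : E → ℝ}
    (hf : MemLp f 2 (volume.restrict U))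
    (h : ∀ φ, IsTest φ → tsupport φ ⊆ U → ∫ x in U, f x * φ x = 0) :
    f =ᵐ[volume.restrict U] 0 := by
  refine (ae_restrict_iff' hU.measurableSet).2 (hU.ae_eq_zero_of_integral_contDiff_smul_eq_zero
    (locallyIntegrableOn_of_locallyIntegrable_restrict (hf.locallyIntegrable (by norm_num))) ?_)
  intro φ h1 h2 h3
  rw [← h φ ⟨h1, h2⟩ h3, ← integral_indicator hU.measurableSet]
  refine integral_congr_ae (Filter.Eventually.of_forall fun x => ?_)
  by_cases hx : x ∈ U
  · simp [indicator_of_mem hx, mul_comm]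
  · simp [indicator_of_notMem hx, image_eq_zero_of_notMem_tsupport fun h => hx (h3 h)]

theorem memLp_apply {μ : Measure E} {d : E → E} (hd : MemLp d 2 μ) (i : Fin 2) :
    MemLp (fun x => d x i) 2 μ :=
  (PiLp.proj (𝕜 := ℝ) 2 (fun _ : Fin 2 => ℝ) i).comp_memLp' hd

theorem memLp_row {μ : Measure E} {τ : E → Tens} (hτ : MemLp τ 2 μ) (i : Fin 2) :
    MemLp (fun x => τ x i) 2 μ :=
  (PiLp.proj (𝕜 := ℝ) 2 (fun _ : Fin 2 => E) i).comp_memLp' hτ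

theorem HasWeakDiv.ae_unique {U : Set E} (hU : IsOpen U) {τ : E → Tens} {d d' : E → E}
    (h : HasWeakDiv U τ d) (h' : HasWeakDiv U τ d') : d =ᵐ[volume.restrict U] d' := by
  have key : ∀ i, (fun x => (d - d') x i) =ᵐ[volume.restrict U] 0 := by
    intro i
    refine ae_eq_zero_of_forall_test hU (memLp_apply (h.2.1.sub h'.2.1) i) fun φ hφ hs => ?_
    have h1 := h.2.2 φ hφ hs i
    have h2 := h'.2.2 φ hφ hs i
    unfold green at h1 h2
    rw [← sub_self (0 : ℝ)]
    nth_rw 1 [← h1]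
    rw [← h2, ← integral_sub (integrable_green hφ h.1 h.2.1 i) (integrable_green hφ h.1 h'.2.1 i)]
    refine integral_congr_ae (Filter.Eventually.of_forall fun x => ?_)
    simp only [Pi.sub_apply, PiLp.sub_apply]
    ring
  filter_upwards [key 0, key 1] with x h0 h1
  ext j
  fin_cases j
  · simpa [sub_eq_zero] using h0
  · simpa [sub_eq_zero] using h1

/-! ### Uniqueness of the normal trace -/

theorem dist_edgePoint (P : Element) (e : Fin P.n) (s t : ℝ) :
    dist (P.edgePoint e s) (P.edgePoint e t) = |s - t| * P.edgeLength e := by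
  unfold Element.edgePoint Polygon.edgePath Element.edgeLength
  rw [dist_lineMap_lineMap, Real.dist_eq, add_sub_add_right_eq_sub]

theorem edgePoint_mem_edgeSet (P : Element) (e : Fin P.n) {s : ℝ} (hs : s ∈ Icc (-(1 / 2) : ℝ) (1 / 2)) :
    P.edgePoint e s ∈ P.poly.edgeSet ℝ e := by
  rw [Polygon.edgeSet_eq_image_edgePath]
  exact ⟨s + 1 / 2, ⟨by linarith [hs.1], by linarith [hs.2]⟩, rfl⟩

theorem edgePoint_notMem (P : Element) (e : Fin P.n) {s : ℝ} (hs : s ∈ Icc (-(1 / 2) : ℝ) (1 / 2)) :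
    P.edgePoint e s ∉ P.carrier := fun h =>
  P.notMem_frontier h (P.mem_frontier_of_mem_edgeSet (edgePoint_mem_edgeSet P e hs))

theorem edgePoint_notMem_edgeSet (P : Element) {e e' : Fin P.n} (hne : e' ≠ e) {s : ℝ}
    (hs : s ∈ Ioo (-(1 / 2) : ℝ) (1 / 2)) : P.edgePoint e s ∉ P.poly.edgeSet ℝ e' := by
  intro h
  have h1 := (P.edges_inter e e' hne.symm
    ⟨edgePoint_mem_edgeSet P e (Ioo_subset_Icc_self hs), h⟩).1
  have hl := P.edgeLength_pos e
  have ha : P.edgePoint e (-(1 / 2)) = P.poly e := by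
    simp [Element.edgePoint, Polygon.edgePath]
  have hb : P.edgePoint e (1 / 2) = P.poly (finRotate P.n e) := by
    norm_num [Element.edgePoint, Polygon.edgePath]
  rcases h1 with h1 | h1
  · have := dist_edgePoint P e s (-(1 / 2))
    rw [ha, h1, dist_self] at this
    have h2 := (mul_eq_zero.1 this.symm).resolve_right hl.ne'
    rw [abs_eq_zero] at h2
    linarith [hs.1]
  · have := dist_edgePoint P e s (1 / 2)
    rw [hb, h1, dist_self] at this
    have h2 := (mul_eq_zero.1 this.symm).resolve_right hl.ne'
    rw [abs_eq_zero] at h2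
    linarith [hs.2]

theorem isClosed_edgeSet (P : Element) (e : Fin P.n) : IsClosed (P.poly.edgeSet ℝ e) := by
  rw [Polygon.edgeSet_eq_image_edgePath]
  refine (isCompact_Icc.image ?_).isClosed
  unfold Polygon.edgePath
  exact AffineMap.lineMap_continuous

/-- A family of polynomials on the edges that annihilates all test functions is zero. -/
theorem eq_zero_of_forall_test_edges (P : Element) (q : Fin P.n → Polynomial ℝ)
    (h : ∀ φ, IsTest φ → ∑ e, P.edgeLength e *
      ∫ s in (-(1 / 2) : ℝ)..(1 / 2), (q e).eval s * φ (P.edgePoint e s) = 0) : q = 0 := by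
  by_contra hq
  obtain ⟨e, he⟩ := Function.ne_iff.1 hq
  obtain ⟨s₀, hs₀, hqs⟩ : ∃ s ∈ Ioo (-(1 / 2) : ℝ) (1 / 2), (q e).eval s ≠ 0 := by
    by_contra! hall
    exact he (Polynomial.eq_zero_of_infinite_isRoot _
      ((Ioo_infinite (by norm_num)).mono hall))
  have hl := P.edgeLength_pos e
  set F : Set E := ⋃ e' ∈ {e' | e' ≠ e}, P.poly.edgeSet ℝ e' with hF
  have hFc : IsClosed F := (toFinite _).isClosed_biUnion fun e' _ => isClosed_edgeSet P e'
  have hx₀ : P.edgePoint e s₀ ∈ Fᶜ := by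
    simp only [hF, mem_compl_iff, mem_iUnion, not_exists]
    exact fun e' he' => edgePoint_notMem_edgeSet P he' hs₀
  obtain ⟨ε, hε, hball⟩ := Metric.isOpen_iff.1 hFc.isOpen_compl _ hx₀
  have hcont : ContinuousAt (fun s => (q e).eval s * (q e).eval s₀) s₀ :=
    ((q e).continuous.mul continuous_const).continuousAt
  have hpos : 0 < (q e).eval s₀ * (q e).eval s₀ := mul_self_pos.2 hqs
  obtain ⟨δ, hδ, hsign⟩ := Metric.eventually_nhds_iff.1 (hcont.eventually (lt_mem_nhds hpos))
  -- The first bound keeps the bump away from all other edges. The second makes `q e` keep its sign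
  -- on the support, since distances along the edge are parameter distances times the edge length.
  set ρ := min ε (δ * P.edgeLength e) with hρ
  have hρ0 : 0 < ρ := by positivity
  let β : ContDiffBump (P.edgePoint e s₀) := ⟨ρ / 2, ρ, by positivity, by linarith⟩
  have hβ : IsTest β := ⟨β.contDiff, β.hasCompactSupport⟩
  have hβ0 : ∀ x, x ∉ Metric.ball (P.edgePoint e s₀) ρ → β x = 0 := by
    intro x hx
    by_contra h0
    have : x ∈ Function.support β := h0
    rw [β.support_eq] at this
    exact hx this
  have hsum := h β hβ
  rw [Finset.sum_eq_single e] at hsum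
  · have hI := (mul_eq_zero.1 hsum).resolve_left hl.ne'
    have : 0 < ∫ s in (-(1 / 2) : ℝ)..(1 / 2),
        ((q e).eval s * β (P.edgePoint e s)) * (q e).eval s₀ := by
      refine intervalIntegral.integral_pos (by norm_num) ?_ ?_ ⟨s₀, Ioo_subset_Icc_self hs₀, ?_⟩
      · exact (((q e).continuous.mul (hβ.1.continuous.comp (continuous_edgePoint P e))).mul
          continuous_const).continuousOn
      · intro s _
        by_cases hs : P.edgePoint e s ∈ Metric.ball (P.edgePoint e s₀) ρ
        · have h1 : dist s s₀ < δ := by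
            rw [Metric.mem_ball, dist_edgePoint] at hs
            rw [Real.dist_eq]
            exact lt_of_mul_lt_mul_right (hs.trans_le (min_le_right _ _)) hl.le
          have := hsign h1
          have h2 : 0 ≤ β (P.edgePoint e s) := β.nonneg
          nlinarith
        · simp [hβ0 _ hs]
      · have h2 : 0 < β (P.edgePoint e s₀) := β.pos_of_mem_ball (Metric.mem_ball_self hρ0)
        nlinarith
    rw [intervalIntegral.integral_mul_const, hI, zero_mul] at this
    exact lt_irrefl _ this
  · intro e' _ hne
    have : ∫ s in (-(1 / 2) : ℝ)..(1 / 2), (q e').eval s * β (P.edgePoint e' s) =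
        ∫ s in (-(1 / 2) : ℝ)..(1 / 2), (0 : ℝ) := by
      refine intervalIntegral.integral_congr fun s hs => ?_
      rw [uIcc_of_le (by norm_num)] at hs
      have hmem : P.edgePoint e' s ∈ F := mem_biUnion hne (edgePoint_mem_edgeSet P e' hs)
      rw [hβ0 _ fun hb => hball (Metric.ball_subset_ball (min_le_left _ _) hb) hmem, mul_zero]
    rw [this]
    simp
  · simp

/-- The weak divergence is unique almost everywhere, so both traces give the same boundary
functional. This makes the choice in `normalTrace` immaterial, and the edge moments additive on
fields that have a trace. -/
theorem HasNormalTrace.unique {P : Element} {τ : E → Tens} {g g' : Fin P.n → Fin 2 → Polynomial ℝ}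
    (h : HasNormalTrace P τ g) (h' : HasNormalTrace P τ g') : g = g' := by
  obtain ⟨d, hd, hg⟩ := h
  obtain ⟨d', hd', hg'⟩ := h'
  have hdd := hd.ae_unique P.isOpen hd'
  funext e i
  rw [← sub_eq_zero]
  refine congrFun (eq_zero_of_forall_test_edges P (fun e => g e i - g' e i) fun φ hφ => ?_) e
  have h1 := hg φ hφ i
  rw [green_congr (Filter.EventuallyEq.refl _ τ) hdd, hg' φ hφ i] at h1
  have hI : ∀ (e : Fin P.n) (q : Polynomial ℝ),
      IntervalIntegrable (fun s => q.eval s * φ (P.edgePoint e s)) volume (-(1 / 2)) (1 / 2) :=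
    fun e q => (q.continuous.mul
      (hφ.1.continuous.comp (continuous_edgePoint P e))).intervalIntegrable _ _
  rw [← sub_eq_zero, ← neg_eq_zero, neg_sub, ← Finset.sum_sub_distrib] at h1
  rw [← h1]
  refine Finset.sum_congr rfl fun e _ => ?_
  rw [← mul_sub, ← intervalIntegral.integral_sub (hI e _) (hI e _)]
  simp only [Polynomial.eval_sub, sub_mul]

theorem HasNormalTrace.normalTrace_eq {P : Element} {τ : E → Tens}
    {g : Fin P.n → Fin 2 → Polynomial ℝ} (h : HasNormalTrace P τ g) : normalTrace P τ = g := by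
  have hex : ∃ g, HasNormalTrace P τ g := ⟨g, h⟩
  rw [normalTrace, dif_pos hex]
  exact hex.choose_spec.unique h

end

/-! ### Polynomials in the local space and unisolvence. -/

section

/-! ### Polynomial tensors belong to the local spaces -/

/-- The divergence of a polynomial tensor. -/
def divPoly (p : Fin 2 → Fin 2 → MvPolynomial (Fin 2) ℝ) (i : Fin 2) : MvPolynomial (Fin 2) ℝ :=
  ∑ j, MvPolynomial.pderiv j (p i j)

/-- The polynomial tensor obtained by `rotRows`. -/
def rotPoly (p : Fin 2 → Fin 2 → MvPolynomial (Fin 2) ℝ) (i : Fin 2) :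
    Fin 2 → MvPolynomial (Fin 2) ℝ :=
  ![p i 1, -p i 0]

theorem rotRows_evalTens (p : Fin 2 → Fin 2 → MvPolynomial (Fin 2) ℝ) (x : E) :
    rotRows (evalTens p x) = evalTens (rotPoly p) x := by
  ext i j
  fin_cases j <;> simp [rotRows, evalTens, evalVec, rotPoly]

theorem divPoly_mem {p : Fin 2 → Fin 2 → MvPolynomial (Fin 2) ℝ} {k : ℕ}
    (hp : ∀ i j, p i j ∈ Poly k) (i : Fin 2) : divPoly p i ∈ Poly (k - 1) :=
  Submodule.sum_mem _ fun j _ => pderiv_mem_Poly (hp i j) j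

theorem rotPoly_mem {p : Fin 2 → Fin 2 → MvPolynomial (Fin 2) ℝ} {k : ℕ}
    (hp : ∀ i j, p i j ∈ Poly k) (i j : Fin 2) : rotPoly p i j ∈ Poly k := by
  fin_cases j
  · exact hp i 1
  · exact Submodule.neg_mem _ (hp i 0)

theorem continuous_evalVec (p : Fin 2 → MvPolynomial (Fin 2) ℝ) : Continuous (evalVec p) := by
  refine (PiLp.continuous_toLp 2 _).comp (continuous_pi fun j => ?_)
  exact (contDiff_evalPoly (p j)).continuous

theorem memLp_of_continuous {F : Type*} [NormedAddCommGroup F]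
    {U : Set E} (hU : Bornology.IsBounded U) (hm : MeasurableSet U) {f : E → F} (hf : Continuous f) :
    MemLp f 2 (volume.restrict U) := by
  have : IsFiniteMeasure (volume.restrict U) :=
    ⟨by rw [Measure.restrict_apply_univ]; exact hU.measure_lt_top⟩
  obtain ⟨C, hC⟩ := hU.isCompact_closure.exists_bound_of_continuousOn hf.continuousOn
  refine MemLp.of_bound hf.aestronglyMeasurable C ?_
  filter_upwards [ae_restrict_mem hm] with x hx
  exact hC x (subset_closure hx)

theorem memLp_evalVec (P : Element) (p : Fin 2 → MvPolynomial (Fin 2) ℝ) :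
    MemLp (evalVec p) 2 (volume.restrict P.carrier) :=
  memLp_of_continuous P.isBounded P.isOpen.measurableSet (continuous_evalVec p)

/-- The restriction of a polynomial to an edge, in the normalised variable. -/
def edgePoly (P : Element) (e : Fin P.n) (q : MvPolynomial (Fin 2) ℝ) : Polynomial ℝ :=
  MvPolynomial.aeval (fun l => Polynomial.C (P.poly e l + (P.poly (finRotate P.n e) l - P.poly e l) / 2)
    + Polynomial.C (P.poly (finRotate P.n e) l - P.poly e l) * Polynomial.X) q

theorem edgePoint_apply (P : Element) (e : Fin P.n) (s : ℝ) (l : Fin 2) :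
    P.edgePoint e s l = P.poly e l + (s + 1 / 2) * (P.poly (finRotate P.n e) l - P.poly e l) := by
  simp only [Element.edgePoint, Polygon.edgePath, AffineMap.lineMap_apply, vsub_eq_sub,
    vadd_eq_add, PiLp.add_apply, PiLp.smul_apply, PiLp.sub_apply, smul_eq_mul]
  ring

theorem eval_edgePoly (P : Element) (e : Fin P.n) (q : MvPolynomial (Fin 2) ℝ) (s : ℝ) :
    (edgePoly P e q).eval s = evalPoly q (P.edgePoint e s) := by
  induction q using MvPolynomial.induction_on with
  | C a => simp [edgePoly, evalPoly]
  | add p q hp hq =>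
    have h1 : edgePoly P e (p + q) = edgePoly P e p + edgePoly P e q := map_add _ _ _
    have h2 : evalPoly (p + q) (P.edgePoint e s) =
      evalPoly p (P.edgePoint e s) + evalPoly q (P.edgePoint e s) := map_add _ _ _
    rw [h1, h2, Polynomial.eval_add, hp, hq]
  | mul_X p n hp =>
    have h1 : edgePoly P e (p * MvPolynomial.X n) = edgePoly P e p *
        edgePoly P e (MvPolynomial.X n) := map_mul _ _ _
    have h2 : evalPoly (p * MvPolynomial.X n) (P.edgePoint e s) =
      evalPoly p (P.edgePoint e s) * P.edgePoint e s n := by simp [evalPoly]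
    rw [h1, h2, Polynomial.eval_mul, hp, edgePoint_apply]
    congr 1
    simp only [edgePoly, MvPolynomial.aeval_X, Polynomial.eval_add, Polynomial.eval_C,
      Polynomial.eval_mul, Polynomial.eval_X]
    ring

theorem natDegree_edgePoly_le (P : Element) (e : Fin P.n) {q : MvPolynomial (Fin 2) ℝ} {k : ℕ}
    (hq : q ∈ Poly k) : (edgePoly P e q).natDegree ≤ k := by
  have := MvPolynomial.aeval_natDegree_le (n := 1) q
    ((MvPolynomial.mem_restrictTotalDegree _ _ _).1 hq)
    (fun l => Polynomial.C (P.poly e l + (P.poly (finRotate P.n e) l - P.poly e l) / 2)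
      + Polynomial.C (P.poly (finRotate P.n e) l - P.poly e l) * Polynomial.X)
    (fun l => (Polynomial.natDegree_add_le _ _).trans
      (max_le (by simp) ((Polynomial.natDegree_C_mul_le _ _).trans Polynomial.natDegree_X_le)))
  simpa [edgePoly] using this

namespace Element.StarBall

variable {P : Element} {c : E} {r : ℝ}

/-- Gauss' theorem for each product `φ p i j` in the direction `j`. The vectors `ν e` already
contain the edge length, while the trace formula multiplies by it, hence the division. -/
theorem exists_poly_trace (h : P.StarBall c r) (p : Fin 2 → Fin 2 → MvPolynomial (Fin 2) ℝ) {k : ℕ}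
    (hp : ∀ i j, p i j ∈ Poly k) :
    ∃ g : Fin P.n → Fin 2 → Polynomial ℝ, (∀ e i, (g e i).natDegree ≤ k) ∧ ∀ φ, IsTest φ → ∀ i,
      green P.carrier φ (evalTens p) (evalVec (divPoly p)) i = ∑ e, P.edgeLength e *
        ∫ s in (-(1 / 2) : ℝ)..(1 / 2), (g e i).eval s * φ (P.edgePoint e s) := by
  obtain ⟨ν, hν⟩ := h.exists_gauss
  refine ⟨fun e i => ∑ j, Polynomial.C (ν e j / P.edgeLength e) * edgePoly P e (p i j),
    fun e i => ?_, fun φ hφ i => ?_⟩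
  · refine Polynomial.natDegree_sum_le_of_forall_le _ _ fun j _ => ?_
    exact (Polynomial.natDegree_C_mul_le _ _).trans (natDegree_edgePoly_le P e (hp i j))
  · have hsm : ∀ j, ContDiff ℝ 1 fun x => φ x * evalPoly (p i j) x := fun j =>
      (hφ.mul (contDiff_evalPoly (p i j))).1.of_le (by simp)
    have hintg : ∀ j, IntegrableOn (fun x => fderiv ℝ (fun x => φ x * evalPoly (p i j) x) x (bas j))
        P.carrier := fun j =>
      ((((hsm j).continuous_fderiv (by simp)).clm_apply
        continuous_const).continuousOn.integrableOn_compact P.isBounded.isCompact_closure).mono_set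
        subset_closure
    have h1 : green P.carrier φ (evalTens p) (evalVec (divPoly p)) i =
        ∑ j, ∫ x in P.carrier, fderiv ℝ (fun x => φ x * evalPoly (p i j) x) x (bas j) := by
      rw [← integral_finsetSum _ fun j _ => hintg j]
      refine integral_congr_ae (Filter.Eventually.of_forall fun x => ?_)
      have hd : ∀ j, fderiv ℝ (fun x => φ x * evalPoly (p i j) x) x (bas j) =
          φ x * evalPoly (MvPolynomial.pderiv j (p i j)) x +
            evalPoly (p i j) x * fderiv ℝ φ x (bas j) := by
        intro j
        have h2 := (hφ.hasFDerivAt x).mul (hasFDerivAt_evalPoly (p i j) x)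
        change fderiv ℝ (φ * evalPoly (p i j)) x (bas j) = _
        rw [h2.fderiv]
        simp only [add_apply, smul_apply, smul_eq_mul, ← (hasFDerivAt_evalPoly (p i j) x).fderiv,
          fderiv_evalPoly]
        congr 2
        fin_cases j <;> simp [bas]
      simp only [hd, Fin.sum_univ_two]
      rw [map_eq_sum_bas (fderiv ℝ φ x) (evalTens p x i), evalVec_apply, evalTens_apply,
        evalVec_apply, evalVec_apply]
      simp only [divPoly, Fin.sum_univ_two, evalPoly, map_add, smul_eq_mul]
      ring
    rw [h1]
    simp only [hν _ (hsm _)]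
    rw [Finset.sum_comm]
    refine Finset.sum_congr rfl fun e _ => ?_
    have hl := P.edgeLength_pos e
    have hI : ∀ j, IntervalIntegrable (fun s => ν e j / P.edgeLength e *
        (φ (P.edgePoint e s) * evalPoly (p i j) (P.edgePoint e s))) volume (-(1 / 2)) (1 / 2) := by
      intro j
      exact (continuous_const.mul ((hsm j).continuous.comp
        (continuous_edgePoint P e))).intervalIntegrable _ _
    have h3 : ∀ s, (∑ j, Polynomial.C (ν e j / P.edgeLength e) * edgePoly P e (p i j)).eval s *
        φ (P.edgePoint e s) = ∑ j, ν e j / P.edgeLength e *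
          (φ (P.edgePoint e s) * evalPoly (p i j) (P.edgePoint e s)) := by
      intro s
      rw [Polynomial.eval_finsetSum, Finset.sum_mul]
      refine Finset.sum_congr rfl fun j _ => ?_
      rw [Polynomial.eval_mul, Polynomial.eval_C, eval_edgePoly]
      ring
    simp only [h3]
    rw [intervalIntegral.integral_finsetSum fun j _ => hI j, Finset.mul_sum]
    refine Finset.sum_congr rfl fun j _ => ?_
    rw [intervalIntegral.integral_const_mul, ← mul_assoc, mul_div_cancel₀ _ hl.ne']
    congr 1
    fin_cases j <;> simp [inner_eq, bas]

/-- Test functions supported in the open element vanish on the edges, so the boundary terms drop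
out. The degree bound in the proof serves only to call the trace formula. -/
theorem hasWeakDiv_poly (h : P.StarBall c r) (p : Fin 2 → Fin 2 → MvPolynomial (Fin 2) ℝ) :
    HasWeakDiv P.carrier (evalTens p) (evalVec (divPoly p)) := by
  refine ⟨memLp_evalTens P p, memLp_evalVec P _, fun φ hφ hs i => ?_⟩
  obtain ⟨k, hk⟩ : ∃ k, ∀ i j, p i j ∈ Poly k := by
    refine ⟨∑ i, ∑ j, (p i j).totalDegree, fun i j => ?_⟩
    rw [MvPolynomial.mem_restrictTotalDegree]
    exact (Finset.single_le_sum (f := fun j => (p i j).totalDegree) (fun _ _ => Nat.zero_le _)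
      (Finset.mem_univ j)).trans (Finset.single_le_sum
        (f := fun i => ∑ j, (p i j).totalDegree) (fun _ _ => Nat.zero_le _) (Finset.mem_univ i))
  obtain ⟨g, -, hg⟩ := h.exists_poly_trace p hk
  rw [hg φ hφ i]
  refine Finset.sum_eq_zero fun e _ => ?_
  have : ∫ s in (-(1 / 2) : ℝ)..(1 / 2), (g e i).eval s * φ (P.edgePoint e s) =
      ∫ s in (-(1 / 2) : ℝ)..(1 / 2), (0 : ℝ) := by
    refine intervalIntegral.integral_congr fun s hs' => ?_
    rw [uIcc_of_le (by norm_num)] at hs'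
    rw [image_eq_zero_of_notMem_tsupport fun hm => edgePoint_notMem P e hs' (hs hm), mul_zero]
  rw [this]
  simp

theorem hasWeakCurl_poly (h : P.StarBall c r) (p : Fin 2 → Fin 2 → MvPolynomial (Fin 2) ℝ) :
    HasWeakCurl P.carrier (evalTens p) (evalVec (divPoly (rotPoly p))) := by
  have := h.hasWeakDiv_poly (rotPoly p)
  unfold HasWeakCurl
  simpa only [rotRows_evalTens] using this

/-- This puts `σ - Πσ` in the local space, the domain on which the degrees of freedom are known to
be linear. -/
theorem memLocalStress_poly (h : P.StarBall c r) {p : Fin 2 → Fin 2 → MvPolynomial (Fin 2) ℝ}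
    {k : ℕ} (hp : ∀ i j, p i j ∈ Poly k) : MemLocalStress k P (evalTens p) := by
  obtain ⟨g, hg, hg'⟩ := h.exists_poly_trace p hp
  exact ⟨⟨_, h.hasWeakDiv_poly p, divPoly p, fun j => Poly_mono (Nat.sub_le _ _) (divPoly_mem hp j),
      Filter.Eventually.of_forall fun x => rfl⟩,
    ⟨_, h.hasWeakCurl_poly p, divPoly (rotPoly p), divPoly_mem (rotPoly_mem hp),
      Filter.Eventually.of_forall fun x => rfl⟩,
    g, hg, _, h.hasWeakDiv_poly p, hg'⟩

end Element.StarBall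

/-! ### Unisolvence -/

/-- The tensor polynomial with one non-zero row. -/
def rowPoly (i : Fin 2) (v : Fin 2 → MvPolynomial (Fin 2) ℝ) :
    Fin 2 → Fin 2 → MvPolynomial (Fin 2) ℝ := Pi.single i v

theorem rowPoly_mem {k : ℕ} (i : Fin 2) {v : Fin 2 → MvPolynomial (Fin 2) ℝ}
    (hv : ∀ j, v j ∈ Poly k) (i' j : Fin 2) : rowPoly i v i' j ∈ Poly k := by
  unfold rowPoly
  by_cases h : i' = i
  · subst h; simpa using hv j
  · rw [Pi.single_eq_of_ne h]; exact Submodule.zero_mem _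

theorem inner_tens (s t : Tens) : inner ℝ s t = inner ℝ (s 0) (t 0) + inner ℝ (s 1) (t 1) := by
  rw [PiLp.inner_apply, Fin.sum_univ_two]

theorem inner_rowPoly (t : Tens) (i : Fin 2) (v : Fin 2 → MvPolynomial (Fin 2) ℝ) (x : E) :
    inner ℝ t (evalTens (rowPoly i v) x) = inner ℝ (t i) (evalVec v x) := by
  have h0 : evalVec 0 x = 0 := by ext j; simp [evalVec]
  rw [inner_tens, evalTens_apply, evalTens_apply]
  fin_cases i <;> simp [rowPoly, h0]

/-- A field in the local space with zero normal trace which is orthogonal to the polynomials of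
degree at most `k` is zero. -/
theorem Element.StarBall.ae_eq_zero {P : Element} {c : E} {r : ℝ} (h : P.StarBall c r) {k : ℕ}
    (hk : 1 ≤ k) {τ : E → Tens} (hτ : MemLocalStress k P τ) (htr : HasNormalTrace P τ 0)
    (hproj : ∀ p : Fin 2 → Fin 2 → MvPolynomial (Fin 2) ℝ, (∀ i j, p i j ∈ Poly k) →
      ∫ x in P.carrier, inner ℝ (τ x) (evalTens p x) = 0) :
    τ =ᵐ[volume.restrict P.carrier] 0 := by
  obtain ⟨⟨d, hd, dp, hdp, hdp'⟩, ⟨cu, hcu, cp, hcp, hcp'⟩, -⟩ := hτ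
  obtain ⟨d', hd', htr⟩ := htr
  have hKm := P.isOpen.measurableSet
  have hrow : ∀ i (v : Fin 2 → MvPolynomial (Fin 2) ℝ), (∀ j, v j ∈ Poly k) →
      ∫ x in P.carrier, inner ℝ (τ x i) (evalVec v x) = 0 := by
    intro i v hv
    simpa only [inner_rowPoly] using hproj (rowPoly i v) (rowPoly_mem i hv)
  have hmem := hd.1
  have hgreen : ∀ φ, IsTest φ → ∀ i, green P.carrier φ τ (evalVec dp) i = 0 := by
    intro φ hφ i
    have h1 := htr φ hφ i
    rw [green_congr (Filter.EventuallyEq.refl _ τ)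
      ((hd'.ae_unique P.isOpen hd).trans hdp')] at h1
    simpa using h1
  -- the divergence vanishes
  have hdiv0 : ∀ i, (fun x => evalPoly (dp i) x) =ᵐ[volume.restrict P.carrier] 0 := by
    intro i
    -- Green's formula is tested with the divergence itself, cut off outside `K`. The boundary term
    -- is zero, and so is the gradient term, as the gradient of a polynomial of degree at most `k`
    -- is orthogonal to `τ`. What is left is the integral of the squared divergence.
    obtain ⟨φ, hφ, hφe⟩ := exists_test_eqOn P.isBounded (contDiff_evalPoly (dp i))
    have h1 := hgreen φ hφ i
    have hz := hrow i (fun j => MvPolynomial.pderiv j (dp i))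
      (fun j => Poly_mono (Nat.sub_le _ _) (pderiv_mem_Poly (hdp i) j))
    have hi1 : Integrable (fun x => inner ℝ (τ x i)
        (evalVec (fun j => MvPolynomial.pderiv j (dp i)) x)) (volume.restrict P.carrier) :=
      integrable_inner_of_memLp (memLp_row hmem i) (memLp_evalVec P _)
    have hq : MemLp (evalPoly (dp i)) 2 (volume.restrict P.carrier) :=
      memLp_of_continuous P.isBounded hKm (contDiff_evalPoly _).continuous
    have hi2 := hq.integrable_sq
    have h2 : green P.carrier φ τ (evalVec dp) i =
        ∫ x in P.carrier, (inner ℝ (τ x i) (evalVec (fun j => MvPolynomial.pderiv j (dp i)) x) +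
          evalPoly (dp i) x ^ 2) := by
      refine setIntegral_congr_fun hKm fun x hx => ?_
      simp only
      rw [(hφe x hx).1, (hφe x hx).2, fderiv_evalPoly, inner_eq, Fin.sum_univ_two, evalVec_apply,
        evalVec_apply, evalVec_apply]
      ring
    rw [h2, integral_add hi1 hi2, hz, zero_add] at h1
    have h3 := (integral_eq_zero_iff_of_nonneg (fun x => sq_nonneg _) hi2).1 h1
    filter_upwards [h3] with x hx
    simpa using hx
  have hfree : ∀ i φ, IsTest φ → ∫ x in P.carrier, fderiv ℝ φ x (τ x i) = 0 := by
    intro i φ hφ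
    rw [← hgreen φ hφ i]
    refine integral_congr_ae ?_
    filter_upwards [hdiv0 i] with x hx
    rw [evalVec_apply, hx]
    simp
  -- a polynomial with the same curl
  have hQ : ∀ i, ∃ q ∈ Poly k, MvPolynomial.pderiv 0 q = cp i := by
    intro i
    obtain ⟨q, hq, hq'⟩ := exists_pderiv_eq (hcp i) 0
    -- Integrating raises the degree from `k - 1` to `k - 1 + 1`, which is `k` only because `1 ≤ k`.
    -- The field `(0, q)` then still has degree at most `k`, so `τ` is orthogonal to it.
    exact ⟨q, by rwa [Nat.sub_add_cancel hk] at hq, hq'⟩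
  choose q hqk hqc using hQ
  set Q : Fin 2 → Fin 2 → MvPolynomial (Fin 2) ℝ := fun i => ![0, q i] with hQdef
  have hQk : ∀ i j, Q i j ∈ Poly k := by
    intro i j
    fin_cases j
    · exact Submodule.zero_mem _
    · exact hqk i
  have hcurlQ := h.hasWeakCurl_poly Q
  have hdivrot : divPoly (rotPoly Q) = cp := by
    funext i
    simp [divPoly, rotPoly, hQdef, hqc]
  rw [hdivrot] at hcurlQ
  have hzero : ∀ i, ∫ x in P.carrier, inner ℝ (τ x i) (τ x i) = 0 := by
    intro i
    have hw : MemLp (fun x => τ x i - evalVec (Q i) x) 2 (volume.restrict P.carrier) :=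
      (memLp_row hmem i).sub (memLp_evalVec P _)
    -- The row of `τ` is solenoidal with zero normal trace, and the same row minus `Q i` is
    -- curl-free, so they are orthogonal; together with `τ ⟂ Q` this gives `∫ |τ i|² = 0`.
    have hcore := integral_inner_eq_zero_of_star h.pos P.isBounded hKm h.star (memLp_row hmem i) hw
      (hfree i) (fun φ hφ hs => by
        have h1 := hcu.2.2 φ hφ hs i
        have h2 := hcurlQ.2.2 φ hφ hs i
        have e1 := integrable_green hφ hcu.1 hcu.2.1 i
        have e2 := integrable_green hφ hcurlQ.1 hcurlQ.2.1 i
        unfold green at h1 h2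
        have h3 := integral_sub e1 e2
        rw [h1, h2, sub_zero] at h3
        rw [← h3]
        refine integral_congr_ae ?_
        filter_upwards [hcp'] with x hx
        rw [hx]
        simp only [rotRows_apply, evalTens_apply, map_sub]
        ring)
    have hz := hrow i (Q i) (hQk i)
    have e1 := integrable_inner_of_memLp hw (memLp_row hmem i)
    have e2 := integrable_inner_of_memLp (memLp_row hmem i) (memLp_evalVec P (Q i))
    have h4 := integral_add e1 e2
    rw [hcore, hz, add_zero] at h4
    rw [← h4]
    refine integral_congr_ae (Filter.Eventually.of_forall fun x => ?_)
    simp only [inner_sub_left, real_inner_comm (τ x i) (evalVec (Q i) x)]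
    ring
  have hrow0 : ∀ i, (fun x => τ x i) =ᵐ[volume.restrict P.carrier] 0 := by
    intro i
    have h3 := (integral_eq_zero_iff_of_nonneg (fun x => real_inner_self_nonneg)
      (integrable_inner_of_memLp (memLp_row hmem i) (memLp_row hmem i))).1 (hzero i)
    filter_upwards [h3] with x hx
    exact inner_self_eq_zero.1 hx
  filter_upwards [hrow0 0, hrow0 1] with x h0 h1
  ext i j
  fin_cases i
  · simpa using congrArg (fun v : E => v j) h0
  · simpa using congrArg (fun v : E => v j) h1

end

/-! ### Degrees of freedom, definiteness of the discrete forms, finite dimension. -/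

section

/-! ### Restriction to elements -/

/-- Restriction of square integrable fields to a smaller set. -/
def restrL {F : Type} [NormedAddCommGroup F] [NormedSpace ℝ F] {U V : Set E} (h : V ⊆ U) :
    L2 U F →ₗ[ℝ] L2 V F where
  toFun τ := ((Lp.memLp τ).mono_measure (Measure.restrict_mono h le_rfl)).toLp
  map_add' σ τ := by
    rw [← MemLp.toLp_add]
    exact MemLp.toLp_congr _ _ (ae_restrict_of_ae_restrict_of_subset h (Lp.coeFn_add σ τ))
  map_smul' a τ := by
    rw [RingHom.id_apply, ← MemLp.toLp_const_smul]
    exact MemLp.toLp_congr _ _ (ae_restrict_of_ae_restrict_of_subset h (Lp.coeFn_smul a τ))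

theorem coeFn_restrL {F : Type} [NormedAddCommGroup F] [NormedSpace ℝ F] {U V : Set E} (h : V ⊆ U)
    (τ : L2 U F) : restrL h τ =ᵐ[volume.restrict V] τ :=
  ((Lp.memLp τ).mono_measure (Measure.restrict_mono h le_rfl)).coeFn_toLp

theorem restr_eq {Ω : Set E} (𝒯 : Mesh Ω) (K : Fin 𝒯.N) (τ : L2 Ω Tens) :
    restr 𝒯 K τ = restrL (𝒯.subset K) τ := rfl

theorem volume_frontier_element (P : Element) : volume (frontier P.carrier) = 0 := by
  rw [P.frontier_eq]
  refine measure_iUnion_null fun e => measure_mono_null (t := (fun x => x + -P.poly e) ⁻¹'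
    ((ℝ ∙ (P.poly (finRotate P.n e) - P.poly e) : Submodule ℝ E) : Set E)) ?_ ?_
  · intro x hx
    rw [Polygon.edgeSet_eq_image_edgePath] at hx
    obtain ⟨t, -, rfl⟩ := hx
    simp only [Polygon.edgePath, AffineMap.lineMap_apply, vsub_eq_sub, vadd_eq_add, mem_preimage,
      add_neg_cancel_right]
    exact Submodule.smul_mem _ _ (Submodule.mem_span_singleton_self _)
  · rw [measure_preimage_add_right]
    exact volume_span_singleton _

/-- Only the closures of the elements cover `Ω`, but their boundaries are null sets. -/
theorem Mesh.ae_of_forall {Ω : Set E} (hΩ : MeasurableSet Ω) (𝒯 : Mesh Ω) {p : E → Prop}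
    (h : ∀ K, ∀ᵐ x ∂volume.restrict (𝒯.elem K).carrier, p x) : ∀ᵐ x ∂volume.restrict Ω, p x := by
  have h1 : ∀ K, ∀ᵐ x ∂(volume : Measure E), x ∈ (𝒯.elem K).carrier → p x := fun K =>
    (ae_restrict_iff' (𝒯.elem K).isOpen.measurableSet).1 (h K)
  have h2 : ∀ K, ∀ᵐ x ∂(volume : Measure E), x ∉ frontier (𝒯.elem K).carrier := fun K =>
    measure_eq_zero_iff_ae_notMem.1 (volume_frontier_element _)
  rw [ae_restrict_iff' hΩ]
  filter_upwards [ae_all_iff.2 h1, ae_all_iff.2 h2] with x hx1 hx2 hxΩ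
  have hxc := subset_closure hxΩ
  rw [𝒯.cover] at hxc
  obtain ⟨K, hK⟩ := mem_iUnion.1 hxc
  refine hx1 K (by_contra fun hn => hx2 K ?_)
  rw [frontier, (𝒯.elem K).isOpen.interior_eq]
  exact ⟨hK, hn⟩

theorem Mesh.eq_zero_of_restrL {Ω : Set E} (hΩ : MeasurableSet Ω) (𝒯 : Mesh Ω) {F : Type}
    [NormedAddCommGroup F] [NormedSpace ℝ F] {τ : L2 Ω F}
    (h : ∀ K, restrL (𝒯.subset K) τ = 0) : τ = 0 := by
  rw [Lp.eq_zero_iff_ae_eq_zero]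
  refine 𝒯.ae_of_forall hΩ fun K => ?_
  have h1 := coeFn_restrL (𝒯.subset K) τ
  rw [h K] at h1
  exact h1.symm.trans (Lp.coeFn_zero _ _ _)

/-! ### Degrees of freedom on the local space -/

/-- The local space as a subspace of `L²(K)`. -/
def localStress (k : ℕ) (P : Element) : Submodule ℝ (L2 P.carrier Tens) where
  carrier := {τ | MemLocalStress k P τ}
  zero_mem' := (MemLocalStress.zero k P).congr (Lp.coeFn_zero _ _ _).symm
  add_mem' {σ τ} hσ hτ := (MemLocalStress.add hσ hτ).congr (Lp.coeFn_add σ τ).symm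
  smul_mem' a τ hτ := (MemLocalStress.smul hτ a).congr (Lp.coeFn_smul a τ).symm

theorem MemLocalStress.hasNormalTrace {k : ℕ} {P : Element} {τ : E → Tens}
    (h : MemLocalStress k P τ) : HasNormalTrace P τ (normalTrace P τ) := by
  obtain ⟨-, -, g, -, hg⟩ := h
  rwa [hg.normalTrace_eq]

theorem MemLocalStress.natDegree_normalTrace_le {k : ℕ} {P : Element} {τ : E → Tens}
    (h : MemLocalStress k P τ) (e : Fin P.n) (i : Fin 2) :
    (normalTrace P τ e i).natDegree ≤ k := by
  obtain ⟨-, -, g, hg, hg'⟩ := h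
  rw [hg'.normalTrace_eq]
  exact hg e i

theorem integral_inner_add_left {U : Set E} {g : E → Tens} (hg : MemLp g 2 (volume.restrict U))
    (σ τ : L2 U Tens) : ∫ x in U, inner ℝ ((σ + τ : L2 U Tens) x) (g x) =
      (∫ x in U, inner ℝ (σ x) (g x)) + ∫ x in U, inner ℝ (τ x) (g x) := by
  rw [← integral_add (integrable_inner_of_memLp (Lp.memLp σ) hg)
    (integrable_inner_of_memLp (Lp.memLp τ) hg)]
  refine integral_congr_ae ?_
  filter_upwards [Lp.coeFn_add σ τ] with x hx
  rw [hx, Pi.add_apply, inner_add_left]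

theorem integral_inner_smul_left {U : Set E} {g : E → Tens} (a : ℝ) (τ : L2 U Tens) :
    ∫ x in U, inner ℝ ((a • τ : L2 U Tens) x) (g x) = a * ∫ x in U, inner ℝ (τ x) (g x) := by
  rw [← integral_const_mul]
  refine integral_congr_ae ?_
  filter_upwards [Lp.coeFn_smul a τ] with x hx
  rw [hx, Pi.smul_apply, real_inner_smul_left]

variable {Ω : Set E} {𝒯 : Mesh Ω} {k : ℕ}

/-- The degrees of freedom, as a linear map on the local space. -/
def dofL (b : DofBasis 𝒯 k) (K : Fin 𝒯.N) :
    localStress k (𝒯.elem K) →ₗ[ℝ] (DofIndex b K → ℝ) where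
  toFun τ := dof b K τ.1
  map_add' σ τ := by
    -- `normalTrace` is a choice, with value zero where no trace exists. It is additive here because
    -- both fields have a trace and traces are unique.
    have htr : normalTrace (𝒯.elem K) (σ.1 + τ.1 : L2 _ Tens) =
        normalTrace (𝒯.elem K) σ.1 + normalTrace (𝒯.elem K) τ.1 :=
      ((σ.2.hasNormalTrace.add τ.2.hasNormalTrace).congr
        (Lp.coeFn_add σ.1 τ.1).symm).normalTrace_eq
    funext l
    rcases l with ⟨e, i, β⟩ | l | l
    · simp only [Pi.add_apply, dof, Submodule.coe_add, htr, Polynomial.eval_add, add_mul]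
      refine intervalIntegral.integral_add ?_ ?_ <;>
        exact ((Polynomial.continuous _).mul (by fun_prop)).intervalIntegrable _ _
    · simp only [Pi.add_apply, dof, Submodule.coe_add,
        integral_inner_add_left (memLp_evalTens _ _), mul_add]
    · simp only [Pi.add_apply, dof, Submodule.coe_add,
        integral_inner_add_left (memLp_evalTens _ _), mul_add]
  map_smul' a τ := by
    have htr : normalTrace (𝒯.elem K) (a • τ.1 : L2 _ Tens) =
        a • normalTrace (𝒯.elem K) τ.1 :=
      ((τ.2.hasNormalTrace.smul a).congr (Lp.coeFn_smul a τ.1).symm).normalTrace_eq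
    funext l
    rcases l with ⟨e, i, β⟩ | l | l
    · simp only [Pi.smul_apply, dof, Submodule.coe_smul, htr, Polynomial.eval_smul, smul_eq_mul,
        mul_assoc, RingHom.id_apply, intervalIntegral.integral_const_mul]
    · simp only [Pi.smul_apply, dof, Submodule.coe_smul, integral_inner_smul_left, smul_eq_mul,
        RingHom.id_apply]
      ring
    · simp only [Pi.smul_apply, dof, Submodule.coe_smul, integral_inner_smul_left, smul_eq_mul,
        RingHom.id_apply]
      ring

theorem dofL_apply (b : DofBasis 𝒯 k) (K : Fin 𝒯.N) (τ : localStress k (𝒯.elem K)) :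
    dofL b K τ = dof b K τ.1 := rfl

/-- A polynomial all of whose moments up to its degree vanish on an interval is zero. -/
theorem polynomial_eq_zero_of_moments {p : Polynomial ℝ} {k : ℕ} (hp : p.natDegree ≤ k)
    (h : ∀ β : Fin (k + 1), ∫ s in (-(1 / 2) : ℝ)..(1 / 2), p.eval s * s ^ (β : ℕ) = 0) : p = 0 := by
  have hsq : ∫ s in (-(1 / 2) : ℝ)..(1 / 2), p.eval s * p.eval s = 0 := by
    have h1 : ∀ s, p.eval s * p.eval s =
        ∑ i ∈ Finset.range (k + 1), p.coeff i * (p.eval s * s ^ i) := by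
      intro s
      nth_rw 2 [Polynomial.eval_eq_sum_range' (Nat.lt_succ_of_le hp)]
      rw [Finset.mul_sum]
      exact Finset.sum_congr rfl fun i _ => by ring
    simp only [h1]
    have hI : ∀ i, IntervalIntegrable (fun s => p.coeff i * (p.eval s * s ^ i)) volume
        (-(1 / 2)) (1 / 2) := fun i =>
      (continuous_const.mul (p.continuous.mul (continuous_pow i))).intervalIntegrable _ _
    rw [intervalIntegral.integral_finsetSum fun i _ => hI i]
    refine Finset.sum_eq_zero fun i hi => ?_
    rw [intervalIntegral.integral_const_mul, h ⟨i, Finset.mem_range.1 hi⟩, mul_zero]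
  by_contra hne
  obtain ⟨s, hs, hps⟩ : ∃ s ∈ Ioo (-(1 / 2) : ℝ) (1 / 2), p.eval s ≠ 0 := by
    by_contra! hall
    exact hne (Polynomial.eq_zero_of_infinite_isRoot _ ((Ioo_infinite (by norm_num)).mono hall))
  have := intervalIntegral.integral_pos (a := -(1 / 2)) (b := 1 / 2)
    (f := fun s => p.eval s * p.eval s) (by norm_num) (p.continuous.mul p.continuous).continuousOn
    (fun _ _ => mul_self_nonneg _) ⟨s, Ioo_subset_Icc_self hs, mul_self_pos.2 hps⟩
  exact this.ne' hsq

theorem polyL2_le_localStress {P : Element} {c : E} {r : ℝ} (h : P.StarBall c r) :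
    polyL2 k P ≤ localStress k P := by
  rintro _ ⟨p, rfl⟩
  exact (h.memLocalStress_poly fun i j => (p i j).2).congr
    (memLp_evalTens P fun i j => (p i j).1).coeFn_toLp.symm

/-- The edge moments up to order `k` annihilate the normal trace, a polynomial of degree at most
`k`, and a vanishing projection is orthogonality to the polynomials; unisolvence does the rest. The
interior moments carry no further information, being moments against polynomials. -/
theorem eq_zero_of_proj_of_dof {b : DofBasis 𝒯 k} {K : Fin 𝒯.N} {c : E} {r : ℝ}
    (h : (𝒯.elem K).StarBall c r) (hk : 1 ≤ k) {τ : L2 (𝒯.elem K).carrier Tens}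
    (hτ : MemLocalStress k (𝒯.elem K) τ) (hp : proj k (𝒯.elem K) τ = 0) (hd : dof b K τ = 0) :
    τ = 0 := by
  rw [Lp.eq_zero_iff_ae_eq_zero]
  refine h.ae_eq_zero hk hτ ?_ fun p hpk => ?_
  · have htr := hτ.hasNormalTrace
    have h0 : normalTrace (𝒯.elem K) τ = 0 := by
      funext e i
      refine polynomial_eq_zero_of_moments (hτ.natDegree_normalTrace_le e i) fun β => ?_
      exact congrFun hd (.inl (e, i, β))
    rwa [h0] at htr
  · have h1 : τ ∈ (polyL2 k (𝒯.elem K))ᗮ :=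
      (Submodule.starProjection_apply_eq_zero_iff _).1 hp
    have h2 := (Submodule.mem_orthogonal' _ _).1 h1 _
      ⟨fun i j => ⟨p i j, hpk i j⟩, rfl⟩
    rw [L2.inner_def] at h2
    rw [← h2]
    refine integral_congr_ae ?_
    filter_upwards [(memLp_evalTens (𝒯.elem K) p).coeFn_toLp] with x hx
    simp only [polyToL2, LinearMap.coe_mk, AddHom.coe_mk, hx]

/-! ### The discrete stress forms -/

/-- `σ - Πσ` as an element of the local space. -/
def residual {K : Fin 𝒯.N} {c : E} {r : ℝ} (h : (𝒯.elem K).StarBall c r) (Γσ : Set E) :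
    stressSpace 𝒯 Γσ k →ₗ[ℝ] localStress k (𝒯.elem K) where
  toFun σ := ⟨restr 𝒯 K σ - proj k (𝒯.elem K) (restr 𝒯 K σ), Submodule.sub_mem _
    ((σ.2.2 K).congr (coeFn_restrL (𝒯.subset K) σ.1).symm)
    (polyL2_le_localStress h (Submodule.starProjection_apply_mem _ _))⟩
  map_add' σ τ := by
    ext1
    simp only [restr_eq, proj, Submodule.coe_add, map_add]
    abel
  map_smul' a τ := by
    ext1
    simp only [restr_eq, proj, Submodule.coe_smul, map_smul, RingHom.id_apply, smul_sub]

/-- The trace as a continuous linear form. -/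
def trL : Tens →L[ℝ] ℝ :=
  (PiLp.proj (𝕜 := ℝ) 2 (fun _ : Fin 2 => ℝ) 0).comp (PiLp.proj (𝕜 := ℝ) 2 (fun _ : Fin 2 => E) 0) +
    (PiLp.proj (𝕜 := ℝ) 2 (fun _ : Fin 2 => ℝ) 1).comp (PiLp.proj (𝕜 := ℝ) 2 (fun _ : Fin 2 => E) 1)

theorem trL_apply (t : Tens) : trL t = tr t := rfl

theorem integrable_tr_mul {U : Set E} (σ τ : L2 U Tens) :
    Integrable (fun x => tr (σ x) * tr (τ x)) (volume.restrict U) :=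
  (trL.comp_memLp' (Lp.memLp σ)).integrable_mul (trL.comp_memLp' (Lp.memLp τ))

theorem integral_tr_add_left {U : Set E} (σ σ' τ : L2 U Tens) :
    ∫ x in U, tr ((σ + σ' : L2 U Tens) x) * tr (τ x) =
      (∫ x in U, tr (σ x) * tr (τ x)) + ∫ x in U, tr (σ' x) * tr (τ x) := by
  rw [← integral_add (integrable_tr_mul σ τ) (integrable_tr_mul σ' τ)]
  refine integral_congr_ae ?_
  filter_upwards [Lp.coeFn_add σ σ'] with x hx
  rw [hx, Pi.add_apply, ← trL_apply, map_add, add_mul]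
  rfl

theorem integral_tr_smul_left {U : Set E} (a : ℝ) (σ τ : L2 U Tens) :
    ∫ x in U, tr ((a • σ : L2 U Tens) x) * tr (τ x) = a * ∫ x in U, tr (σ x) * tr (τ x) := by
  rw [← integral_const_mul]
  refine integral_congr_ae ?_
  filter_upwards [Lp.coeFn_smul a σ] with x hx
  rw [hx, Pi.smul_apply, ← trL_apply, map_smul, smul_eq_mul, mul_assoc]
  rfl

theorem stressForm_comm (b : DofBasis 𝒯 k) (L : Lame) (σ τ : L2 Ω Tens) :
    stressForm b L σ τ = stressForm b L τ σ := by
  unfold stressForm localForm stab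
  refine Finset.sum_congr rfl fun K _ => ?_
  congr 2
  · congr 1
    · exact integral_congr_ae (.of_forall fun x => real_inner_comm _ _)
    · congr 1
      exact integral_congr_ae (.of_forall fun x => mul_comm _ _)
  · exact Finset.sum_congr rfl fun l _ => mul_comm _ _

/-- All the elements of the mesh are star-shaped with respect to some ball. -/
def Mesh.IsStar (𝒯 : Mesh Ω) : Prop := ∀ K, ∃ c r, (𝒯.elem K).StarBall c r

/-- Additivity is stated for summands in the stress space because `dof` involves a chosen normal
trace; the argument passes through `residual`, which lands in the local space. -/
theorem stressForm_add_left (h𝒯 : 𝒯.IsStar) (b : DofBasis 𝒯 k) (L : Lame) {Γσ : Set E}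
    (σ σ' : stressSpace 𝒯 Γσ k) (τ : L2 Ω Tens) :
    stressForm b L (σ + σ' : stressSpace 𝒯 Γσ k) τ = stressForm b L σ τ + stressForm b L σ' τ := by
  unfold stressForm
  rw [← Finset.sum_add_distrib]
  refine Finset.sum_congr rfl fun K _ => ?_
  obtain ⟨c, r, hK⟩ := h𝒯 K
  have hd := LinearMap.map_add (dofL b K) (residual hK Γσ σ) (residual hK Γσ σ')
  rw [← LinearMap.map_add (residual (k := k) hK Γσ)] at hd
  simp only [dofL_apply] at hd
  have hp : proj k (𝒯.elem K) (restr 𝒯 K (σ + σ' : stressSpace 𝒯 Γσ k)) =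
      proj k (𝒯.elem K) (restr 𝒯 K σ) + proj k (𝒯.elem K) (restr 𝒯 K σ') := by
    simp only [restr_eq, proj, Submodule.coe_add, map_add]
  have hs : ∀ t : E → Tens, stab b K (restr 𝒯 K (σ + σ' : stressSpace 𝒯 Γσ k) -
      proj k (𝒯.elem K) (restr 𝒯 K (σ + σ' : stressSpace 𝒯 Γσ k)) : L2 _ Tens) t =
      stab b K (restr 𝒯 K σ - proj k (𝒯.elem K) (restr 𝒯 K σ) : L2 _ Tens) t +
      stab b K (restr 𝒯 K σ' - proj k (𝒯.elem K) (restr 𝒯 K σ') : L2 _ Tens) t := by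
    intro t
    unfold stab
    rw [← mul_add, ← Finset.sum_add_distrib]
    congr 1
    refine Finset.sum_congr rfl fun l _ => ?_
    have := congrFun hd l
    simp only [residual, LinearMap.coe_mk, AddHom.coe_mk, Pi.add_apply] at this
    rw [this, add_mul]
  unfold localForm
  rw [hs, hp, integral_inner_add_left (Lp.memLp _), integral_tr_add_left]
  ring

theorem stressForm_smul_left (h𝒯 : 𝒯.IsStar) (b : DofBasis 𝒯 k) (L : Lame) {Γσ : Set E} (a : ℝ)
    (σ : stressSpace 𝒯 Γσ k) (τ : L2 Ω Tens) :
    stressForm b L (a • σ : stressSpace 𝒯 Γσ k) τ = a * stressForm b L σ τ := by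
  unfold stressForm
  rw [Finset.mul_sum]
  refine Finset.sum_congr rfl fun K _ => ?_
  obtain ⟨c, r, hK⟩ := h𝒯 K
  have hd : dofL b K (residual hK Γσ (a • σ)) = a • dofL b K (residual hK Γσ σ) := by
    rw [map_smul (residual (k := k) hK Γσ) a σ, map_smul (dofL b K) a (residual hK Γσ σ)]
  simp only [dofL_apply] at hd
  have hp : proj k (𝒯.elem K) (restr 𝒯 K (a • σ : stressSpace 𝒯 Γσ k)) =
      a • proj k (𝒯.elem K) (restr 𝒯 K σ) := by
    simp only [restr_eq, proj, Submodule.coe_smul, map_smul]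
  have hs : ∀ t : E → Tens, stab b K (restr 𝒯 K (a • σ : stressSpace 𝒯 Γσ k) -
      proj k (𝒯.elem K) (restr 𝒯 K (a • σ : stressSpace 𝒯 Γσ k)) : L2 _ Tens) t =
      a * stab b K (restr 𝒯 K σ - proj k (𝒯.elem K) (restr 𝒯 K σ) : L2 _ Tens) t := by
    intro t
    unfold stab
    rw [mul_left_comm]
    congr 1
    rw [Finset.mul_sum]
    refine Finset.sum_congr rfl fun l _ => ?_
    have := congrFun hd l
    simp only [residual, LinearMap.coe_mk, AddHom.coe_mk, Pi.smul_apply, smul_eq_mul] at this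
    rw [this, mul_assoc]
  unfold localForm
  rw [hs, hp, integral_inner_smul_left, integral_tr_smul_left]
  ring

/-- The discrete stress form as a bilinear form on the stress space. -/
def stressBil (h𝒯 : 𝒯.IsStar) (b : DofBasis 𝒯 k) (L : Lame) (Γσ : Set E) :
    stressSpace 𝒯 Γσ k →ₗ[ℝ] stressSpace 𝒯 Γσ k →ₗ[ℝ] ℝ :=
  LinearMap.mk₂ ℝ (fun σ τ => stressForm b L σ τ)
    (fun σ σ' τ => stressForm_add_left h𝒯 b L σ σ' τ)
    (fun a σ τ => stressForm_smul_left h𝒯 b L a σ τ)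
    (fun σ τ τ' => by
      rw [stressForm_comm, stressForm_add_left h𝒯, stressForm_comm b L τ, stressForm_comm b L τ'])
    (fun a σ τ => by rw [stressForm_comm, stressForm_smul_left h𝒯, stressForm_comm b L τ]; rfl)

/-- With `κ = λ / (2μ + 2λ)` one has `1 - 2κ = 2μ / (2μ + 2λ) > 0`, and `(tr t)² ≤ 2 |t|²` in
dimension two. For `κ ≤ 0` the subtracted term only helps, and the constant `1` works. -/
theorem exists_compliance_lower_bound (L : Lame) :
    ∃ ε > 0, ∀ t : Tens, ε * inner ℝ t t ≤
      inner ℝ t t - L.lam / (2 * L.mu + 2 * L.lam) * (tr t * tr t) := by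
  have hb := L.bulk_pos
  have hm := L.mu_pos
  set κ := L.lam / (2 * L.mu + 2 * L.lam) with hκ
  have h1 : 0 < 1 - 2 * κ := by
    have : 1 - 2 * κ = 2 * L.mu / (2 * L.mu + 2 * L.lam) := by
      rw [hκ, eq_div_iff hb.ne', sub_mul, mul_assoc, div_mul_cancel₀ _ hb.ne']; ring
    rw [this]; positivity
  refine ⟨min 1 (1 - 2 * κ), lt_min one_pos h1, fun t => ?_⟩
  have hin : inner ℝ t t = t 0 0 ^ 2 + t 0 1 ^ 2 + (t 1 0 ^ 2 + t 1 1 ^ 2) := by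
    rw [inner_tens, inner_eq, inner_eq]; ring
  have htr : tr t * tr t ≤ 2 * inner ℝ t t := by
    rw [hin]; unfold tr
    nlinarith [sq_nonneg (t 0 0 - t 1 1), sq_nonneg (t 0 1), sq_nonneg (t 1 0)]
  have h0 : 0 ≤ inner ℝ t t := real_inner_self_nonneg
  have h0' : 0 ≤ tr t * tr t := mul_self_nonneg _
  rcases le_total κ 0 with hle | hge
  · calc min 1 (1 - 2 * κ) * inner ℝ t t ≤ 1 * inner ℝ t t :=
          mul_le_mul_of_nonneg_right (min_le_left _ _) h0
      _ ≤ _ := by nlinarith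
  · calc min 1 (1 - 2 * κ) * inner ℝ t t ≤ (1 - 2 * κ) * inner ℝ t t :=
          mul_le_mul_of_nonneg_right (min_le_right _ _) h0
      _ ≤ _ := by nlinarith

theorem volume_real_pos (P : Element) : 0 < volume.real P.carrier :=
  ENNReal.toReal_pos (P.isOpen.measure_pos volume P.nonempty).ne' P.isBounded.measure_lt_top.ne

/-- Both summands are nonnegative. If the sum vanishes, the compliance bound gives `Πσ = 0`; the
stabilisation is then the sum of the squared degrees of freedom of `σ` itself, times `|K| > 0`. -/
theorem localForm_self (b : DofBasis 𝒯 k) (L : Lame) (K : Fin 𝒯.N)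
    (σ : L2 (𝒯.elem K).carrier Tens) : 0 ≤ localForm b L K σ σ ∧
      (localForm b L K σ σ = 0 → proj k (𝒯.elem K) σ = 0 ∧ dof b K σ = 0) := by
  obtain ⟨ε, hε, hlow⟩ := exists_compliance_lower_bound L
  set p := proj k (𝒯.elem K) σ with hp
  set q : L2 (𝒯.elem K).carrier Tens := σ - p with hq
  have hI : Integrable (fun x => inner ℝ (p x) (p x)) (volume.restrict (𝒯.elem K).carrier) :=
    integrable_inner_of_memLp (Lp.memLp p) (Lp.memLp p)
  have h1 : ε * ∫ x in (𝒯.elem K).carrier, inner ℝ (p x) (p x) ≤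
      (∫ x in (𝒯.elem K).carrier, inner ℝ (p x) (p x)) - L.lam / (2 * L.mu + 2 * L.lam) *
        ∫ x in (𝒯.elem K).carrier, tr (p x) * tr (p x) := by
    rw [← integral_const_mul, ← integral_const_mul,
      ← integral_sub hI ((integrable_tr_mul p p).const_mul _)]
    exact integral_mono (hI.const_mul ε) (hI.sub ((integrable_tr_mul p p).const_mul _))
      fun x => hlow (p x)
  have h2 : 0 ≤ ∫ x in (𝒯.elem K).carrier, inner ℝ (p x) (p x) :=
    integral_nonneg fun x => real_inner_self_nonneg
  have hV := volume_real_pos (𝒯.elem K)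
  have h3 : 0 ≤ stab b K q q :=
    mul_nonneg hV.le (Finset.sum_nonneg fun l _ => mul_self_nonneg _)
  have hm : 0 < 1 / (2 * L.mu) := by have := L.mu_pos; positivity
  have hform : localForm b L K σ σ = 1 / (2 * L.mu) *
      ((∫ x in (𝒯.elem K).carrier, inner ℝ (p x) (p x)) - L.lam / (2 * L.mu + 2 * L.lam) *
        ∫ x in (𝒯.elem K).carrier, tr (p x) * tr (p x)) + stab b K q q := rfl
  have h4 : 0 ≤ 1 / (2 * L.mu) *
      ((∫ x in (𝒯.elem K).carrier, inner ℝ (p x) (p x)) - L.lam / (2 * L.mu + 2 * L.lam) *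
        ∫ x in (𝒯.elem K).carrier, tr (p x) * tr (p x)) :=
    mul_nonneg hm.le ((mul_nonneg hε.le h2).trans h1)
  refine ⟨by rw [hform]; exact add_nonneg h4 h3, fun h0 => ?_⟩
  rw [hform] at h0
  have h5 := (add_eq_zero_iff_of_nonneg h4 h3).1 h0
  have h6 := (mul_eq_zero.1 h5.1).resolve_left hm.ne'
  have h7 : ∫ x in (𝒯.elem K).carrier, inner ℝ (p x) (p x) = 0 := by
    rw [h6] at h1
    nlinarith
  have hp0 : p = 0 := by
    rw [← inner_self_eq_zero (𝕜 := ℝ), L2.inner_def]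
    exact h7
  refine ⟨hp0, ?_⟩
  have hq0 : q = σ := by rw [hq, hp0, sub_zero]
  have h8 := (mul_eq_zero.1 h5.2).resolve_left hV.ne'
  rw [hq0] at h8
  funext l
  have := (Finset.sum_eq_zero_iff_of_nonneg fun l _ => mul_self_nonneg _).1 h8 l (Finset.mem_univ l)
  exact mul_self_eq_zero.1 this

theorem stressForm_self_nonneg (b : DofBasis 𝒯 k) (L : Lame) (σ : L2 Ω Tens) :
    0 ≤ stressForm b L σ σ :=
  Finset.sum_nonneg fun K _ => (localForm_self b L K _).1

theorem eq_zero_of_stressForm_self (hΩ : MeasurableSet Ω) (h𝒯 : 𝒯.IsStar) (hk : 1 ≤ k)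
    (b : DofBasis 𝒯 k) (L : Lame) {Γσ : Set E} {σ : stressSpace 𝒯 Γσ k}
    (h : stressForm b L σ σ = 0) : σ = 0 := by
  ext1
  refine 𝒯.eq_zero_of_restrL hΩ fun K => ?_
  obtain ⟨c, r, hK⟩ := h𝒯 K
  have h1 := (Finset.sum_eq_zero_iff_of_nonneg fun K _ =>
    (localForm_self b L K (restr 𝒯 K σ)).1).1 h K (Finset.mem_univ K)
  obtain ⟨hp, hd⟩ := (localForm_self b L K _).2 h1
  exact eq_zero_of_proj_of_dof hK hk
    ((σ.2.2 K).congr (coeFn_restrL (𝒯.subset K) σ.1).symm) hp hd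

/-! ### The discrete spaces are finite dimensional -/

/-- The pair formed by `Πσ` and the degrees of freedom of `σ - Πσ`, taken on every element, lives in
a finite-dimensional space and determines `σ` by unisolvence. -/
theorem finiteDimensional_stressSpace (hΩ : MeasurableSet Ω) (h𝒯 : 𝒯.IsStar) (hk : 1 ≤ k)
    (b : DofBasis 𝒯 k) (Γσ : Set E) : FiniteDimensional ℝ (stressSpace 𝒯 Γσ k) := by
  choose c r hK using h𝒯
  let f : stressSpace 𝒯 Γσ k →ₗ[ℝ]
      ((K : Fin 𝒯.N) → (polyL2 k (𝒯.elem K) × (DofIndex b K → ℝ))) :=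
    LinearMap.pi fun K => LinearMap.prod
      (((polyL2 k (𝒯.elem K)).orthogonalProjectionOnto.toLinearMap.comp
        (restrL (𝒯.subset K))).comp (stressSpace 𝒯 Γσ k).subtype)
      ((dofL b K).comp (residual (hK K) Γσ))
  refine Module.Finite.of_injective f ((injective_iff_map_eq_zero f).2 fun σ hσ => ?_)
  ext1
  refine 𝒯.eq_zero_of_restrL hΩ fun K => ?_
  have h1 := congrFun hσ K
  have h2 : proj k (𝒯.elem K) (restr 𝒯 K σ) = 0 := congrArg Subtype.val (congrArg Prod.fst h1)
  have h3 : dof b K (restr 𝒯 K σ - proj k (𝒯.elem K) (restr 𝒯 K σ) : L2 _ Tens) = 0 :=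
    congrArg Prod.snd h1
  rw [h2, sub_zero] at h3
  exact eq_zero_of_proj_of_dof (hK K) hk
    ((σ.2.2 K).congr (coeFn_restrL (𝒯.subset K) σ.1).symm) h2 h3

theorem finiteDimensional_rotSpace (hΩ : MeasurableSet Ω) (𝒯 : Mesh Ω) (k : ℕ) :
    FiniteDimensional ℝ (rotSpace 𝒯 k) := by
  have hmem : ∀ (η : rotSpace 𝒯 k) K, restrL (𝒯.subset K) η.1 ∈ polyL2 k (𝒯.elem K) := by
    intro η K
    obtain ⟨p, hp, hp'⟩ := η.2.2 K
    refine ⟨fun i j => ⟨p i j, hp i j⟩, ?_⟩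
    refine Lp.ext ?_
    exact ((memLp_evalTens _ p).coeFn_toLp.trans
      (Filter.EventuallyEq.symm hp')).trans (coeFn_restrL _ _).symm
  let f : rotSpace 𝒯 k →ₗ[ℝ] ((K : Fin 𝒯.N) → polyL2 k (𝒯.elem K)) :=
    LinearMap.pi fun K => LinearMap.codRestrict _
      ((restrL (𝒯.subset K)).comp (rotSpace 𝒯 k).subtype) fun η => hmem η K
  refine Module.Finite.of_injective f ((injective_iff_map_eq_zero f).2 fun η hη => ?_)
  ext1
  exact 𝒯.eq_zero_of_restrL hΩ fun K => congrArg Subtype.val (congrFun hη K)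

/-- Vector polynomials of degree at most `k` as elements of `L²(K)`. -/
def vecToL2 (k : ℕ) (P : Element) : (Fin 2 → Poly k) →ₗ[ℝ] L2 P.carrier E where
  toFun p := (memLp_evalVec P fun j => (p j).1).toLp
  map_add' p q := by
    rw [← MemLp.toLp_add]
    exact MemLp.toLp_congr _ _ (Filter.Eventually.of_forall fun x => evalVec_add _ _ x)
  map_smul' c p := by
    rw [RingHom.id_apply, ← MemLp.toLp_const_smul]
    exact MemLp.toLp_congr _ _ (Filter.Eventually.of_forall fun x => evalVec_smul c _ x)

theorem finiteDimensional_velSpace (hΩ : MeasurableSet Ω) (𝒯 : Mesh Ω) (k : ℕ) :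
    FiniteDimensional ℝ (velSpace 𝒯 k) := by
  have hmem : ∀ (v : velSpace 𝒯 k) K,
      restrL (𝒯.subset K) v.1 ∈ LinearMap.range (vecToL2 k (𝒯.elem K)) := by
    intro v K
    obtain ⟨p, hp, hp'⟩ := v.2 K
    refine ⟨fun j => ⟨p j, hp j⟩, ?_⟩
    refine Lp.ext ?_
    exact ((memLp_evalVec _ p).coeFn_toLp.trans
      (Filter.EventuallyEq.symm hp')).trans (coeFn_restrL _ _).symm
  let f : velSpace 𝒯 k →ₗ[ℝ] ((K : Fin 𝒯.N) → LinearMap.range (vecToL2 k (𝒯.elem K))) :=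
    LinearMap.pi fun K => LinearMap.codRestrict _
      ((restrL (𝒯.subset K)).comp (velSpace 𝒯 k).subtype) fun v => hmem v K
  refine Module.Finite.of_injective f ((injective_iff_map_eq_zero f).2 fun v hv => ?_)
  ext1
  exact 𝒯.eq_zero_of_restrL hΩ fun K => congrArg Subtype.val (congrFun hv K)

end

/-! ### Analytic tools for bubbles: Poincaré, rotated gradients, Riesz representation. -/

section

/-! ### A Poincaré inequality on star-shaped elements -/

/-- The constant `4` is the largest Jacobian `s⁻²` for `s ≥ 1/2`. -/
theorem setIntegral_comp_affine_le {A K : Set E} (hA : MeasurableSet A) (hK : MeasurableSet K)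
    {g : E → ℝ} (hg : Integrable g) (hg0 : ∀ x, 0 ≤ g x) {a : E} {s : ℝ} (hs : 1 / 2 ≤ s)
    (h : ∀ u ∈ A, a + s • u ∈ K) : ∫ u in A, g (a + s • u) ≤ 4 * ∫ x in K, g x := by
  have hs0 : 0 < s := by linarith
  have hgK : Integrable (K.indicator g) := hg.indicator hK
  have h1 : ∫ u, K.indicator g (a + s • u) = (s ^ 2)⁻¹ * ∫ x in K, g x := by
    have h2 := Measure.integral_comp_smul_of_nonneg (volume : Measure E)
      (fun y => K.indicator g (a + y)) s (hR := hs0.le)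
    rw [h2, finrank_E, integral_add_left_eq_self (K.indicator g) a, integral_indicator hK,
      smul_eq_mul]
  have h3 : (s ^ 2)⁻¹ ≤ 4 := by
    rw [inv_le_comm₀ (by positivity) (by norm_num)]
    nlinarith
  have h4 : 0 ≤ ∫ x in K, g x := integral_nonneg hg0
  calc ∫ u in A, g (a + s • u) = ∫ u, A.indicator (fun u => g (a + s • u)) u :=
        (integral_indicator hA).symm
    _ ≤ ∫ u, K.indicator g (a + s • u) := by
        refine integral_mono (((hg.comp_add_left a).comp_smul hs0.ne').indicator hA)
          ((hgK.comp_add_left a).comp_smul hs0.ne') fun u => ?_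
        by_cases hu : u ∈ A
        · simp [indicator_of_mem hu, indicator_of_mem (h u hu)]
        · simp only [indicator_of_notMem hu]
          exact indicator_nonneg (fun x _ => hg0 x) _
    _ ≤ 4 * ∫ x in K, g x := by
        rw [h1]
        exact mul_le_mul_of_nonneg_right h3 h4

theorem IsTest.integrable_norm_fderiv {φ : E → ℝ} (hφ : IsTest φ) :
    Integrable fun x => ‖fderiv ℝ φ x‖ :=
  ((hφ.1.continuous_fderiv (by simp)).integrable_of_hasCompactSupport (hφ.2.fderiv (𝕜 := ℝ))).norm

/-- Integrate `d(x) φ(y + t(x - y))` over `x ∈ K` and `y` in the ball. At `t = 0` the integral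
factorises and vanishes because `d` has mean zero; at `t = 1` it is `|B| ∫ d φ`. Its `t`-derivative
is bounded by `∇φ` at points of `K`, the segments from the ball staying in `K`. -/
theorem Element.StarBall.exists_poincare {P : Element} {c : E} {r : ℝ} (h : P.StarBall c r)
    {d : E → ℝ} (hd : Continuous d) (hd0 : ∫ x in P.carrier, d x = 0) :
    ∃ C, ∀ φ, IsTest φ →
      |∫ x in P.carrier, d x * φ x| ≤ C * ∫ x in P.carrier, ‖fderiv ℝ φ x‖ := by
  set K := P.carrier with hKdef
  set B := Metric.ball c r with hBdef
  have hBK : B ⊆ K := h.ball_subset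
  have hK : MeasurableSet K := P.isOpen.measurableSet
  have hB : MeasurableSet B := Metric.isOpen_ball.measurableSet
  have hKfin : IsFiniteMeasure (volume.restrict K) :=
    ⟨by rw [Measure.restrict_apply_univ]; exact P.isBounded.measure_lt_top⟩
  have hBfin : IsFiniteMeasure (volume.restrict B) :=
    ⟨by rw [Measure.restrict_apply_univ]; exact Metric.isBounded_ball.measure_lt_top⟩
  set μ := (volume.restrict K).prod (volume.restrict B) with hμ
  have hmem : ∀ᵐ p ∂μ, p.1 ∈ K ∧ p.2 ∈ B := by
    rw [hμ, Measure.prod_restrict]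
    exact ae_restrict_mem (hK.prod hB)
  obtain ⟨D, hD⟩ := P.isBounded.isCompact_closure.exists_bound_of_continuousOn hd.continuousOn
  have hD' : ∀ x ∈ K, ‖d x‖ ≤ D := fun x hx => hD x (subset_closure hx)
  have hDnn : 0 ≤ D := (norm_nonneg _).trans (hD' c h.center_mem)
  set M := Metric.diam K with hM
  have hMd : ∀ x ∈ K, ∀ y ∈ B, ‖x - y‖ ≤ M := fun x hx y hy => by
    rw [← dist_eq_norm]
    exact Metric.dist_le_diam_of_mem P.isBounded hx (hBK hy)
  have hMnn : 0 ≤ M := Metric.diam_nonneg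
  have hVB : 0 < volume.real B :=
    ENNReal.toReal_pos (Metric.measure_ball_pos volume c h.pos).ne'
      Metric.isBounded_ball.measure_lt_top.ne
  refine ⟨(volume.real B)⁻¹ * (D * M * (4 * (volume.real B + volume.real K))), fun φ hφ => ?_⟩
  set I := ∫ x in K, ‖fderiv ℝ φ x‖ with hI
  have hInn : 0 ≤ I := integral_nonneg fun x => norm_nonneg _
  have hcf : Continuous (fderiv ℝ φ) := hφ.1.continuous_fderiv (by simp)
  obtain ⟨A, hA⟩ := hφ.exists_bound
  obtain ⟨A', hA'⟩ := hcf.bounded_above_of_compact_support (hφ.2.fderiv (𝕜 := ℝ))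
  let pt : ℝ → E × E → E := fun t p => p.2 + t • (p.1 - p.2)
  have hpt : ∀ t, Continuous (pt t) := fun t => by simp only [pt]; fun_prop
  let F : ℝ → E × E → ℝ := fun t p => d p.1 * φ (pt t p)
  let F' : ℝ → E × E → ℝ := fun t p => d p.1 * fderiv ℝ φ (pt t p) (p.1 - p.2)
  have hFm : ∀ t, AEStronglyMeasurable (F t) μ := fun t =>
    ((hd.comp continuous_fst).mul (hφ.1.continuous.comp (hpt t))).aestronglyMeasurable
  have hFm' : ∀ t, AEStronglyMeasurable (F' t) μ := fun t =>
    ((hd.comp continuous_fst).mul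
      ((hcf.comp (hpt t)).clm_apply (by fun_prop))).aestronglyMeasurable
  have hFi : ∀ t, Integrable (F t) μ := fun t => by
    refine Integrable.of_bound (hFm t) (D * A) ?_
    filter_upwards [hmem] with p hp
    rw [norm_mul]
    exact mul_le_mul (hD' _ hp.1) (hA _) (norm_nonneg _) hDnn
  have hFb : ∀ t, ∀ p : E × E, p.1 ∈ K → p.2 ∈ B →
      ‖F' t p‖ ≤ D * M * ‖fderiv ℝ φ (pt t p)‖ := fun t p h1 h2 => by
    rw [norm_mul, mul_assoc, mul_comm M]
    exact mul_le_mul (hD' _ h1) (((fderiv ℝ φ (pt t p)).le_opNorm _).trans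
      (mul_le_mul_of_nonneg_left (hMd _ h1 _ h2) (norm_nonneg _))) (norm_nonneg _) hDnn
  have hderiv : ∀ t, HasDerivAt (fun t => ∫ p, F t p ∂μ) (∫ p, F' t p ∂μ) t := by
    intro t
    refine (hasDerivAt_integral_of_dominated_loc_of_deriv_le (bound := fun _ => D * M * A')
      Filter.univ_mem (.of_forall hFm) (hFi t) (hFm' t) ?_ (integrable_const _) ?_).2
    · filter_upwards [hmem] with p hp t _
      exact (hFb t p hp.1 hp.2).trans (mul_le_mul_of_nonneg_left (hA' _) (by positivity))
    · refine .of_forall fun p t _ => ?_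
      have h1 : HasDerivAt (fun t => pt t p) (p.1 - p.2) t := by
        have h2 := ((hasDerivAt_id t).smul_const (p.1 - p.2)).const_add p.2
        rw [one_smul] at h2
        exact h2
      exact ((hφ.hasFDerivAt (pt t p)).comp_hasDerivAt t h1).const_mul (d p.1)
  have hGi : ∀ t, Integrable (fun p => ‖fderiv ℝ φ (pt t p)‖) μ := fun t => by
    refine Integrable.of_bound (hcf.comp (hpt t)).norm.aestronglyMeasurable A' (.of_forall fun p => ?_)
    rw [norm_norm]
    exact hA' _
  -- The Jacobian of `x ↦ y + t(x - y)` degenerates at `t = 0`, that of `y ↦ y + t(x - y)` at `t =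
  -- 1`. The first substitution is used for `t ≥ 1/2` and the second for `t ≤ 1/2`, whence the sum
  -- of both volumes.
  have hG : ∀ t ∈ Ico (0 : ℝ) 1, ∫ p, ‖fderiv ℝ φ (pt t p)‖ ∂μ ≤
      4 * (volume.real B + volume.real K) * I := by
    intro t ht
    have hVK : 0 ≤ volume.real K := measureReal_nonneg
    rcases le_total (1 / 2) t with hle | hle
    · rw [integral_prod_symm _ (hGi t)]
      have h1 : ∫ y in B, ∫ x in K, ‖fderiv ℝ φ (pt t (x, y))‖ ≤ ∫ y in B, 4 * I := by
        refine setIntegral_mono_on (hGi t).integral_prod_right (integrable_const _) hB fun y hy => ?_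
        have h2 := setIntegral_comp_affine_le hK hK hφ.integrable_norm_fderiv
          (fun x => norm_nonneg _) (a := (1 - t) • y) hle fun u hu => ?_
        · refine le_trans (le_of_eq ?_) h2
          refine integral_congr_ae (.of_forall fun u => ?_)
          simp only [pt]
          congr 2
          module
        · exact h.star y hy hu (by linarith [ht.2]) ht.1 (by ring)
      refine h1.trans ?_
      rw [setIntegral_const, smul_eq_mul]
      nlinarith [mul_nonneg hVK hInn]
    · rw [integral_prod _ (hGi t)]
      have h1 : ∫ x in K, ∫ y in B, ‖fderiv ℝ φ (pt t (x, y))‖ ≤ ∫ x in K, 4 * I := by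
        refine setIntegral_mono_on (hGi t).integral_prod_left (integrable_const _) hK fun x hx => ?_
        have h2 := setIntegral_comp_affine_le hB hK hφ.integrable_norm_fderiv
          (fun x => norm_nonneg _) (a := t • x) (s := 1 - t) (by linarith) fun u hu => ?_
        · refine le_trans (le_of_eq ?_) h2
          refine integral_congr_ae (.of_forall fun u => ?_)
          simp only [pt]
          congr 2
          module
        · rw [add_comm]
          exact h.star u hu hx (by linarith [ht.2]) ht.1 (by ring)
      refine h1.trans ?_
      rw [setIntegral_const, smul_eq_mul]
      nlinarith [mul_nonneg hVB.le hInn]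
  have hbound : ∀ t ∈ Ico (0 : ℝ) 1, ‖∫ p, F' t p ∂μ‖ ≤
      D * M * (4 * (volume.real B + volume.real K) * I) := by
    intro t ht
    refine (norm_integral_le_of_norm_le ((hGi t).const_mul (D * M)) ?_).trans ?_
    · filter_upwards [hmem] with p hp
      exact hFb t p hp.1 hp.2
    · rw [integral_const_mul]
      exact mul_le_mul_of_nonneg_left (hG t ht) (by positivity)
  have hmv := norm_image_sub_le_of_norm_deriv_le_segment_01'
    (fun t _ => (hderiv t).hasDerivWithinAt) hbound
  have h0 : ∫ p, F 0 p ∂μ = 0 := by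
    have : F 0 = fun p => d p.1 * φ p.2 := by
      funext p
      simp [F, pt]
    rw [this, hμ, integral_prod_mul (μ := volume.restrict K) (ν := volume.restrict B) d φ, hd0,
      zero_mul]
  have h1 : ∫ p, F 1 p ∂μ = (∫ x in K, d x * φ x) * volume.real B := by
    have : F 1 = fun p => (d p.1 * φ p.1) * (fun _ : E => (1 : ℝ)) p.2 := by
      funext p
      simp [F, pt]
    rw [this, hμ, integral_prod_mul (μ := volume.restrict K) (ν := volume.restrict B)
      (fun x => d x * φ x) fun _ => 1]
    simp
  rw [h0, h1, sub_zero, norm_mul, Real.norm_eq_abs, Real.norm_of_nonneg hVB.le] at hmv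
  rw [← mul_le_mul_iff_left₀ hVB]
  refine hmv.trans (le_of_eq ?_)
  field_simp

/-! ### Gradients of test functions -/

theorem gradient_apply_eq (φ : E → ℝ) (x : E) (j : Fin 2) :
    gradient φ x j = fderiv ℝ φ x (bas j) := by
  rw [← inner_gradient_left, inner_eq]
  fin_cases j <;> simp [bas]

theorem IsTest.fderiv_apply {φ : E → ℝ} (hφ : IsTest φ) (u : E) :
    IsTest fun x => fderiv ℝ φ x u :=
  ⟨(hφ.1.fderiv_right (m := ∞) (by simp)).clm_apply contDiff_const, hφ.2.fderiv_apply ℝ u⟩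

theorem IsTest.integrable_mul {φ ψ : E → ℝ} (hφ : IsTest φ) (hψ : IsTest ψ) :
    Integrable fun x => φ x * ψ x :=
  (hφ.mul hψ.1).integrable

/-- A gradient is curl-free: after integration by parts the two terms differ by the order of the
second derivatives of `φ`. -/
theorem integral_fderiv_rotE_gradient {φ ψ : E → ℝ} (hφ : IsTest φ) (hψ : IsTest ψ) :
    ∫ x, fderiv ℝ ψ x (rotE (gradient φ x)) = 0 := by
  have key : ∀ u v : E, ∫ x, fderiv ℝ φ x u * fderiv ℝ ψ x v =
      -∫ x, fderiv ℝ (fderiv ℝ φ) x v u * ψ x := by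
    intro u v
    have hd : ∀ x, fderiv ℝ (fun x => fderiv ℝ φ x u) x v = fderiv ℝ (fderiv ℝ φ) x v u := by
      intro x
      have h1 : DifferentiableAt ℝ (fderiv ℝ φ) x :=
        ((hφ.1.fderiv_right (m := ∞) (by simp)).differentiable (by simp)) x
      rw [fderiv_clm_apply h1 (differentiableAt_const u)]
      simp
    have h2 := integral_mul_fderiv_eq_neg_fderiv_mul_of_integrable (μ := (volume : Measure E))
      (f := fun x => fderiv ℝ φ x u) (g := ψ) (v := v)
      (((hφ.fderiv_apply u).fderiv_apply v).integrable_mul hψ)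
      ((hφ.fderiv_apply u).integrable_mul (hψ.fderiv_apply v))
      ((hφ.fderiv_apply u).integrable_mul hψ)
      (fun x _ => ((hφ.fderiv_apply u).hasFDerivAt x).differentiableAt)
      (fun x _ => (hψ.hasFDerivAt x).differentiableAt)
    rw [h2]
    simp only [hd]
  have h3 : ∀ x, fderiv ℝ ψ x (rotE (gradient φ x)) =
      fderiv ℝ φ x (bas 1) * fderiv ℝ ψ x (bas 0) - fderiv ℝ φ x (bas 0) * fderiv ℝ ψ x (bas 1) := by
    intro x
    rw [map_eq_sum_bas, rotE_apply]
    simp [gradient_apply_eq]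
    ring
  simp only [h3]
  rw [integral_sub ((hφ.fderiv_apply _).integrable_mul (hψ.fderiv_apply _))
    ((hφ.fderiv_apply _).integrable_mul (hψ.fderiv_apply _)), key, key, sub_eq_zero]
  congr 2
  funext x
  rw [(hφ.1.contDiffAt.isSymmSndFDerivAt (by
    rw [minSmoothness_of_isRCLikeNormedField]; exact WithTop.coe_le_coe.2 (le_top : (2 : ℕ∞) ≤ ⊤))).eq]

/-- Test functions with support in `S`. -/
def testSpace (S : Set E) : Submodule ℝ (E → ℝ) where
  carrier := {φ | IsTest φ ∧ tsupport φ ⊆ S}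
  zero_mem' := ⟨⟨contDiff_const, HasCompactSupport.zero⟩, by simp [tsupport]⟩
  add_mem' {φ ψ} hφ hψ := ⟨⟨hφ.1.1.add hψ.1.1, hφ.1.2.add hψ.1.2⟩,
    (tsupport_add φ ψ).trans (union_subset hφ.2 hψ.2)⟩
  smul_mem' a φ hφ := ⟨⟨hφ.1.1.const_smul a, hφ.1.2.smul_left (f := fun _ => a)⟩,
    (tsupport_smul_subset_right (fun _ => a) φ).trans hφ.2⟩

theorem IsTest.memLp_gradient {φ : E → ℝ} (hφ : IsTest φ) (U : Set E) :
    MemLp (gradient φ) 2 (volume.restrict U) :=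
  (InnerProductSpace.toDual ℝ E).symm.toContinuousLinearEquiv.toContinuousLinearMap.comp_memLp'
    ((hφ.1.continuous_fderiv (by simp)).memLp_of_hasCompactSupport (hφ.2.fderiv (𝕜 := ℝ)))

/-- The gradient from test functions to square integrable fields. -/
def gradL (U S : Set E) : testSpace S →ₗ[ℝ] L2 U E where
  toFun φ := (φ.2.1.memLp_gradient U).toLp
  map_add' φ ψ := by
    rw [← MemLp.toLp_add]
    refine MemLp.toLp_congr _ _ (.of_forall fun x => ?_)
    have := fderiv_add (φ.2.1.hasFDerivAt x).differentiableAt (ψ.2.1.hasFDerivAt x).differentiableAt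
    simp only [gradient, Pi.add_apply, Submodule.coe_add, this, map_add]
  map_smul' a φ := by
    rw [RingHom.id_apply, ← MemLp.toLp_const_smul]
    refine MemLp.toLp_congr _ _ (.of_forall fun x => ?_)
    have := fderiv_const_smul (φ.2.1.hasFDerivAt x).differentiableAt a
    simp only [gradient, Pi.smul_apply, Submodule.coe_smul, this, map_smul]

theorem inner_gradL {U S : Set E} (v : L2 U E) (φ : testSpace S) :
    inner ℝ (gradL U S φ) v = ∫ x in U, fderiv ℝ φ x (v x) := by
  rw [L2.inner_def]
  refine integral_congr_ae ?_
  filter_upwards [(φ.2.1.memLp_gradient U).coeFn_toLp] with x hx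
  rw [← inner_gradient_left, ← hx]
  rfl

/-- A bounded functional on the range of a linear map is represented in the closure of this
range. -/
theorem exists_mem_closure_range_inner_eq {V H : Type*} [AddCommGroup V] [Module ℝ V]
    [NormedAddCommGroup H] [InnerProductSpace ℝ H] [CompleteSpace H] (T : V →ₗ[ℝ] H)
    (l : V →ₗ[ℝ] ℝ) (C : ℝ) (hC : ∀ v, |l v| ≤ C * ‖T v‖) :
    ∃ y ∈ (LinearMap.range T).topologicalClosure, ∀ v, inner ℝ (T v) y = l v := by
  -- The bound forces `l` to vanish on the kernel of `T`, so `l` descends to the range through any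
  -- linear section.
  obtain ⟨s, hs⟩ := T.rangeRestrict.exists_rightInverse_of_surjective T.range_rangeRestrict
  have hs' : ∀ w : LinearMap.range T, T (s w) = w := fun w =>
    congrArg Subtype.val (LinearMap.congr_fun hs w)
  have hls : ∀ v, l (s ⟨T v, v, rfl⟩) = l v := by
    intro v
    have h1 := hC (s ⟨T v, v, rfl⟩ - v)
    rw [map_sub T, hs', sub_self, norm_zero, mul_zero] at h1
    have h2 := abs_eq_zero.1 (le_antisymm h1 (abs_nonneg _))
    rwa [map_sub, sub_eq_zero] at h2
  let g : LinearMap.range T →L[ℝ] ℝ := (l.comp s).mkContinuous C fun w => by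
    have := hC (s w)
    rwa [hs'] at this
  obtain ⟨G, hG, -⟩ := exists_extension_norm_eq (LinearMap.range T) g
  have : CompleteSpace (LinearMap.range T).topologicalClosure :=
    (LinearMap.range T).isClosed_topologicalClosure.completeSpace_coe
  -- A Hahn-Banach extension has a Riesz vector in `H`; projecting it onto the closure does not
  -- change its pairing with the range.
  refine ⟨(LinearMap.range T).topologicalClosure.starProjection
    ((InnerProductSpace.toDual ℝ H).symm G), Submodule.starProjection_apply_mem _ _, fun v => ?_⟩
  have hv : T v ∈ (LinearMap.range T).topologicalClosure :=
    Submodule.le_topologicalClosure _ ⟨v, rfl⟩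
  rw [← Submodule.inner_starProjection_left_eq_right, Submodule.starProjection_eq_self_iff.2 hv,
    real_inner_comm, InnerProductSpace.toDual_symm_apply]
  exact (hG ⟨T v, v, rfl⟩).trans (hls v)

theorem inner_eq_zero_of_mem_closure {H : Type*} [NormedAddCommGroup H] [InnerProductSpace ℝ H]
    {W : Submodule ℝ H} {u y : H} (hu : ∀ w ∈ W, inner ℝ u w = 0) (hy : y ∈ W.topologicalClosure) :
    inner ℝ u y = 0 := by
  have h1 : u ∈ W.topologicalClosureᗮ := by
    rw [Submodule.orthogonal_closure]
    exact (Submodule.mem_orthogonal' _ _).2 hu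
  exact (Submodule.mem_orthogonal' _ _).1 h1 y hy

end

/-! ### Bubbles, and rotations orthogonal to the stress space. -/

section

/-! ### Bubble fields -/

/-- A row with vanishing normal trace, polynomial divergence and polynomial curl: its extension by
zero is a row of a field of the stress space. -/
structure IsBubble (k : ℕ) (P : Element) (v : L2 P.carrier E) : Prop where
  div : ∃ q ∈ Poly k, ∀ φ, IsTest φ →
    ∫ x in P.carrier, (fderiv ℝ φ x (v x) + evalPoly q x * φ x) = 0
  curl : ∃ q ∈ Poly (k - 1), ∀ φ, IsTest φ → tsupport φ ⊆ P.carrier →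
    ∫ x in P.carrier, (fderiv ℝ φ x (rotE (v x)) + evalPoly q x * φ x) = 0

/-- The tensor with row `i` equal to `v`, the other row being zero. -/
def rowE (i : Fin 2) : E →L[ℝ] Tens :=
  (PiLp.continuousLinearEquiv 2 ℝ fun _ : Fin 2 => E).symm.toContinuousLinearMap.comp
    (ContinuousLinearMap.single ℝ (fun _ : Fin 2 => E) i)

theorem rowE_apply (i : Fin 2) (v : E) (j : Fin 2) : rowE i v j = if j = i then v else 0 := by
  simp [rowE]

theorem inner_rowE (i : Fin 2) (v : E) (t : Tens) : inner ℝ (rowE i v) t = inner ℝ v (t i) := by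
  rw [inner_tens, rowE_apply, rowE_apply]
  fin_cases i <;> simp

theorem evalVec_single_apply (i : Fin 2) (q : MvPolynomial (Fin 2) ℝ) (x : E) (j : Fin 2) :
    evalVec (Pi.single i q) x j = if j = i then evalPoly q x else 0 := by
  rw [evalVec_apply]
  by_cases h : j = i
  · subst h; simp
  · simp [h, evalPoly]

theorem single_mem_Poly {k : ℕ} {q : MvPolynomial (Fin 2) ℝ} (hq : q ∈ Poly k) (i j : Fin 2) :
    (Pi.single i q : Fin 2 → MvPolynomial (Fin 2) ℝ) j ∈ Poly k := by
  by_cases h : j = i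
  · subst h; simpa using hq
  · simp [h]

variable {Ω : Set E} {𝒯 : Mesh Ω} {k : ℕ}

/-- Green's formula without boundary term holds against every test function of the plane. So the
extension by zero has a global weak divergence and zero normal trace on all of `∂Ω`, whatever `Γσ`
is; on the other elements it is zero by disjointness. -/
theorem IsBubble.exists_extension (hΩ : MeasurableSet Ω) (Γσ : Set E) {K : Fin 𝒯.N}
    {v : L2 (𝒯.elem K).carrier E} (hv : IsBubble k (𝒯.elem K) v) (i : Fin 2) :
    ∃ τ ∈ stressSpace 𝒯 Γσ k, ∀ η : L2 Ω Tens,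
      inner ℝ τ η = ∫ x in (𝒯.elem K).carrier, inner ℝ (v x) (η x i) := by
  have hUm : MeasurableSet (𝒯.elem K).carrier := (𝒯.elem K).isOpen.measurableSet
  have hUΩ : (𝒯.elem K).carrier ⊆ Ω := 𝒯.subset K
  obtain ⟨q, hq, hdiv⟩ := hv.div
  obtain ⟨s, hs, hcurl⟩ := hv.curl
  set f : E → Tens := (𝒯.elem K).carrier.indicator fun x => rowE i (v x) with hf
  set d : E → E := (𝒯.elem K).carrier.indicator (evalVec (Pi.single i q)) with hd
  have hfU : ∀ x ∈ (𝒯.elem K).carrier, f x = rowE i (v x) := fun x hx => indicator_of_mem hx _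
  have hdU : ∀ x ∈ (𝒯.elem K).carrier, d x = evalVec (Pi.single i q) x := fun x hx => indicator_of_mem hx _
  have hf0 : ∀ x ∉ (𝒯.elem K).carrier, f x = 0 := fun x hx => indicator_of_notMem hx _
  have hd0 : ∀ x ∉ (𝒯.elem K).carrier, d x = 0 := fun x hx => indicator_of_notMem hx _
  have hrow : MemLp (fun x => rowE i (v x)) 2 (volume.restrict (𝒯.elem K).carrier) :=
    (rowE i).comp_memLp' (Lp.memLp v)
  have hfm : ∀ V, (𝒯.elem K).carrier ⊆ V → MemLp f 2 (volume.restrict V) := fun V hV => by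
    rw [hf, memLp_indicator_iff_restrict hUm, Measure.restrict_restrict hUm,
      inter_eq_left.2 hV]
    exact hrow
  have hdm : ∀ V, (𝒯.elem K).carrier ⊆ V → MemLp d 2 (volume.restrict V) := fun V hV => by
    rw [hd, memLp_indicator_iff_restrict hUm, Measure.restrict_restrict hUm,
      inter_eq_left.2 hV]
    exact memLp_evalVec _ _
  have hgreen : ∀ V, MeasurableSet V → (𝒯.elem K).carrier ⊆ V → ∀ φ, IsTest φ → ∀ j, green V φ f d j = 0 := by
    intro V hVm hV φ hφ j
    unfold green
    rw [setIntegral_eq_of_subset_of_forall_sdiff_eq_zero hVm hV fun x hx => by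
      rw [hf0 x hx.2, hd0 x hx.2]; simp]
    by_cases hj : j = i
    · rw [← hdiv φ hφ]
      refine setIntegral_congr_fun hUm fun x hx => ?_
      simp only [hfU x hx, hdU x hx, rowE_apply, evalVec_single_apply, if_pos hj]
    · rw [← integral_zero E ℝ (μ := volume.restrict (𝒯.elem K).carrier)]
      refine setIntegral_congr_fun hUm fun x hx => ?_
      simp only [hfU x hx, hdU x hx, rowE_apply, evalVec_single_apply, if_neg hj]
      simp
  have hwd : ∀ V, MeasurableSet V → (𝒯.elem K).carrier ⊆ V → HasWeakDiv V f d := fun V hVm hV =>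
    ⟨hfm V hV, hdm V hV, fun φ hφ _ j => hgreen V hVm hV φ hφ j⟩
  have hwc : HasWeakCurl (𝒯.elem K).carrier f (evalVec (Pi.single i s)) := by
    refine ⟨?_, memLp_evalVec _ _, fun φ hφ hφs j => ?_⟩
    · have h1 : (fun x => rotRows (f x)) =ᵐ[volume.restrict (𝒯.elem K).carrier] fun x => rowE i (rotE (v x)) := by
        filter_upwards [ae_restrict_mem hUm] with x hx
        ext1 j
        rw [rotRows_apply, hfU x hx, rowE_apply, rowE_apply]
        split_ifs <;> simp
      exact (((rowE i).comp rotE).comp_memLp' (Lp.memLp v)).ae_eq h1.symm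
    · by_cases hj : j = i
      · rw [← hcurl φ hφ hφs]
        refine setIntegral_congr_fun hUm fun x hx => ?_
        simp only [rotRows_apply, hfU x hx, rowE_apply, evalVec_single_apply, if_pos hj]
      · unfold green
        rw [← integral_zero E ℝ (μ := volume.restrict (𝒯.elem K).carrier)]
        refine setIntegral_congr_fun hUm fun x hx => ?_
        simp only [rotRows_apply, hfU x hx, rowE_apply, evalVec_single_apply, if_neg hj]
        simp
  have hloc : ∀ K', MemLocalStress k (𝒯.elem K') f := by
    intro K'
    by_cases hK' : K' = K
    · rw [hK']
      refine ⟨⟨d, hwd (𝒯.elem K).carrier hUm subset_rfl, Pi.single i q, single_mem_Poly hq i, ?_⟩,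
        ⟨_, hwc, Pi.single i s, single_mem_Poly hs i, .of_forall fun x => rfl⟩,
        0, fun e j => by simp, d, hwd (𝒯.elem K).carrier hUm subset_rfl, fun φ hφ j => ?_⟩
      · filter_upwards [ae_restrict_mem hUm] with x hx using hdU x hx
      · rw [hgreen (𝒯.elem K).carrier hUm subset_rfl φ hφ j]
        simp
    · refine (MemLocalStress.zero k _).congr ?_
      filter_upwards [ae_restrict_mem (𝒯.elem K').isOpen.measurableSet] with x hx
      exact (hf0 x (disjoint_left.1 (𝒯.disjoint K' K hK') hx)).symm
  have hae := (hfm Ω hUΩ).coeFn_toLp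
  refine ⟨(hfm Ω hUΩ).toLp, ⟨⟨d, (hwd Ω hΩ hUΩ).congr hae.symm, fun φ hφ _ j => ?_⟩, fun K' =>
    (hloc K').congr (ae_restrict_of_ae_restrict_of_subset (𝒯.subset K') hae.symm)⟩, fun η => ?_⟩
  · rw [green_congr hae (Filter.EventuallyEq.refl _ _)]
    exact hgreen Ω hΩ hUΩ φ hφ j
  · rw [L2.inner_def]
    have h1 : ∫ x in Ω, inner ℝ (((hfm Ω hUΩ).toLp : L2 Ω Tens) x) (η x) = ∫ x in Ω, inner ℝ (f x) (η x) := by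
      refine integral_congr_ae ?_
      filter_upwards [hae] with x hx
      rw [hx]
    rw [h1, setIntegral_eq_of_subset_of_forall_sdiff_eq_zero hΩ hUΩ fun x hx => by
      rw [hf0 x hx.2, inner_zero_left]]
    refine setIntegral_congr_fun hUm fun x hx => ?_
    simp only [hfU x hx, inner_rowE]

/-! ### Rotational bubbles -/

theorem inner_rotE_comm (u v : E) : inner ℝ (rotE u) v = -inner ℝ u (rotE v) := by
  rw [inner_rotE_left, real_inner_comm, inner_rotE_left]
  ring

/-- The row-wise rotation of square integrable fields. -/
def rotL (U : Set E) : L2 U E →L[ℝ] L2 U E := rotE.compLpL 2 (volume.restrict U)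

theorem inner_rotL {U : Set E} (u v : L2 U E) : inner ℝ (rotL U u) v = -inner ℝ u (rotL U v) := by
  rw [L2.inner_def, L2.inner_def, ← integral_neg]
  refine integral_congr_ae ?_
  filter_upwards [rotE.coeFn_compLpL (p := 2) (μ := volume.restrict U) u,
    rotE.coeFn_compLpL (p := 2) (μ := volume.restrict U) v] with x h1 h2
  change inner ℝ (rotL U u x) (v x) = _
  rw [rotL, h1, h2, inner_rotE_comm]

theorem inner_gradL_rotL {U S : Set E} (v : L2 U E) (φ : testSpace S) :
    inner ℝ (gradL U S φ) (rotL U v) = ∫ x in U, fderiv ℝ φ x (rotE (v x)) := by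
  rw [inner_gradL]
  refine integral_congr_ae ?_
  filter_upwards [rotE.coeFn_compLpL (p := 2) (μ := volume.restrict U) v] with x hx
  rw [rotL, hx]

/-- Only `φ` must be supported in `U`: the integral then extends to the whole plane, where the curl
of a gradient is tested. The asymmetry yields both that limits of gradients are curl-free and that
limits of rotated gradients of such `φ` have zero normal trace. -/
theorem inner_gradL_rotL_gradL {U : Set E} {S : Set E} (φ : testSpace U) (ψ : testSpace S) :
    inner ℝ (gradL U U φ) (rotL U (gradL U S ψ)) = 0 := by
  rw [inner_gradL_rotL, ← integral_fderiv_rotE_gradient ψ.2.1 φ.2.1]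
  have h1 : ∫ x in U, fderiv ℝ φ.1 x (rotE (gradL U S ψ x)) =
      ∫ x in U, fderiv ℝ φ.1 x (rotE (gradient ψ.1 x)) := by
    refine integral_congr_ae ?_
    filter_upwards [(ψ.2.1.memLp_gradient U).coeFn_toLp] with x hx
    rw [← hx]
    rfl
  rw [h1]
  refine setIntegral_eq_integral_of_forall_compl_eq_zero fun x hx => ?_
  have : fderiv ℝ φ.1 x = 0 := by
    by_contra hne
    exact hx (φ.2.2 (support_fderiv_subset ℝ hne))
  rw [this]
  simp

/-- The bubble is the projection of `u` onto the closure of the rotated gradients of functions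
supported in the element. Elements of this closure are solenoidal with zero normal trace, and `u -
z` is orthogonal to it, that is, curl-free, so `z` inherits the curl of `u`. -/
theorem exists_rot_bubble {P : Element} (u : L2 P.carrier E) {q : MvPolynomial (Fin 2) ℝ}
    (hq : q ∈ Poly (k - 1)) (hu : ∀ φ, IsTest φ → tsupport φ ⊆ P.carrier →
      ∫ x in P.carrier, (fderiv ℝ φ x (rotE (u x)) + evalPoly q x * φ x) = 0) :
    ∃ z : L2 P.carrier E, IsBubble k P z ∧ (∀ φ, IsTest φ → tsupport φ ⊆ P.carrier →
      ∫ x in P.carrier, (fderiv ℝ φ x (rotE (z x)) + evalPoly q x * φ x) = 0) ∧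
        inner ℝ z u = inner ℝ z z := by
  set W := (LinearMap.range ((rotL P.carrier).toLinearMap.comp (gradL P.carrier P.carrier))).topologicalClosure with hW
  have : CompleteSpace W := Submodule.isClosed_topologicalClosure _ |>.completeSpace_coe
  set z := W.starProjection u with hz
  have hzW : z ∈ W := Submodule.starProjection_apply_mem _ _
  have horth : ∀ w ∈ W, inner ℝ w (u - z) = 0 := fun w hw =>
    (Submodule.mem_orthogonal _ _).1 (Submodule.sub_starProjection_mem_orthogonal u) w hw
  have hcurl : ∀ φ, IsTest φ → tsupport φ ⊆ P.carrier →
      ∫ x in P.carrier, (fderiv ℝ φ x (rotE (z x)) + evalPoly q x * φ x) = 0 := by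
    intro φ hφ hs
    let φ' : testSpace P.carrier := ⟨φ, hφ, hs⟩
    have h1 := horth (rotL P.carrier (gradL P.carrier P.carrier φ')) (Submodule.le_topologicalClosure _ ⟨φ', rfl⟩)
    rw [inner_rotL, neg_eq_zero, map_sub, inner_sub_right, inner_gradL_rotL, inner_gradL_rotL,
      sub_eq_zero] at h1
    have hI : ∀ w : L2 P.carrier E, Integrable (fun x => fderiv ℝ φ x (rotE (w x))) (volume.restrict P.carrier) := by
      intro w
      refine (integrable_inner_of_memLp (hφ.memLp_gradient P.carrier)
        (rotE.comp_memLp' (Lp.memLp w))).congr (.of_forall fun x => ?_)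
      exact inner_gradient_left
    have hIq : Integrable (fun x => evalPoly q x * φ x) (volume.restrict P.carrier) := by
      have h2 := (hφ.mul (contDiff_evalPoly q)).integrable.integrableOn (s := P.carrier)
      exact h2.congr (.of_forall fun x => mul_comm _ _)
    rw [integral_add (hI z) hIq, ← hu φ hφ hs, integral_add (hI u) hIq]
    congr 1
    exact h1.symm
  refine ⟨z, ⟨⟨0, Submodule.zero_mem _, fun φ hφ => ?_⟩, ⟨q, hq, hcurl⟩⟩, hcurl, ?_⟩
  -- Test functions with arbitrary support are admitted, so this encodes the zero normal trace
  -- besides the zero divergence.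
  · let φ' : testSpace (univ : Set E) := ⟨φ, hφ, subset_univ _⟩
    have h1 : inner ℝ (gradL P.carrier univ φ') z = 0 := by
      refine inner_eq_zero_of_mem_closure ?_ hzW
      rintro _ ⟨ψ, rfl⟩
      change inner ℝ (gradL P.carrier univ φ') (rotL P.carrier (gradL P.carrier P.carrier ψ)) = 0
      have := inner_gradL_rotL_gradL ψ φ'
      rw [← neg_eq_zero, ← inner_rotL, real_inner_comm] at this
      exact this
    rw [inner_gradL] at h1
    simpa [evalPoly] using h1
  · have h1 := horth z hzW
    rwa [inner_sub_right, sub_eq_zero] at h1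

/-! ### Divergence bubbles -/

/-- A weak Neumann problem: `y` is a limit of gradients, hence curl-free, with zero normal trace and
divergence `q`, the second coordinate minus its mean. The mean is removed for compatibility, and `1
≤ k` admits the affine `q` as a divergence. Solvability is the Poincaré inequality. -/
theorem Element.StarBall.exists_div_bubble {P : Element} {c : E} {r : ℝ} (h : P.StarBall c r)
    (hk : 1 ≤ k) : ∃ y : L2 P.carrier E, IsBubble k P y ∧ ∫ x in P.carrier, y x 1 ≠ 0 := by
  have hUm : MeasurableSet P.carrier := P.isOpen.measurableSet
  have hfin : IsFiniteMeasure (volume.restrict P.carrier) :=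
    ⟨by rw [Measure.restrict_apply_univ]; exact P.isBounded.measure_lt_top⟩
  have hV := volume_real_pos P
  set m : ℝ := (volume.real P.carrier)⁻¹ * ∫ x in P.carrier, x 1 with hm
  set q : MvPolynomial (Fin 2) ℝ := MvPolynomial.X 1 - MvPolynomial.C m with hqd
  have hq : q ∈ Poly k := by
    refine Poly_mono hk (Submodule.sub_mem _ ?_ ?_) <;> rw [MvPolynomial.mem_restrictTotalDegree]
    · rw [MvPolynomial.totalDegree_X]
    · simp
  have hqe : ∀ x : E, evalPoly q x = x 1 - m := fun x => by simp [evalPoly, hqd]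
  have hqc : Continuous (evalPoly q) := (contDiff_evalPoly q).continuous
  have hintg : ∀ {g : E → ℝ}, Continuous g → IntegrableOn g P.carrier := fun hg =>
    (hg.continuousOn.integrableOn_compact P.isBounded.isCompact_closure).mono_set subset_closure
  have hc1 : Continuous fun x : E => x 1 := by fun_prop
  have hq0 : ∫ x in P.carrier, evalPoly q x = 0 := by
    simp only [hqe]
    rw [integral_sub (hintg hc1) (integrable_const _), setIntegral_const, smul_eq_mul, hm,
      mul_inv_cancel_left₀ hV.ne', sub_self]
  obtain ⟨C, hC⟩ := h.exists_poincare hqc hq0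
  have hC' : 0 ≤ max C 0 := le_max_right _ _
  let l : testSpace (univ : Set E) →ₗ[ℝ] ℝ :=
    { toFun := fun φ => -∫ x in P.carrier, evalPoly q x * φ.1 x
      map_add' := fun φ ψ => by
        simp only [Submodule.coe_add, Pi.add_apply, mul_add]
        rw [integral_add (hintg (g := fun x => evalPoly q x * φ.1 x) (hqc.mul φ.2.1.1.continuous))
          (hintg (g := fun x => evalPoly q x * ψ.1 x) (hqc.mul ψ.2.1.1.continuous)), neg_add]
      map_smul' := fun a φ => by
        simp only [Submodule.coe_smul, Pi.smul_apply, smul_eq_mul, RingHom.id_apply,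
          mul_left_comm _ a]
        rw [integral_const_mul, mul_neg] }
  set one : L2 P.carrier ℝ := (memLp_const (1 : ℝ)).toLp with hone
  have hl : ∀ φ, |l φ| ≤ max C 0 * ‖one‖ * ‖gradL P.carrier univ φ‖ := by
    intro φ
    have h1 : ∫ x in P.carrier, ‖fderiv ℝ φ.1 x‖ ≤ ‖one‖ * ‖gradL P.carrier univ φ‖ := by
      have h2 := φ.2.1.memLp_gradient P.carrier
      have h3 : ‖gradL P.carrier univ φ‖ = ‖h2.norm.toLp‖ := by
        change ‖h2.toLp‖ = _
        rw [Lp.norm_toLp, Lp.norm_toLp, eLpNorm_norm]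
      have h4 : ∫ x in P.carrier, ‖fderiv ℝ φ.1 x‖ = inner ℝ one h2.norm.toLp := by
        rw [L2.inner_def]
        refine integral_congr_ae ?_
        filter_upwards [h2.norm.coeFn_toLp,
          (memLp_const (μ := volume.restrict P.carrier) (p := 2) (1 : ℝ)).coeFn_toLp] with x hx hx'
        rw [hx, hone, hx']
        simp [gradient]
      rw [h4, h3]
      exact real_inner_le_norm _ _
    change |-∫ x in P.carrier, evalPoly q x * φ.1 x| ≤ _
    rw [abs_neg, mul_assoc]
    refine (hC φ.1 φ.2.1).trans ?_
    exact (mul_le_mul_of_nonneg_right (le_max_left C 0) (integral_nonneg fun x => norm_nonneg _)).trans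
      (mul_le_mul_of_nonneg_left h1 hC')
  obtain ⟨y, hy, hyl⟩ := exists_mem_closure_range_inner_eq (gradL P.carrier univ) l _ hl
  have hI : ∀ φ, IsTest φ → Integrable (fun x => fderiv ℝ φ x (y x)) (volume.restrict P.carrier) := by
    intro φ hφ
    refine (integrable_inner_of_memLp (hφ.memLp_gradient P.carrier) (Lp.memLp y)).congr
      (.of_forall fun x => ?_)
    exact inner_gradient_left
  have hdiv : ∀ φ, IsTest φ → ∫ x in P.carrier, fderiv ℝ φ x (y x) = -∫ x in P.carrier, evalPoly q x * φ x := by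
    intro φ hφ
    have := hyl ⟨φ, hφ, subset_univ _⟩
    rwa [inner_gradL] at this
  refine ⟨y, ⟨⟨q, hq, fun φ hφ => ?_⟩, 0, Submodule.zero_mem _, fun φ hφ hs => ?_⟩, ?_⟩
  · rw [integral_add (hI φ hφ) (hintg (g := fun x => evalPoly q x * φ x) (hqc.mul hφ.1.continuous)), hdiv φ hφ, neg_add_cancel]
  · have h1 : inner ℝ (rotL P.carrier (gradL P.carrier P.carrier ⟨φ, hφ, hs⟩)) y = 0 := by
      refine inner_eq_zero_of_mem_closure ?_ hy
      rintro _ ⟨ψ, rfl⟩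
      rw [inner_rotL, inner_gradL_rotL_gradL, neg_zero]
    rw [inner_rotL, inner_gradL_rotL, neg_eq_zero] at h1
    simpa [evalPoly] using h1
  -- Testing with `q` itself, whose gradient is the second basis vector, turns the integral of that
  -- component into `-∫ q²`.
  · obtain ⟨φ, hφ, hφU⟩ := exists_test_eqOn P.isBounded (contDiff_evalPoly q)
    have h1 : ∫ x in P.carrier, y x 1 = -∫ x in P.carrier, evalPoly q x * evalPoly q x := by
      have h2 := hdiv φ hφ
      have h3 : ∫ x in P.carrier, fderiv ℝ φ x (y x) = ∫ x in P.carrier, y x 1 := by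
        refine setIntegral_congr_fun hUm fun x hx => ?_
        simp only [(hφU x hx).2]
        rw [fderiv_evalPoly]
        simp [hqd, evalPoly, Fin.sum_univ_two, MvPolynomial.pderiv_X]
      have h4 : ∫ x in P.carrier, evalPoly q x * φ x = ∫ x in P.carrier, evalPoly q x * evalPoly q x :=
        setIntegral_congr_fun hUm fun x hx => by simp only [(hφU x hx).1]
      rw [← h3, h2, h4]
    rw [h1, neg_ne_zero]
    intro h0
    have h2 := (integral_eq_zero_iff_of_nonneg (fun x => mul_self_nonneg _)
      (hintg (hqc.mul hqc))).1 h0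
    have h3 : EqOn (fun x => evalPoly q x * evalPoly q x) 0 P.carrier :=
      Measure.eqOn_open_of_ae_eq h2 P.isOpen (hqc.mul hqc).continuousOn continuousOn_const
    have h4 : ∀ x ∈ P.carrier, x 1 = m := fun x hx => by
      have := mul_self_eq_zero.1 (h3 hx)
      rw [hqe] at this
      linarith
    -- Two points of the ball with different second coordinates show that `q` is not identically
    -- zero on the element.
    have h5 : c + (r / 2) • bas 1 ∈ P.carrier := h.ball_subset (by
      rw [mem_ball_iff_norm, add_sub_cancel_left, norm_smul]
      have := h.pos
      simp [bas, abs_of_pos this]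
      linarith)
    have h6 := h4 _ h5
    have h7 := h4 c h.center_mem
    simp [bas, h7] at h6
    exact h.pos.ne' h6

/-! ### Rotations orthogonal to the stress space -/

/-- An open set contains a box, a product of infinite sets, on which a polynomial is determined by
its values. -/
theorem eq_of_eqOn_open {U : Set E} (hU : IsOpen U) (hne : U.Nonempty)
    {p q : MvPolynomial (Fin 2) ℝ} (h : ∀ x ∈ U, evalPoly p x = evalPoly q x) : p = q := by
  obtain ⟨c, hc⟩ := hne
  have hU' : IsOpen ((WithLp.toLp 2 : (Fin 2 → ℝ) → E) ⁻¹' U) :=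
    hU.preimage (PiLp.continuous_toLp 2 _)
  obtain ⟨ε, hε, hb⟩ := Metric.isOpen_iff.1 hU' (fun l => c l) (by simpa using hc)
  refine MvPolynomial.funext_set (fun l => Metric.ball (c l) ε) (fun l => ?_) fun x hx => ?_
  · rw [Real.ball_eq_Ioo]
    exact Ioo_infinite (by linarith)
  · have hx' : x ∈ Metric.ball (fun l => c l) ε := by
      rw [ball_pi _ hε]
      exact hx
    exact h _ (hb hx')

/-- On an element a skew field is `(0, p; -p, 0)`, and the curls of its two rows are the two partial
derivatives of `p`. Rotational bubbles make these vanish, and a divergence bubble excludes a nonzero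
constant. This is injectivity of `H^*`. -/
theorem eq_zero_of_forall_inner_stressSpace (hΩ : MeasurableSet Ω) (h𝒯 : 𝒯.IsStar) (hk : 1 ≤ k)
    {Γσ : Set E} {η : L2 Ω Tens} (hη : η ∈ rotSpace 𝒯 k)
    (h : ∀ τ ∈ stressSpace 𝒯 Γσ k, inner ℝ τ η = 0) : η = 0 := by
  rw [Lp.eq_zero_iff_ae_eq_zero]
  refine 𝒯.ae_of_forall hΩ fun K => ?_
  obtain ⟨c, r, hK⟩ := h𝒯 K
  set U := (𝒯.elem K).carrier with hU
  have hUo : IsOpen U := (𝒯.elem K).isOpen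
  have hUm : MeasurableSet U := hUo.measurableSet
  obtain ⟨p, hp, hpη⟩ := hη.2 K
  have hbub : ∀ v : L2 U E, IsBubble k (𝒯.elem K) v → ∀ i,
      ∫ x in U, inner ℝ (v x) (evalVec (p i) x) = 0 := by
    intro v hv i
    obtain ⟨τ, hτ, hτη⟩ := hv.exists_extension hΩ Γσ i
    rw [← h τ hτ, hτη η]
    refine integral_congr_ae ?_
    filter_upwards [hpη] with x hx
    rw [hx]
    rfl
  have hskew : ∀ i j, p i j = -p j i := by
    intro i j
    refine eq_of_eqOn_open hUo (𝒯.elem K).nonempty fun x hx => ?_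
    have h1 : (fun x => evalPoly (p i j) x) =ᵐ[volume.restrict U] fun x => evalPoly (-p j i) x := by
      filter_upwards [hpη, ae_restrict_of_ae_restrict_of_subset (𝒯.subset K) hη.1] with x h1 h2
      have := h2 i j
      rw [h1] at this
      simpa [evalPoly, evalTens, evalVec] using this
    exact Measure.eqOn_open_of_ae_eq h1 hUo (contDiff_evalPoly _).continuous.continuousOn
      (contDiff_evalPoly _).continuous.continuousOn hx
  have hdiag : ∀ i, p i i = 0 := fun i => self_eq_neg.1 (hskew i i)
  have hcurl : ∀ i, divPoly (rotPoly p) i = 0 := by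
    intro i
    have hmem := memLp_evalVec (𝒯.elem K) (p i)
    have hwc := hK.hasWeakCurl_poly p
    have hIu : ∀ φ, IsTest φ → tsupport φ ⊆ U →
        ∫ x in U, (fderiv ℝ φ x (rotE (evalVec (p i) x)) +
          evalPoly (divPoly (rotPoly p) i) x * φ x) = 0 := fun φ hφ hs => hwc.2.2 φ hφ hs i
    -- The bubble `z` built from the row itself is orthogonal to that row by assumption, and `⟨z, u⟩
    -- = ⟨z, z⟩` then gives `z = 0`; its curl, which is that of the row, vanishes as well.
    obtain ⟨z, hz, hzq, hzz⟩ := exists_rot_bubble (k := k) (P := 𝒯.elem K) hmem.toLp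
      (divPoly_mem (rotPoly_mem hp) i) fun φ hφ hs => by
        rw [← hIu φ hφ hs]
        refine integral_congr_ae ?_
        filter_upwards [hmem.coeFn_toLp] with x hx
        rw [hx]
    have hz0 : z = 0 := by
      rw [← inner_self_eq_zero (𝕜 := ℝ), ← hzz, L2.inner_def, ← hbub z hz i]
      refine integral_congr_ae ?_
      filter_upwards [hmem.coeFn_toLp] with x hx
      rw [hx]
    have hae : evalPoly (divPoly (rotPoly p) i) =ᵐ[volume.restrict U] 0 := by
      refine ae_eq_zero_of_forall_test hUo (memLp_of_continuous (𝒯.elem K).isBounded hUm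
        (contDiff_evalPoly _).continuous) fun φ hφ hs => ?_
      rw [← hzq φ hφ hs]
      refine integral_congr_ae ?_
      filter_upwards [Lp.coeFn_zero E 2 (volume.restrict U)] with x hx
      rw [hz0, hx]
      simp
    refine eq_of_eqOn_open hUo (𝒯.elem K).nonempty fun x hx => ?_
    have := Measure.eqOn_open_of_ae_eq hae hUo (contDiff_evalPoly _).continuous.continuousOn
      continuousOn_const hx
    simpa [evalPoly] using this
  have hgrad : ∀ j, MvPolynomial.pderiv j (p 0 1) = 0 := by
    intro j
    fin_cases j
    · have := hcurl 0
      simpa [divPoly, rotPoly, Fin.sum_univ_two, hdiag] using this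
    · have := hcurl 1
      simpa [divPoly, rotPoly, Fin.sum_univ_two, hdiag, hskew 1 0] using this
  have hconst : ∀ x, evalPoly (p 0 1) x = evalPoly (p 0 1) c := by
    intro x
    refine is_const_of_fderiv_eq_zero (𝕜 := ℝ) ((contDiff_evalPoly _).differentiable (by simp)) ?_ x c
    intro x
    ext u
    rw [fderiv_evalPoly]
    simp [hgrad, evalPoly]
  have ha : evalPoly (p 0 1) c = 0 := by
    -- Row `0` of the field is now `(0, a)` with `a` constant, so its pairing with the bubble is `a`
    -- times the nonzero integral of the second component.
    obtain ⟨y, hy, hy0⟩ := hK.exists_div_bubble hk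
    have h1 := hbub y hy 0
    have h2 : ∫ x in U, inner ℝ (y x) (evalVec (p 0) x) = (∫ x in U, y x 1) * evalPoly (p 0 1) c := by
      rw [← integral_mul_const]
      refine integral_congr_ae (.of_forall fun x => ?_)
      simp only [inner_eq, evalVec_apply, hconst, hdiag]
      simp [evalPoly]
    rw [h2] at h1
    exact (mul_eq_zero.1 h1).resolve_left hy0
  filter_upwards [hpη] with x hx
  rw [hx]
  ext i j
  have h01 : evalPoly (p 0 1) x = 0 := (hconst x).trans ha
  have h10 : evalPoly (p 1 0) x = 0 := by
    rw [hskew 1 0]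
    simpa [evalPoly] using h01
  rw [evalTens_apply, evalVec_apply]
  fin_cases i <;> fin_cases j
  · simp [hdiag, evalPoly]
  · simpa using h01
  · simpa using h10
  · simp [hdiag, evalPoly]

end

/-! ### The linear evolution equation, the block operators and their invertibility. -/

section

/-! ### Linear differential equations -/

/-- Duhamel's formula `x(t) = e^{tG} (x₀ + ∫₀ᵗ e^{-sG} g(s) ds)`. -/
theorem exists_linear_ode_solution {X : Type*} [NormedAddCommGroup X] [NormedSpace ℝ X]
    [CompleteSpace X] (G : X →L[ℝ] X) {g : ℝ → X} {T : ℝ} (hT : 0 ≤ T)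
    (hg : ContinuousOn g (Icc 0 T)) (x₀ : X) :
    ∃ x : ℝ → X, x 0 = x₀ ∧
      ∀ t ∈ Icc 0 T, HasDerivWithinAt x (G (x t) + g t) (Icc 0 T) t := by
  let : NormedAlgebra ℚ (X →L[ℝ] X) := NormedAlgebra.restrictScalars ℚ ℝ _
  -- The forcing is extended by its end values to a continuous function on the line, so that the
  -- fundamental theorem of calculus gives two-sided derivatives even at `0` and `T`.
  set g' : ℝ → X := IccExtend hT (domRestrict (Icc 0 T) g) with hg'
  have hgc : Continuous g' := hg.domRestrict.Icc_extend'
  have hgg : ∀ t ∈ Icc 0 T, g' t = g t := fun t ht => IccExtend_of_mem hT _ ht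
  let S : ℝ → X →L[ℝ] X := fun t => NormedSpace.exp (t • G)
  have hS : ∀ t, HasDerivAt S (G * S t) t := fun t => hasDerivAt_exp_smul_const' G t
  have hSc : Continuous S := continuous_iff_continuousAt.2 fun t => (hS t).continuousAt
  have hSS : ∀ t, S t * S (-t) = 1 := fun t => by
    have h1 : Commute (t • G) ((-t) • G) :=
      ((Commute.refl G).smul_left t).smul_right (-t)
    have h2 := NormedSpace.exp_add_of_commute h1
    rw [← add_smul, add_neg_cancel, zero_smul, NormedSpace.exp_zero] at h2
    exact h2.symm
  let y : ℝ → X := fun t => x₀ + ∫ s in (0 : ℝ)..t, S (-s) (g' s)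
  have hyc : Continuous fun s => S (-s) (g' s) := (hSc.comp continuous_neg).clm_apply hgc
  have hy : ∀ t, HasDerivAt y (S (-t) (g' t)) t := fun t =>
    (intervalIntegral.integral_hasDerivAt_right (hyc.intervalIntegrable _ _)
      (hyc.stronglyMeasurableAtFilter _ _) hyc.continuousAt).const_add x₀
  refine ⟨fun t => S t (y t), by simp [S, y], fun t ht => ?_⟩
  have h1 := ((hS t).clm_apply (hy t)).hasDerivWithinAt (s := Icc 0 T)
  have h2 : S t (S (-t) (g' t)) = g t := by
    rw [← hgg t ht]
    exact congrArg (fun A : X →L[ℝ] X => A (g' t)) (hSS t)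
  rw [h2] at h1
  exact h1

theorem linear_ode_unique {X : Type*} [NormedAddCommGroup X] [NormedSpace ℝ X] (G : X →L[ℝ] X)
    {g : ℝ → X} {T : ℝ} {x y : ℝ → X} (h0 : x 0 = y 0)
    (hx : ∀ t ∈ Icc 0 T, HasDerivWithinAt x (G (x t) + g t) (Icc 0 T) t)
    (hy : ∀ t ∈ Icc 0 T, HasDerivWithinAt y (G (y t) + g t) (Icc 0 T) t) :
    EqOn x y (Icc 0 T) := by
  -- Grönwall uniqueness only needs right derivatives on `[0, T)`.
  have hcond : ∀ {z : ℝ → X}, (∀ t ∈ Icc 0 T, HasDerivWithinAt z (G (z t) + g t) (Icc 0 T) t) →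
      ∀ t ∈ Ico 0 T, HasDerivWithinAt z (G (z t) + g t) (Ici t) t := fun hz t ht =>
    (hz t (Ico_subset_Icc_self ht)).mono_of_mem_nhdsWithin (Icc_mem_nhdsGE_of_mem ht)
  refine ODE_solution_unique (v := fun t z => G z + g t) (K := ‖G‖₊)
    (fun t => by simpa using G.lipschitz.add (LipschitzWith.const (g t))) (fun t ht => (hx t ht).continuousWithinAt)
    (hcond hx) (fun t ht => (hy t ht).continuousWithinAt) (hcond hy) h0

/-! ### The weak divergence -/

variable {Ω : Set E} {𝒯 : Mesh Ω} {Γσ : Set E} {k : ℕ}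

theorem hasWeakDiv_weakDiv {τ : L2 Ω Tens} (hτ : τ ∈ stressSpace 𝒯 Γσ k) :
    HasWeakDiv Ω τ (weakDiv τ) := by
  have hex : ∃ d : L2 Ω E, HasWeakDiv Ω τ d := by
    obtain ⟨d, hd, -⟩ := hτ.1
    refine ⟨hd.2.1.toLp, hd.1, Lp.memLp _, fun φ hφ hs i => ?_⟩
    rw [green_congr (Filter.EventuallyEq.refl _ _) hd.2.1.coeFn_toLp]
    exact hd.2.2 φ hφ hs i
  rw [weakDiv, dif_pos hex]
  exact hex.choose_spec

/-- The weak divergence as a linear map on the stress space. -/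
def divL (hΩ : IsOpen Ω) (𝒯 : Mesh Ω) (Γσ : Set E) (k : ℕ) : stressSpace 𝒯 Γσ k →ₗ[ℝ] L2 Ω E where
  toFun τ := weakDiv τ
  map_add' σ τ := by
    refine Lp.ext (((hasWeakDiv_weakDiv (σ + τ).2).ae_unique hΩ
      (((hasWeakDiv_weakDiv σ.2).add (hasWeakDiv_weakDiv τ.2)).congr ?_)).trans
        (Lp.coeFn_add _ _).symm)
    exact (Lp.coeFn_add σ.1 τ.1).symm
  map_smul' a τ := by
    refine Lp.ext (((hasWeakDiv_weakDiv (a • τ).2).ae_unique hΩ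
      (((hasWeakDiv_weakDiv τ.2).smul a).congr ?_)).trans (Lp.coeFn_smul _ _).symm)
    exact (Lp.coeFn_smul a τ.1).symm

theorem weakDiv_add (hΩ : IsOpen Ω) (σ τ : stressSpace 𝒯 Γσ k) :
    weakDiv (σ + τ : L2 Ω Tens) = weakDiv (σ : L2 Ω Tens) + weakDiv (τ : L2 Ω Tens) :=
  (divL hΩ 𝒯 Γσ k).map_add σ τ

/-! ### Riesz representatives -/

section Riesz

variable {H V : Type*} [NormedAddCommGroup H] [InnerProductSpace ℝ H] [AddCommGroup V] [Module ℝ V]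
  (W : Submodule ℝ H) [FiniteDimensional ℝ W]

theorem inner_riesz (l : W →ₗ[ℝ] ℝ) (z : W) : inner ℝ (riesz W l) z = l z := by
  have hex : ∃ w : W, ∀ z : W, inner ℝ w z = l z :=
    ⟨(InnerProductSpace.toDual ℝ W).symm l.toContinuousLinearMap, fun z => by
      rw [InnerProductSpace.toDual_symm_apply]; rfl⟩
  rw [riesz, dif_pos hex]
  exact hex.choose_spec z

/-- The operator associated with a bilinear form. -/
def rieszL (B : V →ₗ[ℝ] W →ₗ[ℝ] ℝ) : V →ₗ[ℝ] W where
  toFun v := riesz W (B v)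
  map_add' u v := ext_inner_right ℝ fun z => by
    rw [inner_add_left, inner_riesz, inner_riesz, inner_riesz, map_add, LinearMap.add_apply]
  map_smul' a v := ext_inner_right ℝ fun z => by
    rw [RingHom.id_apply, real_inner_smul_left, inner_riesz, inner_riesz, map_smul,
      LinearMap.smul_apply, smul_eq_mul]

theorem inner_rieszL (B : V →ₗ[ℝ] W →ₗ[ℝ] ℝ) (v : V) (z : W) : inner ℝ (rieszL W B v) z = B v z :=
  inner_riesz W (B v) z

/-- In this form the load depends visibly linearly and continuously on `f`. -/
theorem riesz_inner_eq_orthogonalProjectionOnto (u : H) :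
    riesz W (fun w => inner ℝ u (w : H)) = W.orthogonalProjectionOnto u :=
  ext_inner_right ℝ fun z => by
    rw [Submodule.inner_orthogonalProjectionOnto_eq_of_mem_right]
    exact inner_riesz W ((innerₗ H u).comp W.subtype) z

end Riesz

/-! ### The block operators -/

/-- The operator `opA` as a linear map. -/
def opAL (h𝒯 : 𝒯.IsStar) (b : DofBasis 𝒯 k) (Γσ : Set E) [FiniteDimensional ℝ (stressSpace 𝒯 Γσ k)]
    (L : Lame) : stressSpace 𝒯 Γσ k →ₗ[ℝ] stressSpace 𝒯 Γσ k :=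
  rieszL _ (stressBil h𝒯 b L Γσ)

theorem opAL_apply [FiniteDimensional ℝ (stressSpace 𝒯 Γσ k)]
    (h𝒯 : 𝒯.IsStar) (b : DofBasis 𝒯 k) (L : Lame) (σ : stressSpace 𝒯 Γσ k) :
    opAL h𝒯 b Γσ L σ = opA b Γσ L σ := rfl

theorem inner_opA [FiniteDimensional ℝ (stressSpace 𝒯 Γσ k)]
    (h𝒯 : 𝒯.IsStar) (b : DofBasis 𝒯 k) (L : Lame) (σ τ : stressSpace 𝒯 Γσ k) :
    inner ℝ (opA b Γσ L σ) τ = stressForm b L σ τ :=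
  inner_rieszL _ (stressBil h𝒯 b L Γσ) σ τ

/-- The operator `opH` as a linear map. -/
def opHL (𝒯 : Mesh Ω) (Γσ : Set E) (k : ℕ) [FiniteDimensional ℝ (rotSpace 𝒯 k)] :
    stressSpace 𝒯 Γσ k →ₗ[ℝ] rotSpace 𝒯 k :=
  rieszL _ ((innerₗ (L2 Ω Tens)).compl₁₂ (stressSpace 𝒯 Γσ k).subtype (rotSpace 𝒯 k).subtype)

theorem opHL_apply [FiniteDimensional ℝ (rotSpace 𝒯 k)]
    (σ : stressSpace 𝒯 Γσ k) : opHL 𝒯 Γσ k σ = opH 𝒯 Γσ k σ := rfl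

theorem inner_opH [FiniteDimensional ℝ (rotSpace 𝒯 k)]
    (σ : stressSpace 𝒯 Γσ k) (η : rotSpace 𝒯 k) :
    inner ℝ (opH 𝒯 Γσ k σ) η = inner ℝ (σ : L2 Ω Tens) (η : L2 Ω Tens) :=
  inner_rieszL _ ((innerₗ (L2 Ω Tens)).compl₁₂ (stressSpace 𝒯 Γσ k).subtype
    (rotSpace 𝒯 k).subtype) σ η

/-- The operator `opJ` as a linear map. -/
def opJL (hΩ : IsOpen Ω) (𝒯 : Mesh Ω) (Γσ : Set E) (k : ℕ) [FiniteDimensional ℝ (velSpace 𝒯 k)] :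
    stressSpace 𝒯 Γσ k →ₗ[ℝ] velSpace 𝒯 k :=
  rieszL _ ((innerₗ (L2 Ω E)).compl₁₂ (divL hΩ 𝒯 Γσ k) (velSpace 𝒯 k).subtype)

theorem opJL_apply [FiniteDimensional ℝ (velSpace 𝒯 k)]
    (hΩ : IsOpen Ω) (σ : stressSpace 𝒯 Γσ k) :
    opJL hΩ 𝒯 Γσ k σ = opJ 𝒯 Γσ k σ := rfl

theorem inner_opJ [FiniteDimensional ℝ (velSpace 𝒯 k)]
    (hΩ : IsOpen Ω) (σ : stressSpace 𝒯 Γσ k) (w : velSpace 𝒯 k) :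
    inner ℝ (opJ 𝒯 Γσ k σ) w = inner ℝ (weakDiv (σ : L2 Ω Tens)) (w : L2 Ω E) :=
  inner_rieszL _ ((innerₗ (L2 Ω E)).compl₁₂ (divL hΩ 𝒯 Γσ k) (velSpace 𝒯 k).subtype) σ w

/-- The operator `opHadj` as a linear map. -/
def opHadjL (𝒯 : Mesh Ω) (Γσ : Set E) (k : ℕ) [FiniteDimensional ℝ (stressSpace 𝒯 Γσ k)]
    [FiniteDimensional ℝ (rotSpace 𝒯 k)] : rotSpace 𝒯 k →ₗ[ℝ] stressSpace 𝒯 Γσ k :=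
  rieszL _ ((innerₗ (rotSpace 𝒯 k)).compl₂ (opHL 𝒯 Γσ k))

theorem opHadjL_apply [FiniteDimensional ℝ (stressSpace 𝒯 Γσ k)] [FiniteDimensional ℝ (rotSpace 𝒯 k)]
    (η : rotSpace 𝒯 k) : opHadjL 𝒯 Γσ k η = opHadj 𝒯 Γσ k η := rfl

theorem inner_opHadj [FiniteDimensional ℝ (stressSpace 𝒯 Γσ k)] [FiniteDimensional ℝ (rotSpace 𝒯 k)]
    (η : rotSpace 𝒯 k) (τ : stressSpace 𝒯 Γσ k) :
    inner ℝ (opHadj 𝒯 Γσ k η) τ = inner ℝ (τ : L2 Ω Tens) (η : L2 Ω Tens) := by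
  rw [← inner_opH, real_inner_comm η]
  exact inner_rieszL _ ((innerₗ (rotSpace 𝒯 k)).compl₂ (opHL 𝒯 Γσ k)) η τ

/-- The operator `opJadj` as a linear map. -/
def opJadjL (hΩ : IsOpen Ω) (𝒯 : Mesh Ω) (Γσ : Set E) (k : ℕ)
    [FiniteDimensional ℝ (stressSpace 𝒯 Γσ k)] [FiniteDimensional ℝ (velSpace 𝒯 k)] :
    velSpace 𝒯 k →ₗ[ℝ] stressSpace 𝒯 Γσ k :=
  rieszL _ ((innerₗ (velSpace 𝒯 k)).compl₂ (opJL hΩ 𝒯 Γσ k))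

theorem opJadjL_apply [FiniteDimensional ℝ (stressSpace 𝒯 Γσ k)] [FiniteDimensional ℝ (velSpace 𝒯 k)]
    (hΩ : IsOpen Ω) (w : velSpace 𝒯 k) :
    opJadjL hΩ 𝒯 Γσ k w = opJadj 𝒯 Γσ k w := rfl

theorem inner_opJadj [FiniteDimensional ℝ (stressSpace 𝒯 Γσ k)] [FiniteDimensional ℝ (velSpace 𝒯 k)]
    (hΩ : IsOpen Ω) (w : velSpace 𝒯 k) (τ : stressSpace 𝒯 Γσ k) :
    inner ℝ (opJadj 𝒯 Γσ k w) τ = inner ℝ (weakDiv (τ : L2 Ω Tens)) (w : L2 Ω E) := by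
  rw [← inner_opJ hΩ, real_inner_comm w]
  exact inner_rieszL _ ((innerₗ (velSpace 𝒯 k)).compl₂ (opJL hΩ 𝒯 Γσ k)) w τ

/-- The block operator `blockA` as a linear map. -/
def blockAL (h𝒯 : 𝒯.IsStar) (b : DofBasis 𝒯 k) (Γσ : Set E)
    [FiniteDimensional ℝ (stressSpace 𝒯 Γσ k)] [FiniteDimensional ℝ (rotSpace 𝒯 k)]
    (ρ : ℝ) (L₀ L₁ : Lame) : State 𝒯 Γσ k →ₗ[ℝ] State 𝒯 Γσ k where
  toFun := blockA b Γσ ρ L₀ L₁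
  map_add' x y := by
    simp only [blockA, ← opAL_apply h𝒯, ← opHL_apply, ← opHadjL_apply, Prod.fst_add, Prod.snd_add,
      map_add, smul_add, Prod.mk_add_mk]
    refine Prod.ext ?_ (Prod.ext ?_ (Prod.ext rfl ?_)) <;> exact add_add_add_comm _ _ _ _
  map_smul' a x := by
    simp only [blockA, ← opAL_apply h𝒯, ← opHL_apply, ← opHadjL_apply, Prod.smul_fst, Prod.smul_snd,
      map_smul, smul_add, Prod.smul_mk, RingHom.id_apply, smul_comm ρ a]

/-- The block operator `blockB` as a linear map. -/
def blockBL (hΩ : IsOpen Ω) (h𝒯 : 𝒯.IsStar) (b : DofBasis 𝒯 k) (Γσ : Set E)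
    [FiniteDimensional ℝ (stressSpace 𝒯 Γσ k)] [FiniteDimensional ℝ (velSpace 𝒯 k)]
    (L₀' : Lame) : State 𝒯 Γσ k →ₗ[ℝ] State 𝒯 Γσ k where
  toFun := blockB b Γσ L₀'
  map_add' x y := by
    simp only [blockB, ← opAL_apply h𝒯, ← opJL_apply hΩ, ← opJadjL_apply hΩ, Prod.fst_add,
      Prod.snd_add, map_add, Prod.mk_add_mk]
    refine Prod.ext ?_ (Prod.ext ?_ (Prod.ext ?_ ?_)) <;> simp only [add_zero] <;> abel
  map_smul' a x := by
    simp only [blockB, ← opAL_apply h𝒯, ← opJL_apply hΩ, ← opJadjL_apply hΩ, Prod.smul_fst,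
      Prod.smul_snd, map_smul, smul_add, smul_sub, smul_neg, smul_zero, Prod.smul_mk,
      RingHom.id_apply]

/-- Elements of a discrete space are equal when they pair equally with that space. Doing this in
each component, and unfolding the operators and adjoints by their defining pairings, leaves only a
rearrangement of signs. -/
theorem blockA_eq_iff [FiniteDimensional ℝ (stressSpace 𝒯 Γσ k)] [FiniteDimensional ℝ (velSpace 𝒯 k)]
    [FiniteDimensional ℝ (rotSpace 𝒯 k)]
    (hΩ : IsOpen Ω) (h𝒯 : 𝒯.IsStar) (b : DofBasis 𝒯 k) (ρ : ℝ)
    (L₀ L₁ L₀' : Lame) (x x' : State 𝒯 Γσ k) (g : L2 Ω E) :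
    blockA b Γσ ρ L₀ L₁ x' = blockB b Γσ L₀' x + blockC 𝒯 Γσ k ρ g ↔
      (∀ τ : stressSpace 𝒯 Γσ k,
        stressForm b L₀ x'.1 τ + stressForm b L₀' x.1 τ +
          inner ℝ (weakDiv (τ : L2 Ω Tens)) (x.2.2.1 : L2 Ω E) +
          inner ℝ (τ : L2 Ω Tens) (x'.2.2.2 : L2 Ω Tens) = 0) ∧
      (∀ τ : stressSpace 𝒯 Γσ k,
        stressForm b L₁ x'.2.1 τ +
          inner ℝ (weakDiv (τ : L2 Ω Tens)) (x.2.2.1 : L2 Ω E) +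
          inner ℝ (τ : L2 Ω Tens) (x'.2.2.2 : L2 Ω Tens) = 0) ∧
      (∀ w : velSpace 𝒯 k,
        inner ℝ (ρ • (x'.2.2.1 : L2 Ω E)) (w : L2 Ω E) -
          inner ℝ (weakDiv (x.1 + x.2.1 : L2 Ω Tens)) (w : L2 Ω E) -
          inner ℝ (ρ • g) (w : L2 Ω E) = 0) ∧
      ∀ η : rotSpace 𝒯 k,
        inner ℝ (x'.1 + x'.2.1 : L2 Ω Tens) (η : L2 Ω Tens) = 0 := by
  have hext : ∀ {H : Type} [NormedAddCommGroup H] [InnerProductSpace ℝ H] {u v : H},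
      u = v ↔ ∀ z, inner ℝ u z = inner ℝ v z := fun {H} _ _ u v =>
    ⟨fun h z => by rw [h], fun h => ext_inner_right ℝ h⟩
  unfold blockA blockB blockC
  simp only [Prod.mk_add_mk, Prod.mk.injEq, add_zero]
  refine and_congr ?_ (and_congr ?_ (and_congr ?_ ?_))
  · rw [hext]
    refine forall_congr' fun τ => ?_
    rw [inner_add_left, inner_sub_left, inner_neg_left, inner_opA h𝒯, inner_opA h𝒯, inner_opHadj,
      inner_opJadj hΩ]
    constructor <;> intro h <;> linarith
  · rw [hext]
    refine forall_congr' fun τ => ?_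
    rw [inner_add_left, inner_neg_left, inner_opA h𝒯, inner_opHadj, inner_opJadj hΩ]
    constructor <;> intro h <;> linarith
  · rw [hext]
    refine forall_congr' fun w => ?_
    have h1 := inner_riesz (velSpace 𝒯 k)
      ((innerₗ (L2 Ω E) (ρ • g)).comp (velSpace 𝒯 k).subtype) w
    have h2 : inner ℝ (ρ • x'.2.2.1) w = inner ℝ (ρ • (x'.2.2.1 : L2 Ω E)) (w : L2 Ω E) := rfl
    rw [inner_add_left, inner_add_left, inner_opJ hΩ, inner_opJ hΩ, weakDiv_add hΩ, inner_add_left,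
      h2]
    change _ = _ + inner ℝ (riesz (velSpace 𝒯 k)
      ((innerₗ (L2 Ω E) (ρ • g)).comp (velSpace 𝒯 k).subtype)) w ↔ _
    rw [h1]
    change _ = _ + inner ℝ (ρ • g) (w : L2 Ω E) ↔ _
    constructor <;> intro h <;> linarith
  · rw [hext]
    refine forall_congr' fun η => ?_
    rw [inner_add_left, inner_opH, inner_opH, inner_zero_left, inner_add_left]

/-- In finite dimension injectivity suffices. For a kernel element, the fourth row cancels the
rotation terms in the sum of the first two rows tested with `σ₀` and `σ₁`; definiteness removes the
stresses, and the first row then says that `r` is orthogonal to the stress space. -/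
theorem bijective_blockA [FiniteDimensional ℝ (stressSpace 𝒯 Γσ k)] [FiniteDimensional ℝ (velSpace 𝒯 k)]
    [FiniteDimensional ℝ (rotSpace 𝒯 k)]
    (hΩ : IsOpen Ω) (h𝒯 : 𝒯.IsStar) (hk : 1 ≤ k) (b : DofBasis 𝒯 k) {ρ : ℝ}
    (hρ : 0 < ρ) (L₀ L₁ : Lame) : Function.Bijective (blockA b Γσ ρ L₀ L₁) := by
  have hinj : Function.Injective (blockAL h𝒯 b Γσ ρ L₀ L₁) := by
    refine (injective_iff_map_eq_zero _).2 fun x hx => ?_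
    obtain ⟨σ₀, σ₁, v, r⟩ := x
    have h1 : opA b Γσ L₀ σ₀ + opHadj 𝒯 Γσ k r = 0 := congrArg Prod.fst hx
    have h2 : opA b Γσ L₁ σ₁ + opHadj 𝒯 Γσ k r = 0 := congrArg (fun z => z.2.1) hx
    have h3 : ρ • v = 0 := congrArg (fun z => z.2.2.1) hx
    have h4 : opH 𝒯 Γσ k σ₀ + opH 𝒯 Γσ k σ₁ = 0 := congrArg (fun z => z.2.2.2) hx
    have e1 : ∀ τ : stressSpace 𝒯 Γσ k, stressForm b L₀ σ₀ τ +
        inner ℝ (τ : L2 Ω Tens) (r : L2 Ω Tens) = 0 := fun τ => by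
      rw [← inner_opA h𝒯, ← inner_opHadj, ← inner_add_left, h1, inner_zero_left]
    have e2 : ∀ τ : stressSpace 𝒯 Γσ k, stressForm b L₁ σ₁ τ +
        inner ℝ (τ : L2 Ω Tens) (r : L2 Ω Tens) = 0 := fun τ => by
      rw [← inner_opA h𝒯, ← inner_opHadj, ← inner_add_left, h2, inner_zero_left]
    have e3 : inner ℝ (σ₀ : L2 Ω Tens) (r : L2 Ω Tens) +
        inner ℝ (σ₁ : L2 Ω Tens) (r : L2 Ω Tens) = 0 := by
      rw [← inner_opH, ← inner_opH, ← inner_add_left, h4, inner_zero_left]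
    have n1 := stressForm_self_nonneg b L₀ (σ₀ : L2 Ω Tens)
    have n2 := stressForm_self_nonneg b L₁ (σ₁ : L2 Ω Tens)
    have s1 := e1 σ₀
    have s2 := e2 σ₁
    have z1 : σ₀ = 0 := eq_zero_of_stressForm_self hΩ.measurableSet h𝒯 hk b L₀ (by linarith)
    have z2 : σ₁ = 0 := eq_zero_of_stressForm_self hΩ.measurableSet h𝒯 hk b L₁ (by linarith)
    have z3 : v = 0 := (smul_eq_zero.1 h3).resolve_left hρ.ne'
    have z4 : r = 0 := by
      ext1
      refine eq_zero_of_forall_inner_stressSpace hΩ.measurableSet h𝒯 hk r.2 (Γσ := Γσ) fun τ hτ => ?_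
      have h5 := e1 ⟨τ, hτ⟩
      have h6 : stressForm b L₀ σ₀ τ = 0 := by
        rw [z1]
        exact LinearMap.congr_fun (map_zero (stressBil h𝒯 b L₀ Γσ)) ⟨τ, hτ⟩
      rwa [h6, zero_add] at h5
    rw [z1, z2, z3, z4]
    rfl
  exact ⟨hinj, LinearMap.surjective_of_injective hinj⟩

theorem continuousOn_blockC [FiniteDimensional ℝ (velSpace 𝒯 k)] (ρ : ℝ) {f : ℝ → L2 Ω E}
    {s : Set ℝ} (hf : ContinuousOn f s) :
    ContinuousOn (fun t => blockC 𝒯 Γσ k ρ (f t)) s := by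
  simp only [blockC, riesz_inner_eq_orthogonalProjectionOnto]
  exact continuousOn_const.prodMk (continuousOn_const.prodMk
    (((velSpace 𝒯 k).orthogonalProjectionOnto.continuous.comp_continuousOn
      (hf.const_smul ρ)).prodMk continuousOn_const))

end

end ViscoVEM

end

open MeasureTheory Set ViscoVEM in
/-- Unique solvability of the semi-discrete problem: the operator form of the system is equivalent
to the variational one, and it has exactly one `C¹` solution on `[0, T]` for each initial datum. -/
theorem mainTheorem7
    (Ω Γu Γσ : Set E) (hΩ : IsPolygonalDomain Ω) (hΓ : IsBoundaryPartition Ω Γu Γσ)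
    (𝒯 : Mesh Ω) (η₁ η₂ : ℝ) (hη₁ : 0 < η₁) (hη₂ : 0 < η₂) (h𝒯 : 𝒯.IsRegular η₁ η₂)
    (k : ℕ) (hk : 1 ≤ k) (b : DofBasis 𝒯 k)
    (ρ : ℝ) (hρ : 0 < ρ) (L₀ L₁ L₀' : Lame)
    (T : ℝ) (hT : 0 < T) (f : ℝ → L2 Ω E) (hf : ContinuousOn f (Icc 0 T))
    (x₀ : State 𝒯 Γσ k) :
    (∀ x : ℝ → State 𝒯 Γσ k,
      SolvesODE b Γσ ρ L₀ L₁ L₀' T f x₀ x ↔ SolvesVariational b Γσ ρ L₀ L₁ L₀' T f x₀ x) ∧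
    Function.Bijective (blockA b Γσ ρ L₀ L₁) ∧
    ∃ x : ℝ → State 𝒯 Γσ k, SolvesODE b Γσ ρ L₀ L₁ L₀' T f x₀ x ∧
      ∀ y : ℝ → State 𝒯 Γσ k, SolvesODE b Γσ ρ L₀ L₁ L₀' T f x₀ y → EqOn y x (Icc 0 T) := by
  have hstar : 𝒯.IsStar := fun K => h𝒯.exists_starBall hη₁ K
  have hm : MeasurableSet Ω := hΩ.isOpen.measurableSet
  have fS := finiteDimensional_stressSpace hm hstar hk b Γσ
  have fV := finiteDimensional_velSpace hm 𝒯 k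
  have fR := finiteDimensional_rotSpace hm 𝒯 k
  have hbij := bijective_blockA (Γσ := Γσ) hΩ.isOpen hstar hk b hρ L₀ L₁
  refine ⟨fun x => ?_, hbij, ?_⟩
  · refine and_congr_right fun _ => exists_congr fun x' => and_congr_right fun _ =>
      forall₂_congr fun t _ => and_congr_right fun _ => ?_
    exact blockA_eq_iff hΩ.isOpen hstar b ρ L₀ L₁ L₀' (x t) (x' t) (f t)
  · let A := LinearEquiv.ofBijective (blockAL hstar b Γσ ρ L₀ L₁) hbij
    -- Explicit form of the system: `G = 𝒜⁻¹ ℬ` and `g = 𝒜⁻¹ 𝒞`, both continuous because the state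
    -- space is finite dimensional.
    let G : State 𝒯 Γσ k →L[ℝ] State 𝒯 Γσ k :=
      (A.symm.toLinearMap.comp (blockBL hΩ.isOpen hstar b Γσ L₀')).toContinuousLinearMap
    let g : ℝ → State 𝒯 Γσ k := fun t => A.symm (blockC 𝒯 Γσ k ρ (f t))
    have hg : ContinuousOn g (Icc 0 T) :=
      A.symm.toLinearMap.continuous_of_finiteDimensional.comp_continuousOn (continuousOn_blockC ρ hf)
    have hiff : ∀ x x' t, blockA b Γσ ρ L₀ L₁ x' = blockB b Γσ L₀' x + blockC 𝒯 Γσ k ρ (f t) ↔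
        x' = G x + g t := fun x x' t => by
      have h1 : G x + g t = A.symm (blockB b Γσ L₀' x + blockC 𝒯 Γσ k ρ (f t)) :=
        (map_add A.symm _ _).symm
      rw [h1, LinearEquiv.eq_symm_apply]
      rfl
    obtain ⟨x, hx0, hx⟩ := exists_linear_ode_solution G hT.le hg x₀
    refine ⟨x, ⟨hx0, fun t => G (x t) + g t, ?_, fun t ht => ⟨hx t ht, (hiff _ _ _).2 rfl⟩⟩, ?_⟩
    -- The `C¹` regularity comes from the equation: its right-hand side is continuous once the
    -- solution is.
    · exact (G.continuous.comp_continuousOn fun t ht => (hx t ht).continuousWithinAt).add hg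
    · rintro y ⟨hy0, y', -, hy⟩
      refine linear_ode_unique G (hy0.trans hx0.symm) (fun t ht => ?_) hx
      rw [← (hiff _ _ _).1 (hy t ht).2]
      exact (hy t ht).1
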